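/- Let $\lambda\ge 1$ be an integer, $D=2\lambda+2$, and $0<\beta<\lambda+1=D/2$. For $h>0$ put $a_h(\beta)=\dfrac{\Gamma(h-\beta)}{4^{\beta}\pi^{h}\Gamma(\beta)}$. For $L\ge 0$ and pairwise distinct points $x_1,x_2,x_3,x_4\in\mathbb R^D$ consider the $L$-loop conformal ladder integral (with $w_0=x_1$, $w_{L+1}=x_3$) $$I^{(L)}=\int_{(\mathbb R^D)^L}\prod_{i=1}^{L}\frac{d^Dw_i}{|x_2-w_i|^{2\beta}\,|x_4-w_i|^{2\beta}}\;\prod_{m=0}^{L}\frac{1}{|w_m-w_{m+1}|^{2(D/2-\beta)}},\qquad f_L=|x_{24}|^{2L\beta}\,|x_{13}|^{2(D/2-\beta)}\,I^{(L)} .$$ The number $f_L$ depends only on the cross-ratios $$\frac{x_{12}^2x_{34}^2}{x_{24}^2x_{13}^2}=\frac{z\bar z}{(1-z)(1-\bar z)},\qquad \frac{x_{14}^2x_{23}^2}{x_{24}^2x_{13}^2}=\frac{1}{(1-z)(1-\bar z)},$$ where $z\in\mathbb C$ and $\bar z$ is its conjugate, so that there is a well-defined function $$\widetilde\Phi^{(\beta)}_L(z,\bar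 z;\lambda)=a_{\lambda+1}(\beta)^{L+1}\,2\pi^{\lambda+2}\,\frac{(z\bar z)^{1/2}}{\bigl((1-z)(1-\bar z)\bigr)^{\lambda-\beta+1}}\,f_L .$$ Let $R_d=\dfrac{1}{z-\bar z}\,(z\partial_z-\bar z\partial_{\bar z})$, and let $\widehat H_{-\beta}=(-i\partial)^{-2\beta}\,|x|^{-2\beta}$ on the plane $\mathbb R^2=\mathbb C$, that is, $$(\widehat H_{-\beta}f)(x)=\int_{\mathbb C}K_\beta(|x-y|)\,|y|^{-2\beta}f(y)\,d^2y ,$$ where $K_\beta(r)=a_1(\beta)\,r^{2\beta-2}$ if $\beta$ is not an integer and $K_\beta(r)=\dfrac{2(-1)^{\beta}}{4^{\beta}\pi\,\Gamma(\beta)^2}\,r^{2\beta-2}\log r$ if $\beta$ is a positive integer; the integral is taken in polar coordinates of $y$, over the angle first. Then the operator $$R^{(\beta)}_\ell(\lambda)=(R_d)^{\lambda}\,\sqrt{z\bar z}\;\widehat H_{-\beta}\,\frac{1}{\sqrt{z\bar z}}\,(R_d)^{-\lambda}$$ raises the loop number: for every $L\ge0$, on $\mathbb C\setminus\mathbb R$,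 $$R^{(\beta)}_\ell(\lambda)\,\widetilde\Phi^{(\beta)}_L(z,\bar z;\lambda)=\widetilde\Phi^{(\beta)}_{L+1}(z,\bar z;\lambda).$$ Here $(R_d)^{-\lambda}F$ stands for any function $g$, symmetric under $z\leftrightarrow\bar z$, with $(R_d)^{\lambda}g=F$ on $\mathbb C\setminus\mathbb R$, for which the integral that defines $\widehat H_{-\beta}\bigl(g/\sqrt{z\bar z}\bigr)$ converges at every point of $\mathbb C\setminus\mathbb R$. Such a $g$ exists for $F=\widetilde\Phi^{(\beta)}_L(\cdot\,;\lambda)$, and the equation holds for every choice of it. The operator $z\partial_z-\bar z\partial_{\bar z}$ is understood as $-i$ times the derivative along the rotations $z\mapsto e^{it}z$. -/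

import Mathlib

open MeasureTheory

namespace LadderShift

noncomputable section

/-! ### The conformal four-point ladder integrals in dimension `D = 2 l + 2` -/

/-- Euclidean space `ℝ^D` with `D = 2 l + 2`, i.e. `l = D / 2 - 1`. -/
abbrev Space (l : ℕ) : Type := EuclideanSpace ℝ (Fin (2 * l + 2))

/-- The `L`-loop ladder integral with index `β` on the lines that go to `x₂` and `x₄` and index
`γ` on the lines of the chain `x₁, w₁, …, w_L, x₃`. A line of index `a` from `p` to `q` stands for
`1 / (|p - q|²)^a`. -/
def ladderIntegral (l : ℕ) (β γ : ℝ) (L : ℕ) (x₁ x₂ x₃ x₄ : Space l) : ℝ :=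
  ∫ w : Fin L → Space l,
    (∏ i : Fin L, ‖x₂ - w i‖ ^ (-(2 * β)) * ‖x₄ - w i‖ ^ (-(2 * β))) *
      ∏ m : Fin (L + 1),
        ‖(Fin.cons x₁ (Fin.snoc w x₃ : Fin (L + 1) → Space l) : Fin (L + 2) → Space l) m.castSucc -
          (Fin.cons x₁ (Fin.snoc w x₃ : Fin (L + 1) → Space l) : Fin (L + 2) → Space l) m.succ‖
          ^ (-(2 * γ))

/-- The conformally invariant normalization
`f_L = |x₂₄|^{2 L β} |x₁₃|^{2 (D/2 - β)} I_L`, where `γ = D / 2 - β`. -/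
def ladderF (l : ℕ) (β : ℝ) (L : ℕ) (x₁ x₂ x₃ x₄ : Space l) : ℝ :=
  ‖x₂ - x₄‖ ^ (2 * L * β) * ‖x₁ - x₃‖ ^ (2 * ((l : ℝ) + 1 - β)) *
    ladderIntegral l β ((l : ℝ) + 1 - β) L x₁ x₂ x₃ x₄

/-- The constant `a(β) = Γ(h - β) / (4^β π^h Γ(β))`, `h = D / 2`: the kernel of `p^{-2β}` on `ℝ^D`
is `a(β) / |x - y|^{2 (h - β)}`. -/
def propConst (h β : ℝ) : ℝ :=
  Real.Gamma (h - β) / ((4 : ℝ) ^ β * Real.pi ^ h * Real.Gamma β)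

/-- Four distinct points whose cross-ratios are
`u = z z̄ / ((1 - z) (1 - z̄))` and `v = 1 / ((1 - z) (1 - z̄))`. -/
structure IsConfiguration (l : ℕ) (z : ℂ) (x₁ x₂ x₃ x₄ : Space l) : Prop where
  ne₁₂ : x₁ ≠ x₂
  ne₁₃ : x₁ ≠ x₃
  ne₁₄ : x₁ ≠ x₄
  ne₂₃ : x₂ ≠ x₃
  ne₂₄ : x₂ ≠ x₄
  ne₃₄ : x₃ ≠ x₄
  cross_u : (‖x₁ - x₂‖ ^ 2 * ‖x₃ - x₄‖ ^ 2) / (‖x₂ - x₄‖ ^ 2 * ‖x₁ - x₃‖ ^ 2) =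
    ‖z‖ ^ 2 / ‖1 - z‖ ^ 2
  cross_v : (‖x₁ - x₄‖ ^ 2 * ‖x₂ - x₃‖ ^ 2) / (‖x₂ - x₄‖ ^ 2 * ‖x₁ - x₃‖ ^ 2) =
    1 / ‖1 - z‖ ^ 2

/-- `Φ` is the normalized `L`-loop conformal ladder function
`a(β)^{L+1} 2 π^{l+2} (z z̄)^{1/2} / ((1 - z) (1 - z̄))^{l - β + 1} f_L` of the complex variable `z`
(`z̄` is the conjugate of `z`), whatever configuration of four points represents `z`. -/
def IsLadderFunction (l : ℕ) (β : ℝ) (L : ℕ) (Φ : ℂ → ℂ) : Prop :=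
  ∀ (z : ℂ) (x₁ x₂ x₃ x₄ : Space l), IsConfiguration l z x₁ x₂ x₃ x₄ →
    Φ z = ((propConst ((l : ℝ) + 1) β ^ (L + 1) * (2 * Real.pi ^ (l + 2)) *
      (‖z‖ / (‖1 - z‖ ^ 2) ^ ((l : ℝ) - β + 1)) * ladderF l β L x₁ x₂ x₃ x₄ : ℝ) : ℂ)

/-! ### The operator `R_d = (z - z̄)⁻¹ (z ∂_z - z̄ ∂_z̄)`

The field `z ∂_z - z̄ ∂_z̄` is `-i` times the generator of the rotations `z ↦ e^{it} z`; it is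
evaluated as a derivative along the rotation, see `rd_eq_wirtinger`. -/

/-- `R_d f` at a point `z`. -/
def Rd (f : ℂ → ℂ) (z : ℂ) : ℂ :=
  (z - starRingEnd ℂ z)⁻¹ *
    (-Complex.I * deriv (fun t : ℝ => f (Complex.exp (t * Complex.I) * z)) 0)

/-- `R_d f = F` on `ℂ ∖ ℝ`, the derivative of `f` being required to exist there. -/
def HasRd (f F : ℂ → ℂ) : Prop :=
  ∀ z : ℂ, z.im ≠ 0 →
    DifferentiableAt ℝ (fun t : ℝ => f (Complex.exp (t * Complex.I) * z)) 0 ∧ Rd f z = F z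

/-- `(R_d)^k f = F` on `ℂ ∖ ℝ`, all derivatives being required to exist there. -/
def HasRdPow : ℕ → (ℂ → ℂ) → (ℂ → ℂ) → Prop
  | 0, f, F => ∀ z : ℂ, z.im ≠ 0 → f z = F z
  | k + 1, f, F => ∃ f₁ : ℂ → ℂ, HasRd f f₁ ∧ HasRdPow k f₁ F

/-- For a function that is differentiable in the real sense, with
`∂_z = (∂_x - i ∂_y) / 2` and `∂_z̄ = (∂_x + i ∂_y) / 2`, `Rd` is `(z - z̄)⁻¹ (z ∂_z - z̄ ∂_z̄)`. -/
theorem rd_eq_wirtinger (f : ℂ → ℂ) (f' : ℂ →L[ℝ] ℂ) (z : ℂ) (hf : HasFDerivAt f f' z) :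
    Rd f z = (z - starRingEnd ℂ z)⁻¹ *
      (z * ((f' 1 - Complex.I * f' Complex.I) / 2) -
        starRingEnd ℂ z * ((f' 1 + Complex.I * f' Complex.I) / 2)) := by
  have h1 : HasDerivAt (fun t : ℝ => Complex.exp (t * Complex.I) * z) (Complex.I * z) 0 := by
    have h0 : HasDerivAt (fun t : ℝ => (t : ℂ) * Complex.I) (1 * Complex.I) 0 :=
      (Complex.ofRealCLM.hasDerivAt (x := (0 : ℝ))).mul_const Complex.I
    simpa using (h0.cexp).mul_const z
  have hf0 : HasFDerivAt f f' (Complex.exp (((0 : ℝ) : ℂ) * Complex.I) * z) := by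
    simpa using hf
  have h2 := hf0.comp_hasDerivAt (0 : ℝ) h1
  have h3 : f' (Complex.I * z) = -(z.im : ℂ) * f' 1 + z.re * f' Complex.I := by
    have h4 : Complex.I * z = (-z.im) • (1 : ℂ) + z.re • Complex.I := by
      apply Complex.ext <;> simp
    rw [h4, map_add, map_smul, map_smul]
    simp
  have h5 : deriv (fun t : ℝ => f (Complex.exp (t * Complex.I) * z)) 0 = f' (Complex.I * z) :=
    h2.deriv
  unfold Rd
  rw [h5, h3]
  congr 1
  have h6 : starRingEnd ℂ z = z.re - z.im * Complex.I := by
    apply Complex.ext <;> simp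
  rw [h6]
  conv_rhs => rw [← Complex.re_add_im z]
  simp only [Complex.add_re, Complex.add_im, Complex.mul_re, Complex.mul_im, Complex.ofReal_re,
    Complex.ofReal_im, Complex.I_re, Complex.I_im]
  ring_nf

/-! ### The operator `Ĥ_{-β} = (-i ∂)^{-2β} |x|^{-2β}` on the plane -/

/-- The kernel of `(-i ∂)^{-2β} = (-Δ)^{-β}` on `ℝ² = ℂ` at distance `r`: it is `a(β) r^{2β - 2}`
with `a(β) = Γ(1 - β) / (4^β π Γ(β))`, and at the poles `β = 1, 2, …` of `a(β)` the logarithmic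
kernel (the finite part), e.g. `-(2π)⁻¹ log r` for `β = 1`. -/
def planeKernel (β r : ℝ) : ℝ :=
  open Classical in
  if ∃ k : ℕ, β = k + 1 then
    (-1) ^ ⌊β⌋₊ * 2 / ((4 : ℝ) ^ β * Real.pi * Real.Gamma β ^ 2) *
      (r ^ (2 * β - 2) * Real.log r)
  else propConst 1 β * r ^ (2 * β - 2)

/-- `K_β(|x - y|) f(y)` at `y = ρ e^{iθ}`, where `K_β` is `planeKernel β`. -/
def circleIntegrand (β : ℝ) (f : ℂ → ℂ) (x : ℂ) (ρ θ : ℝ) : ℂ :=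
  (planeKernel β ‖x - ρ * Complex.exp (θ * Complex.I)‖ : ℂ) *
    f (ρ * Complex.exp (θ * Complex.I))

/-- `(Ĥ_{-β} f)(x) = ∫ K_β(|x - y|) |y|^{-2β} f(y) d²y`, written in polar coordinates
`y = ρ e^{iθ}`, the integration over the angle being done first. -/
def Hhat (β : ℝ) (f : ℂ → ℂ) (x : ℂ) : ℂ :=
  ∫ ρ in Set.Ioi (0 : ℝ),
    ((ρ ^ (-(2 * β)) * ρ : ℝ) : ℂ) * ∫ θ in (-Real.pi)..Real.pi, circleIntegrand β f x ρ θ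

/-- The function `f` is in the domain of `Ĥ_{-β}`: the integral that defines `(Ĥ_{-β} f)(x)`
converges at every `x ∈ ℂ ∖ ℝ`. -/
def InHhatDomain (β : ℝ) (f : ℂ → ℂ) : Prop :=
  ∀ x : ℂ, x.im ≠ 0 →
    (∀ᵐ ρ ∂(volume.restrict (Set.Ioi (0 : ℝ))),
      IntervalIntegrable (circleIntegrand β f x ρ) volume (-Real.pi) Real.pi) ∧
    IntegrableOn (fun ρ : ℝ => ((ρ ^ (-(2 * β)) * ρ : ℝ) : ℂ) *
      ∫ θ in (-Real.pi)..Real.pi, circleIntegrand β f x ρ θ) (Set.Ioi (0 : ℝ))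

/-! ### The loop-raising operator -/

/-- `g` is a value of `(R_d)^{-l} F` to which `Ĥ_{-β} (z z̄)^{-1/2}` can be applied: a symmetric
function of `z` and `z̄` with `(R_d)^l g = F`. -/
structure IsRdPreimage (l : ℕ) (β : ℝ) (F g : ℂ → ℂ) : Prop where
  symm : ∀ z : ℂ, g (starRingEnd ℂ z) = g z
  rdPow : HasRdPow l g F
  dom : InHhatDomain β (fun w => g w / (‖w‖ : ℂ))

/-- `(R_d)^l √(z z̄) Ĥ_{-β} (1 / √(z z̄)) (R_d)^{-l} F = F'` on `ℂ ∖ ℝ`: the function `F` has a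
preimage under `(R_d)^l` as above, and every such preimage leads to `F'`. -/
def LoopOperatorMaps (l : ℕ) (β : ℝ) (F F' : ℂ → ℂ) : Prop :=
  (∃ g : ℂ → ℂ, IsRdPreimage l β F g) ∧
    ∀ g : ℂ → ℂ, IsRdPreimage l β F g →
      HasRdPow l (fun z => (‖z‖ : ℂ) * Hhat β (fun w => g w / (‖w‖ : ℂ)) z) F'

end

end LadderShift

/-!
The proof writes `l = m + 1`, `γ = l + 1 - β` and works on one circle `|z| = r` at a time, where
everything symmetric under `z ↔ z̄` is a function of `c = cos φ`, and `R_d` is, up to the factor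
`1 / (2 r)`, the derivative with respect to `c` (`hasRdPow_of_chain`, `HasRdPow.exists_chain`).

*Reduction to one point.* An inversion at `x₄` followed by a similarity sends the four points to
`z, 0, 1, ∞`. Conformal invariance turns the normalized ladder integral into `|1 - z|^{2γ} J_L(z)`,
where `J_0(x) = |x - 1|^{-2γ}` and `J_{L+1}(x) = ∫ |x - y|^{-2γ} |y|^{-2β} J_L(y) dy` over `ℝ^D`
(`ladderF_eq`, `ladderChain`). The power of `|1 - z|` cancels the one in the normalization, so that
the ladder function is a constant times `|z| J_L(z)` (`ladderFun`).

*Dimension shift.* Let `k` be a function of `cos θ`, and convolve it on the circle with `G`. The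
`l`-th derivative of the result with respect to `cos φ` is a multiple of the convolution, on the
sphere of dimension `2 l + 1`, of the `l`-th derivatives of `k` and of `G` (`hasDerivAt_shiftChain`).
Each step is an integration by parts on the sphere (`hasDerivAt_sphereIntegral`). The `l`-th
derivative of the planar kernel of `(-i ∂)^{-2β}` with respect to the squared distance is a multiple
of the propagator `|x - y|^{-2γ}` of `ℝ^D`, also for integral `β`: since `β < l + 1`, the `l`-fold
differentiation removes the logarithm (`planePow_eq`). Hence, if `R_d^l g` is the `L`-loop ladder
function, the contribution of the circle of radius `ρ` to `Ĥ (g / |·|)` has, on the circle of radius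
`r`, as `l`-th derivative a multiple of `loopDensity`: the contribution of the sphere of radius `ρ` to the
`(L + 1)`-loop ladder, by `planarLadder_succ`.

*Integration over the radius.* Differentiation under the integral over `ρ` is avoided. Each
contribution is a polynomial of degree less than `l` in `c` plus an iterated primitive of the
nonnegative function `loopDensity`, and the latter integrates over `ρ` by Tonelli's theorem. The
polynomial parts then integrate as well, because interpolation expresses them by their values at
finitely many points (`integral_polynomial_add_cauchyInt`). So the operator gives, on each circle, a
polynomial plus an iterated primitive of the next ladder (`exists_Hhat_eq`), whatever the preimage
(`hasRdPow_Hhat`).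

*Existence of a preimage.* On each circle take the iterated primitive of the ladder function, and
away from the unit circle subtract its Chebyshev modes of degree less than `l`
(`canonicalPreimage`). A function without these modes is orthogonal to the Taylor polynomial of the
kernel, which gives the contributions of the circles of radius `ρ` the decay that is needed for
`ρ → 0` and `ρ → ∞` (`norm_circleConv_le`, `exists_norm_canonicalShell_le`). At the point `1` each
integration softens the singularity of the ladder, down to an integrable one
(`exists_preimageChain_le_rpow`). Together, `isRdPreimage_canonicalPreimage`.
-/

namespace LadderShift

open Real Set Filter Topology

/-! ### The dimension shift on a circle -/

/-- The square `[0, π]²` of the pairs of angles `(θ, ψ)`. -/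
def angleSquare : Set (ℝ × ℝ) := Icc 0 π ×ˢ Icc 0 π

lemma isCompact_angleSquare : IsCompact angleSquare := isCompact_Icc.prod isCompact_Icc

lemma measurableSet_angleSquare : MeasurableSet angleSquare := isCompact_angleSquare.measurableSet

/-- First coordinate along `m` of the point of the sphere with spherical angles `θ, ψ`, where `m` is
at angle `φ` from the axis. -/
noncomputable def sphereDot (φ : ℝ) (p : ℝ × ℝ) : ℝ := cos φ * cos p.1 + sin φ * sin p.1 * cos p.2

lemma abs_sphereDot_le (φ : ℝ) (p : ℝ × ℝ) : |sphereDot φ p| ≤ 1 := by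
  have h1 : sphereDot φ p ^ 2 ≤ 1 := by
    unfold sphereDot
    have h2 := sin_sq_add_cos_sq φ
    have h3 := sin_sq_add_cos_sq p.1
    have h4 := sin_sq_add_cos_sq p.2
    have h5 : (cos φ * cos p.1 + sin φ * sin p.1 * cos p.2) ^ 2 ≤
        (cos φ ^ 2 + sin φ ^ 2) * (cos p.1 ^ 2 + (sin p.1 * cos p.2) ^ 2) := by
      nlinarith [sq_nonneg (cos φ * (sin p.1 * cos p.2) - sin φ * cos p.1)]
    have h6 : (sin p.1 * cos p.2) ^ 2 ≤ sin p.1 ^ 2 := by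
      nlinarith [sq_nonneg (sin p.1 * sin p.2)]
    nlinarith
  exact abs_le_one_iff_mul_self_le_one.2 (by nlinarith)

lemma continuous_sphereDot (φ : ℝ) : Continuous (sphereDot φ) := by
  unfold sphereDot; fun_prop

lemma integral_square_deriv_fst {A A' : ℝ → ℝ → ℂ}
    (hA : ∀ x y, HasDerivAt (fun x => A x y) (A' x y) x)
    (hc : Continuous (Function.uncurry A')) (h0 : ∀ y, A 0 y = 0) (h1 : ∀ y, A π y = 0) :
    ∫ p in angleSquare, A' p.1 p.2 = 0 := by
  have hint : IntegrableOn (Function.uncurry A') angleSquare :=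
    hc.continuousOn.integrableOn_compact isCompact_angleSquare
  have e : (volume : Measure (ℝ × ℝ)).restrict angleSquare =
      (volume.restrict (Icc 0 π)).prod (volume.restrict (Icc 0 π)) := by
    rw [angleSquare, Measure.volume_eq_prod, Measure.prod_restrict]
  rw [IntegrableOn, e] at hint
  rw [e]
  rw [show (∫ p, A' p.1 p.2 ∂((volume.restrict (Icc 0 π)).prod (volume.restrict (Icc 0 π)))) = _
    from integral_prod_symm _ hint]
  apply integral_eq_zero_of_ae
  refine Eventually.of_forall fun y => ?_
  change ∫ x in Icc 0 π, A' x y = 0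
  rw [integral_Icc_eq_integral_Ioc, ← intervalIntegral.integral_of_le pi_pos.le,
    intervalIntegral.integral_eq_sub_of_hasDerivAt (fun x _ => hA x y)]
  · simp [h0, h1]
  · exact (hc.comp (by fun_prop : Continuous fun x : ℝ => (x, y))).intervalIntegrable _ _

lemma integral_square_deriv_snd {A A' : ℝ → ℝ → ℂ}
    (hA : ∀ x y, HasDerivAt (fun y => A x y) (A' x y) y)
    (hc : Continuous (Function.uncurry A')) (h0 : ∀ x, A x 0 = 0) (h1 : ∀ x, A x π = 0) :
    ∫ p in angleSquare, A' p.1 p.2 = 0 := by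
  have hint : IntegrableOn (Function.uncurry A') angleSquare :=
    hc.continuousOn.integrableOn_compact isCompact_angleSquare
  have e : (volume : Measure (ℝ × ℝ)).restrict angleSquare =
      (volume.restrict (Icc 0 π)).prod (volume.restrict (Icc 0 π)) := by
    rw [angleSquare, Measure.volume_eq_prod, Measure.prod_restrict]
  rw [IntegrableOn, e] at hint
  rw [e]
  rw [show (∫ p, A' p.1 p.2 ∂((volume.restrict (Icc 0 π)).prod (volume.restrict (Icc 0 π)))) = _
    from integral_prod _ hint]
  apply integral_eq_zero_of_ae
  refine Eventually.of_forall fun x => ?_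
  change ∫ y in Icc 0 π, A' x y = 0
  rw [integral_Icc_eq_integral_Ioc, ← intervalIntegral.integral_of_le pi_pos.le,
    intervalIntegral.integral_eq_sub_of_hasDerivAt (fun y _ => hA x y)]
  · simp [h0, h1]
  · exact (hc.comp (by fun_prop : Continuous fun y : ℝ => (x, y))).intervalIntegrable _ _

/-- The integral over the sphere of dimension `2 j + 1` of a function of the coordinate along a
vector `m` times a function of the coordinate along the axis, up to the volume of a sphere of
dimension `2 j - 1`. -/
noncomputable def sphereIntegral (j : ℕ) (k : ℝ → ℝ) (G : ℝ → ℂ) (φ : ℝ) : ℂ :=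
  ∫ p in angleSquare,
    ((k (sphereDot φ p) * (sin p.1 ^ (2 * j) * sin p.2 ^ (2 * j - 1)) : ℝ) : ℂ) * G (cos p.1)

/-- `k 0, k 1, k 2, …` are a function and its successive derivatives on `[-1, 1]`. -/
def IsKernelChain (k : ℕ → ℝ → ℝ) : Prop :=
  ∀ i t, |t| ≤ 1 → HasDerivAt (k i) (k (i + 1) t) t

lemma IsKernelChain.continuous_comp {k : ℕ → ℝ → ℝ} (hk : IsKernelChain k) (i : ℕ)
    {X : Type*} [TopologicalSpace X] {u : X → ℝ} (hu : Continuous u) (hu1 : ∀ x, |u x| ≤ 1) :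
    Continuous fun x => k i (u x) :=
  continuous_iff_continuousAt.2 fun x =>
    (hk i (u x) (hu1 x)).continuousAt.comp hu.continuousAt

lemma IsKernelChain.bounded {k : ℕ → ℝ → ℝ} (hk : IsKernelChain k) (i : ℕ) :
    ∃ M, ∀ t, |t| ≤ 1 → |k i t| ≤ M := by
  have h : ContinuousOn (k i) (Icc (-1) 1) := fun t ht =>
    (hk i t (abs_le.2 ht)).continuousAt.continuousWithinAt
  obtain ⟨M, hM⟩ := isCompact_Icc.exists_bound_of_continuousOn h
  exact ⟨M, fun t ht => hM t (abs_le.1 ht)⟩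

lemma hasDerivAt_sphereDot (φ : ℝ) (p : ℝ × ℝ) :
    HasDerivAt (fun φ => sphereDot φ p) (-sin φ * cos p.1 + cos φ * sin p.1 * cos p.2) φ := by
  unfold sphereDot
  have h1 := (hasDerivAt_cos φ).mul_const (cos p.1)
  have h2 := ((hasDerivAt_sin φ).mul_const (sin p.1)).mul_const (cos p.2)
  exact h1.add h2

lemma hasDerivAt_sphereIntegral_aux (j : ℕ) {k : ℕ → ℝ → ℝ} (hk : IsKernelChain k) (i : ℕ)
    {G : ℝ → ℂ} (hG : Continuous G) (φ : ℝ) :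
    HasDerivAt (sphereIntegral j (k i) G)
      (∫ p in angleSquare,
        ((k (i + 1) (sphereDot φ p) * (-sin φ * cos p.1 + cos φ * sin p.1 * cos p.2) *
          (sin p.1 ^ (2 * j) * sin p.2 ^ (2 * j - 1)) : ℝ) : ℂ) * G (cos p.1)) φ := by
  obtain ⟨M, hM⟩ := hk.bounded (i + 1)
  obtain ⟨N, hN⟩ := (isCompact_Icc (a := (-1 : ℝ)) (b := 1)).exists_bound_of_continuousOn
    hG.continuousOn
  have hcont : ∀ (i : ℕ) (φ : ℝ), Continuous fun p => k i (sphereDot φ p) := fun i φ =>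
    hk.continuous_comp i (continuous_sphereDot φ) (abs_sphereDot_le φ)
  have h1 : ∀ φ, Continuous fun p : ℝ × ℝ =>
    ((k i (sphereDot φ p) * (sin p.1 ^ (2 * j) * sin p.2 ^ (2 * j - 1)) : ℝ) : ℂ) *
      G (cos p.1) := fun φ =>
    (Complex.continuous_ofReal.comp ((hcont i φ).mul (by fun_prop))).mul (hG.comp (by fun_prop))
  have h2 : ∀ φ, Continuous fun p : ℝ × ℝ =>
    ((k (i + 1) (sphereDot φ p) * (-sin φ * cos p.1 + cos φ * sin p.1 * cos p.2) *
          (sin p.1 ^ (2 * j) * sin p.2 ^ (2 * j - 1)) : ℝ) : ℂ) * G (cos p.1) := fun φ =>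
    (Complex.continuous_ofReal.comp (((hcont (i + 1) φ).mul (by fun_prop)).mul
      (by fun_prop))).mul (hG.comp (by fun_prop))
  refine (hasDerivAt_integral_of_dominated_loc_of_deriv_le 
    (μ := volume.restrict angleSquare) (bound := fun _ => M * 2 * N)
    (F := fun φ p => ((k i (sphereDot φ p) *
      (sin p.1 ^ (2 * j) * sin p.2 ^ (2 * j - 1)) : ℝ) : ℂ) * G (cos p.1))
    (F' := fun φ p => ((k (i + 1) (sphereDot φ p) * (-sin φ * cos p.1 + cos φ * sin p.1 * cos p.2) *
          (sin p.1 ^ (2 * j) * sin p.2 ^ (2 * j - 1)) : ℝ) : ℂ) * G (cos p.1))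
    (s := univ) univ_mem ?_ ?_ ?_ ?_ ?_ ?_).2
  · exact Eventually.of_forall fun φ => (h1 φ).aestronglyMeasurable
  · exact (h1 φ).continuousOn.integrableOn_compact isCompact_angleSquare
  · exact (h2 φ).aestronglyMeasurable
  · refine Eventually.of_forall fun p φ _ => ?_
    rw [norm_mul, Complex.norm_real, norm_mul, norm_mul, norm_eq_abs, norm_eq_abs, norm_eq_abs]
    have a1 := hM _ (abs_sphereDot_le φ p)
    have a2 : |(-sin φ * cos p.1 + cos φ * sin p.1 * cos p.2)| ≤ 2 := by
      have b1 : |-sin φ * cos p.1| ≤ 1 := by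
        rw [abs_mul, abs_neg]
        exact mul_le_one₀ (abs_sin_le_one _) (abs_nonneg _) (abs_cos_le_one _)
      have b2 : |cos φ * sin p.1 * cos p.2| ≤ 1 := by
        rw [abs_mul, abs_mul]
        exact mul_le_one₀ (mul_le_one₀ (abs_cos_le_one _) (abs_nonneg _) (abs_sin_le_one _))
          (abs_nonneg _) (abs_cos_le_one _)
      linarith [abs_add_le (-sin φ * cos p.1) (cos φ * sin p.1 * cos p.2)]
    have a3 : |sin p.1 ^ (2 * j) * sin p.2 ^ (2 * j - 1)| ≤ 1 := by
      rw [abs_mul, abs_pow, abs_pow]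
      exact mul_le_one₀ (pow_le_one₀ (abs_nonneg _) (abs_sin_le_one _)) (by positivity)
        (pow_le_one₀ (abs_nonneg _) (abs_sin_le_one _))
    have a4 := hN (cos p.1) ⟨neg_one_le_cos _, cos_le_one _⟩
    have a5 : 0 ≤ M := (abs_nonneg _).trans a1
    calc _ ≤ M * 2 * 1 * N := by gcongr
      _ = M * 2 * N := by ring
  · have : IsFiniteMeasure ((volume : Measure (ℝ × ℝ)).restrict angleSquare) :=
      ⟨by simpa using isCompact_angleSquare.measure_lt_top⟩
    exact integrable_const _
  · refine Eventually.of_forall fun p φ _ => ?_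
    have d1 := (hk i _ (abs_sphereDot_le φ p)).comp φ (hasDerivAt_sphereDot φ p)
    exact ((d1.mul_const _).ofReal_comp).mul_const _

/-- Raising the dimension by two: the derivative of a spherical integral with respect to `cos φ` is
the spherical integral, two dimensions up, of the derivatives of the two functions. The integrand of
the difference of both sides is the divergence of a field that vanishes on the boundary of the
square of angles. -/
lemma hasDerivAt_sphereIntegral {j : ℕ} (hj : 0 < j) {k : ℕ → ℝ → ℝ} (hk : IsKernelChain k) (i : ℕ)
    {G G' : ℝ → ℂ} (hG : ∀ t, HasDerivAt G (G' t) t) (hG' : Continuous G') (φ : ℝ) :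
    HasDerivAt (sphereIntegral j (k i) G)
      (-sin φ * ((2 * j : ℝ)⁻¹ * sphereIntegral (j + 1) (k (i + 1)) G' φ)) φ := by
  have hGc : Continuous G := continuous_iff_continuousAt.2 fun t => (hG t).continuousAt
  have hcont : ∀ (i : ℕ), Continuous fun p => k i (sphereDot φ p) := fun i =>
    hk.continuous_comp i (continuous_sphereDot φ) (abs_sphereDot_le φ)
  obtain ⟨n, rfl⟩ : ∃ n, j = n + 1 := ⟨j - 1, by omega⟩
  have key := hasDerivAt_sphereIntegral_aux (n + 1) hk i hGc φ
  convert key using 1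
  have e2 : 2 * (n + 1) - 1 = 2 * n + 1 := by omega
  have e3 : 2 * (n + 1 + 1) - 1 = 2 * n + 3 := by omega
  unfold sphereIntegral
  rw [e2, e3]
  set κ₁ : ℝ × ℝ → ℝ := fun p => k (i + 1) (sphereDot φ p) with hκ₁
  set κ₂ : ℝ × ℝ → ℝ := fun p => k (i + 2) (sphereDot φ p) with hκ₂
  have c1 : Continuous κ₁ := hcont (i + 1)
  have c2 : Continuous κ₂ := hcont (i + 2)
  -- the two components of the field; below, `A'` and `B'` are the two terms of its divergence
  set A : ℝ → ℝ → ℂ := fun x y =>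
    ((κ₁ (x, y) * (sin x ^ (2 * n + 3) * sin y ^ (2 * n + 3)) : ℝ) : ℂ) *
      G (cos x) with hA
  set A' : ℝ → ℝ → ℂ := fun x y =>
    (((κ₂ (x, y) * (-cos φ * sin x + sin φ * cos x * cos y) *
        (sin x ^ (2 * n + 3) * sin y ^ (2 * n + 3)) +
      κ₁ (x, y) *
        ((2 * n + 3) * sin x ^ (2 * n + 2) * cos x * sin y ^ (2 * n + 3))) : ℝ) : ℂ) * G (cos x) +
    ((κ₁ (x, y) * (sin x ^ (2 * n + 3) * sin y ^ (2 * n + 3)) : ℝ) : ℂ) *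
      (G' (cos x) * (-sin x : ℝ)) with hA'
  set B : ℝ → ℝ → ℂ := fun x y =>
    ((κ₁ (x, y) * (sin x ^ (2 * n + 2) * (sin y ^ (2 * n + 2) *
      (-cos φ * sin x + sin φ * cos x * cos y))) : ℝ) : ℂ) * G (cos x) with hB
  set B' : ℝ → ℝ → ℂ := fun x y =>
    ((κ₂ (x, y) * (-sin φ * sin x * sin y) *
      (sin x ^ (2 * n + 2) * (sin y ^ (2 * n + 2) * (-cos φ * sin x + sin φ * cos x * cos y))) +
      κ₁ (x, y) * (sin x ^ (2 * n + 2) *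
       ((2 * n + 2) * sin y ^ (2 * n + 1) * cos y * (-cos φ * sin x + sin φ * cos x * cos y) +
        sin y ^ (2 * n + 2) * (-sin φ * cos x * sin y))) : ℝ) : ℂ) * G (cos x) with hB'
  have d1 : ∀ x y, HasDerivAt (fun x => sphereDot φ (x, y))
      (-cos φ * sin x + sin φ * cos x * cos y) x := fun x y => by
    have h1 := ((hasDerivAt_cos x).const_mul (cos φ)).add
      (((hasDerivAt_sin x).const_mul (sin φ)).mul_const (cos y))
    exact h1.congr_deriv (by ring)
  have d2 : ∀ x y, HasDerivAt (fun y => sphereDot φ (x, y)) (-sin φ * sin x * sin y) y :=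
    fun x y => by
      have h1 := ((hasDerivAt_cos y).const_mul (sin φ * sin x)).const_add (cos φ * cos x)
      exact h1.congr_deriv (by ring)
  have cA : Continuous (Function.uncurry A') := by
    simp only [hA', Function.uncurry_def]
    fun_prop
  have cB : Continuous (Function.uncurry B') := by
    simp only [hB', Function.uncurry_def]
    fun_prop
  have d3 : ∀ x, HasDerivAt (fun x => G (cos x)) (G' (cos x) * (-sin x : ℝ)) x := fun x => by
    have h := (hG (cos x)).scomp x (hasDerivAt_cos x)
    exact h.congr_deriv (by rw [Complex.real_smul, mul_comm])
  have d4 : ∀ x y, HasDerivAt (fun x => κ₁ (x, y))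
      (κ₂ (x, y) * (-cos φ * sin x + sin φ * cos x * cos y)) x := fun x y =>
    (hk (i + 1) _ (abs_sphereDot_le φ (x, y))).comp x (d1 x y)
  have d5 : ∀ x y, HasDerivAt (fun y => κ₁ (x, y)) (κ₂ (x, y) * (-sin φ * sin x * sin y)) y :=
    fun x y => (hk (i + 1) _ (abs_sphereDot_le φ (x, y))).comp y (d2 x y)
  have iA : ∫ p in angleSquare, A' p.1 p.2 = 0 := by
    refine integral_square_deriv_fst (A := A) ?_ cA ?_ ?_
    · intro x y
      have h1 := ((d4 x y).mul (((hasDerivAt_sin x).pow (2 * n + 3)).mul_const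
        (sin y ^ (2 * n + 3)))).ofReal_comp.mul (d3 x)
      refine h1.congr_deriv ?_
      simp only [hA']
      congr 3
      simp only [Pi.pow_apply]
      push_cast
      ring
    · intro y; simp [hA]
    · intro y; simp [hA]
  have iB : ∫ p in angleSquare, B' p.1 p.2 = 0 := by
    refine integral_square_deriv_snd (A := B) ?_ cB ?_ ?_
    · intro x y
      have h2 : HasDerivAt (fun y => -cos φ * sin x + sin φ * cos x * cos y)
          (-sin φ * cos x * sin y) y :=
        (((hasDerivAt_cos y).const_mul (sin φ * cos x)).const_add _).congr_deriv (by ring)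
      have h1 := ((d5 x y).mul ((((hasDerivAt_sin y).pow (2 * n + 2)).mul h2).const_mul
        (sin x ^ (2 * n + 2)))).ofReal_comp.mul_const (G (cos x))
      refine h1.congr_deriv ?_
      simp only [hB']
      congr 2
      simp only [Pi.pow_apply, Pi.mul_apply]
      push_cast
      ring
    · intro y; simp [hB]
    · intro y; simp [hB]
  have hI : ∀ f : ℝ × ℝ → ℂ, Continuous f → IntegrableOn f angleSquare := fun f hf =>
    hf.continuousOn.integrableOn_compact isCompact_angleSquare
  have hn : ((2 * (n + 1 : ℕ) : ℝ) : ℂ) ≠ 0 := by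
    norm_cast
  have hAB : ∫ p in angleSquare, ((sin φ : ℂ) * A' p.1 p.2 + B' p.1 p.2) = 0 := by
    have h1 : IntegrableOn (fun p : ℝ × ℝ => (sin φ : ℂ) * A' p.1 p.2) angleSquare :=
      (hI _ cA).const_mul _
    have h2 : IntegrableOn (fun p : ℝ × ℝ => B' p.1 p.2) angleSquare := hI _ cB
    rw [integral_add h1 h2, integral_const_mul, iA, iB]
    simp
  have cT : Continuous fun p : ℝ × ℝ =>
      ((κ₁ p * (-sin φ * cos p.1 + cos φ * sin p.1 * cos p.2) *
        (sin p.1 ^ (2 * (n + 1)) * sin p.2 ^ (2 * n + 1)) : ℝ) : ℂ) * G (cos p.1) := by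
    fun_prop
  have cS : Continuous fun p : ℝ × ℝ =>
      ((κ₁ p * (sin p.1 ^ (2 * (n + 1 + 1)) * sin p.2 ^ (2 * n + 3)) : ℝ) : ℂ) *
        G' (cos p.1) := by
    fun_prop
  have hsum : (2 * (n + 1 : ℕ) : ℝ) * (∫ p in angleSquare,
        ((κ₁ p * (-sin φ * cos p.1 + cos φ * sin p.1 * cos p.2) *
        (sin p.1 ^ (2 * (n + 1)) * sin p.2 ^ (2 * n + 1)) : ℝ) : ℂ) * G (cos p.1)) +
      sin φ * (∫ p in angleSquare,
        ((κ₁ p * (sin p.1 ^ (2 * (n + 1 + 1)) * sin p.2 ^ (2 * n + 3)) : ℝ) : ℂ) *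
          G' (cos p.1)) = 0 := by
    rw [← neg_eq_zero, ← hAB, ← integral_const_mul, ← integral_const_mul, ← integral_add
      ((hI _ cT).const_mul _) ((hI _ cS).const_mul _), ← integral_neg]
    congr 1
    ext p
    simp only [hA', hB']
    have hp := Complex.sin_sq (p.2 : ℂ)
    push_cast
    linear_combination (-κ₁ p * G (cos p.1) * Complex.sin p.1 ^ (2 * n + 2) *
      Complex.sin p.2 ^ (2 * n + 1) * (2 * n + 2) * Complex.sin φ * Complex.cos p.1 : ℂ) * hp
  have e5 : (((2 * (n + 1 : ℕ) : ℝ)⁻¹ : ℝ) : ℂ) * ((2 * (n + 1 : ℕ) : ℝ) : ℂ) = 1 := by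
    rw [Complex.ofReal_inv]; exact inv_mul_cancel₀ hn
  linear_combination (-((2 * (n + 1 : ℕ) : ℝ)⁻¹ : ℝ) : ℂ) * hsum + (∫ p in angleSquare,
        ((κ₁ p * (-sin φ * cos p.1 + cos φ * sin p.1 * cos p.2) *
        (sin p.1 ^ (2 * (n + 1)) * sin p.2 ^ (2 * n + 1)) : ℝ) : ℂ) * G (cos p.1)) * e5

/-- The convolution on the circle of `k (cos θ)` and `G (cos θ)`, at the angle `φ`. -/
noncomputable def circleConv (k : ℝ → ℝ) (G : ℝ → ℂ) (φ : ℝ) : ℂ :=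
  ∫ θ in (-π)..π, (k (cos (φ - θ)) : ℂ) * G (cos θ)

/-- The first step from the plane to dimension four. The integral over `ψ` on the right-hand side is
elementary, and an integration by parts on the circle does the rest. -/
lemma hasDerivAt_circleConv {k : ℕ → ℝ → ℝ} (hk : IsKernelChain k)
    {G G' : ℝ → ℂ} (hG : ∀ t, HasDerivAt G (G' t) t) (hG' : Continuous G') (φ : ℝ) :
    HasDerivAt (circleConv (k 0) G) (-sin φ * sphereIntegral 1 (k 1) G' φ) φ := by
  have hGc : Continuous G := continuous_iff_continuousAt.2 fun t => (hG t).continuousAt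
  have hcc : ∀ (i : ℕ) (φ : ℝ), Continuous fun θ => k i (cos (φ - θ)) := fun i φ =>
    hk.continuous_comp i (by fun_prop) (fun θ => abs_cos_le_one _)
  have hcc' : ∀ (i : ℕ) (φ : ℝ), Continuous fun θ => k i (cos (φ + θ)) := fun i φ =>
    hk.continuous_comp i (by fun_prop) (fun θ => abs_cos_le_one _)
  obtain ⟨M, hM⟩ := hk.bounded 1
  obtain ⟨N, hN⟩ := (isCompact_Icc (a := (-1 : ℝ)) (b := 1)).exists_bound_of_continuousOn
    hGc.continuousOn
  have key : HasDerivAt (circleConv (k 0) G)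
      (∫ θ in (-π)..π, ((k 1 (cos (φ - θ)) * (-sin (φ - θ)) : ℝ) : ℂ) * G (cos θ)) φ := by
    refine (intervalIntegral.hasDerivAt_integral_of_dominated_loc_of_deriv_le
      (bound := fun _ => M * N) (F := fun φ θ => (k 0 (cos (φ - θ)) : ℂ) * G (cos θ))
      (F' := fun φ θ => ((k 1 (cos (φ - θ)) * (-sin (φ - θ)) : ℝ) : ℂ) * G (cos θ))
      (s := univ) univ_mem ?_ ?_ ?_ ?_ ?_ ?_).2
    · exact Eventually.of_forall fun φ => ((Complex.continuous_ofReal.comp (hcc 0 φ)).mul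
        (hGc.comp (by fun_prop))).aestronglyMeasurable
    · exact ((Complex.continuous_ofReal.comp (hcc 0 φ)).mul
        (hGc.comp (by fun_prop))).intervalIntegrable _ _
    · exact ((Complex.continuous_ofReal.comp ((hcc 1 φ).mul (by fun_prop))).mul
        (hGc.comp (by fun_prop))).aestronglyMeasurable
    · refine Eventually.of_forall fun θ _ φ _ => ?_
      rw [norm_mul, Complex.norm_real, norm_mul, norm_neg, norm_eq_abs, norm_eq_abs]
      have a1 := hM _ (abs_cos_le_one (φ - θ))
      have a2 := hN (cos θ) ⟨neg_one_le_cos _, cos_le_one _⟩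
      have a3 : 0 ≤ M := (abs_nonneg _).trans a1
      calc _ ≤ M * 1 * N := by
            have := abs_sin_le_one (φ - θ)
            gcongr
        _ = M * N := by ring
    · exact intervalIntegrable_const
    · refine Eventually.of_forall fun θ _ φ _ => ?_
      have d1 : HasDerivAt (fun φ => cos (φ - θ)) (-sin (φ - θ)) φ := by
        simpa using (hasDerivAt_cos (φ - θ)).comp_sub_const φ θ
      exact ((hk 0 _ (abs_cos_le_one (φ - θ))).comp φ d1).ofReal_comp.mul_const _
  convert key using 1
  -- fold the circle to `[0, π]`
  have hfold : ∫ θ in (-π)..π, ((k 1 (cos (φ - θ)) * (-sin (φ - θ)) : ℝ) : ℂ) * G (cos θ) =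
      -∫ θ in (0 : ℝ)..π, ((k 1 (cos (φ - θ)) * sin (φ - θ) + k 1 (cos (φ + θ)) * sin (φ + θ) :
        ℝ) : ℂ) * G (cos θ) := by
    have c1 : Continuous fun θ : ℝ => ((k 1 (cos (φ - θ)) * (-sin (φ - θ)) : ℝ) : ℂ) * G (cos θ) :=
      (Complex.continuous_ofReal.comp ((hcc 1 φ).mul (by fun_prop))).mul
        (hGc.comp (by fun_prop))
    have c2 : Continuous fun θ : ℝ => ((k 1 (cos (φ + θ)) * (-sin (φ + θ)) : ℝ) : ℂ) * G (cos θ) :=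
      (Complex.continuous_ofReal.comp ((hcc' 1 φ).mul (by fun_prop))).mul
        (hGc.comp (by fun_prop))
    rw [← intervalIntegral.integral_add_adjacent_intervals (b := 0) (c1.intervalIntegrable _ _)
      (c1.intervalIntegrable _ _)]
    have := intervalIntegral.integral_comp_neg (a := 0) (b := π)
      (fun θ => ((k 1 (cos (φ - θ)) * (-sin (φ - θ)) : ℝ) : ℂ) * G (cos θ))
    simp only [sub_neg_eq_add, cos_neg, neg_zero] at this
    rw [← this, ← intervalIntegral.integral_add (c2.intervalIntegrable _ _)
      (c1.intervalIntegrable _ _), ← intervalIntegral.integral_neg]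
    congr 1
    ext θ
    push_cast
    ring
  rw [hfold]
  -- the inner integral of the right-hand side
  have hinner : (sin φ : ℂ) * sphereIntegral 1 (k 1) G' φ =
      ∫ θ in (0 : ℝ)..π, ((k 0 (cos (φ - θ)) - k 0 (cos (φ + θ)) : ℝ) : ℂ) *
        (sin θ * G' (cos θ)) := by
    have c0 : Continuous fun p => k 1 (sphereDot φ p) :=
      hk.continuous_comp 1 (continuous_sphereDot φ) (abs_sphereDot_le φ)
    have c3 : Continuous fun p : ℝ × ℝ =>
        (sin φ : ℂ) * (((k 1 (sphereDot φ p) * (sin p.1 ^ (2 * 1) * sin p.2 ^ (2 * 1 - 1)) : ℝ) : ℂ)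
          * G' (cos p.1)) :=
      continuous_const.mul ((Complex.continuous_ofReal.comp (c0.mul (by fun_prop))).mul
        (hG'.comp (by fun_prop)))
    have e : (volume : Measure (ℝ × ℝ)).restrict angleSquare =
        (volume.restrict (Icc 0 π)).prod (volume.restrict (Icc 0 π)) := by
      rw [angleSquare, Measure.volume_eq_prod, Measure.prod_restrict]
    have hint := c3.continuousOn.integrableOn_compact (μ := volume) isCompact_angleSquare
    rw [IntegrableOn, e] at hint
    unfold sphereIntegral
    rw [← integral_const_mul, e, integral_prod _ hint, integral_Icc_eq_integral_Ioc,
      ← intervalIntegral.integral_of_le pi_pos.le]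
    congr 1
    ext θ
    rw [integral_Icc_eq_integral_Ioc, ← intervalIntegral.integral_of_le pi_pos.le]
    have d2 : ∀ ψ, HasDerivAt
        (fun ψ => ((-k 0 (sphereDot φ (θ, ψ)) : ℝ) : ℂ) * (sin θ * G' (cos θ)))
        ((sin φ : ℂ) * (((k 1 (sphereDot φ (θ, ψ)) * (sin θ ^ (2 * 1) * sin ψ ^ (2 * 1 - 1)) : ℝ) : ℂ)
          * G' (cos θ))) ψ := fun ψ => by
      have d3 : HasDerivAt (fun ψ => sphereDot φ (θ, ψ)) (-sin φ * sin θ * sin ψ) ψ := by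
        have h1 := ((hasDerivAt_cos ψ).const_mul (sin φ * sin θ)).const_add (cos φ * cos θ)
        exact h1.congr_deriv (by ring)
      have d4 := ((hk 0 _ (abs_sphereDot_le φ (θ, ψ))).comp ψ d3).neg.ofReal_comp.mul_const
        (sin θ * G' (cos θ))
      refine d4.congr_deriv ?_
      push_cast
      ring
    rw [intervalIntegral.integral_eq_sub_of_hasDerivAt (fun ψ _ => d2 ψ)
      ((c3.comp (by fun_prop : Continuous fun ψ : ℝ => (θ, ψ))).intervalIntegrable _ _)]
    simp only [sphereDot, cos_zero, cos_pi, cos_sub, cos_add]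
    push_cast
    ring_nf
  rw [neg_mul, hinner]
  congr 1
  have dD : ∀ θ, HasDerivAt (fun θ => ((k 0 (cos (φ - θ)) - k 0 (cos (φ + θ)) : ℝ) : ℂ))
      ((k 1 (cos (φ - θ)) * sin (φ - θ) + k 1 (cos (φ + θ)) * sin (φ + θ) : ℝ) : ℂ) θ := fun θ => by
    have d1 : HasDerivAt (fun θ => cos (φ - θ)) (sin (φ - θ)) θ := by
      simpa using (hasDerivAt_cos (φ - θ)).comp_const_sub φ θ
    have d2 : HasDerivAt (fun θ => cos (φ + θ)) (-sin (φ + θ)) θ := by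
      simpa using (hasDerivAt_cos (φ + θ)).comp_const_add φ θ
    have := ((hk 0 _ (abs_cos_le_one (φ - θ))).comp θ d1).sub
      ((hk 0 _ (abs_cos_le_one (φ + θ))).comp θ d2)
    exact (this.congr_deriv (by ring)).ofReal_comp
  have dG : ∀ x, HasDerivAt (fun x => G (cos x)) (-(sin x * G' (cos x))) x := fun x => by
    have h := (hG (cos x)).scomp x (hasDerivAt_cos x)
    exact h.congr_deriv (by rw [Complex.real_smul]; push_cast; ring)
  have ibp := intervalIntegral.integral_mul_deriv_eq_deriv_mul (a := 0) (b := π)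
    (fun x _ => dD x) (fun x _ => dG x)
    ((Complex.continuous_ofReal.comp (((hcc 1 φ).mul (by fun_prop)).add
      ((hcc' 1 φ).mul (by fun_prop)))).intervalIntegrable _ _)
    (((Complex.continuous_ofReal.comp (by fun_prop)).mul
      (hG'.comp (by fun_prop))).neg.intervalIntegrable _ _)
  have b1 : cos (φ + π) = cos (φ - π) := by rw [cos_add_pi, cos_sub_pi]
  simp only [b1, sub_zero, add_zero, sub_self, Complex.ofReal_zero, zero_mul, zero_sub, mul_neg,
    intervalIntegral.integral_neg] at ibp
  exact neg_injective ibp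

lemma continuous_sphereIntegral (j : ℕ) {k : ℕ → ℝ → ℝ} (hk : IsKernelChain k) (i : ℕ)
    {G : ℝ → ℂ} (hG : Continuous G) : Continuous (sphereIntegral j (k i) G) :=
  continuous_iff_continuousAt.2 fun φ => (hasDerivAt_sphereIntegral_aux j hk i hG φ).continuousAt

/-- The circle convolution followed by its derivatives with respect to `c = cos φ`. -/
noncomputable def shiftChain (k : ℕ → ℝ → ℝ) (G : ℕ → ℝ → ℂ) : ℕ → ℝ → ℂ
  | 0, c => circleConv (k 0) (G 0) (arccos c)
  | j + 1, c => ((2 ^ j * j.factorial : ℝ)⁻¹ : ℝ) *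
      sphereIntegral (j + 1) (k (j + 1)) (G (j + 1)) (arccos c)

/-- Dimension shift on a circle: the `l`-th derivative, with respect to the cosine of the angle, of
a planar convolution is a convolution over the sphere of dimension `2 l + 1` of the `l`-th
derivatives. -/
lemma hasDerivAt_shiftChain {k : ℕ → ℝ → ℝ} (hk : IsKernelChain k) {l : ℕ} {G : ℕ → ℝ → ℂ}
    (hG : ∀ j < l, ∀ t, HasDerivAt (G j) (G (j + 1) t) t) (hGl : Continuous (G l))
    {j : ℕ} (hj : j < l) {c : ℝ} (hc : c ∈ Ioo (-1 : ℝ) 1) :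
    HasDerivAt (shiftChain k G j) (shiftChain k G (j + 1) c) c := by
  have hcont : ∀ j ≤ l, Continuous (G j) := fun j hj => by
    rcases hj.lt_or_eq with h | rfl
    · exact continuous_iff_continuousAt.2 fun t => (hG j h t).continuousAt
    · exact hGl
  have hs : 0 < √(1 - c ^ 2) := sqrt_pos.2 (by nlinarith [hc.1, hc.2])
  have ha := hasDerivAt_arccos (ne_of_gt hc.1) (ne_of_lt hc.2)
  have hne : (sin (arccos c) : ℂ) ≠ 0 := by
    rw [sin_arccos]; exact_mod_cast hs.ne'
  rcases j with _ | j
  · have h := (hasDerivAt_circleConv hk (hG 0 hj) (hcont 1 hj) (arccos c)).scomp c ha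
    refine h.congr_deriv ?_
    rw [← sin_arccos, Complex.real_smul]
    simp only [shiftChain]
    push_cast at hne ⊢
    field_simp
    simp
  · have h := ((hasDerivAt_sphereIntegral j.succ_pos hk (j + 1) (hG (j + 1) hj)
      (hcont (j + 2) hj) (arccos c)).scomp c ha).const_mul
        (((2 ^ j * j.factorial : ℝ)⁻¹ : ℝ) : ℂ)
    refine h.congr_deriv ?_
    rw [← sin_arccos, Complex.real_smul]
    simp only [shiftChain]
    have hj' : (j.factorial : ℂ) ≠ 0 := by exact_mod_cast j.factorial_ne_zero
    have hj2 : (j + 1 : ℂ) ≠ 0 := by exact_mod_cast j.succ_ne_zero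
    rw [Nat.factorial_succ]
    push_cast at hne ⊢
    field_simp
    try ring

/-! ### Iterated primitives -/

/-- Cauchy's formula for the `(k + 1)`-fold primitive of `f` that vanishes to order `k + 1`
at `0`. -/
noncomputable def cauchyInt (k : ℕ) (f : ℝ → ℂ) (c : ℝ) : ℂ :=
  ∫ s in (0 : ℝ)..c, (((c - s) ^ k / k.factorial : ℝ) : ℂ) * f s

section
variable {S : Set ℝ}

lemma intervalIntegrable_of_continuousOn_ordConnected (hS : S.OrdConnected) (h0 : (0 : ℝ) ∈ S)
    {f : ℝ → ℂ} (hf : ContinuousOn f S) {c : ℝ} (hc : c ∈ S) : IntervalIntegrable f volume 0 c :=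
  (hf.mono (hS.uIcc_subset h0 hc)).intervalIntegrable

lemma hasDerivAt_cauchyInt_zero (hSo : IsOpen S) (hS : S.OrdConnected) (h0 : (0 : ℝ) ∈ S)
    {f : ℝ → ℂ} (hf : ContinuousOn f S) {c : ℝ} (hc : c ∈ S) :
    HasDerivAt (cauchyInt 0 f) (f c) c := by
  have h : cauchyInt 0 f = fun c => ∫ s in (0 : ℝ)..c, f s := by
    ext c; simp [cauchyInt]
  rw [h]
  exact intervalIntegral.integral_hasDerivAt_right
    (intervalIntegrable_of_continuousOn_ordConnected hS h0 hf hc)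
    (hf.stronglyMeasurableAtFilter hSo c hc) (hf.continuousAt (hSo.mem_nhds hc))

lemma cauchyInt_succ_primitive (hS : S.OrdConnected) (h0 : (0 : ℝ) ∈ S)
    {f F : ℝ → ℂ} (hF : ∀ t ∈ S, HasDerivAt F (f t) t) (hf : ContinuousOn f S) (k : ℕ) {c : ℝ}
    (hc : c ∈ S) :
    cauchyInt k F c = cauchyInt (k + 1) f c + F 0 * ((c ^ (k + 1) / (k + 1).factorial : ℝ) : ℂ) := by
  have hsub := hS.uIcc_subset h0 hc
  have hu : ∀ s ∈ uIcc 0 c, HasDerivAt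
      (fun s : ℝ => ((-(c - s) ^ (k + 1) / (k + 1).factorial : ℝ) : ℂ))
      (((c - s) ^ k / k.factorial : ℝ) : ℂ) s := fun s _ => by
    have h1 : HasDerivAt (fun s : ℝ => c - s) (-1) s := by
      simpa using (hasDerivAt_id s).const_sub c
    refine HasDerivAt.ofReal_comp ?_
    refine ((h1.pow (k + 1)).neg.div_const _).congr_deriv ?_
    have := k.factorial_ne_zero
    rw [Nat.factorial_succ]
    push_cast
    field_simp
  have h := intervalIntegral.integral_deriv_mul_eq_sub hu
    (fun s hs => hF s (hsub hs)) (by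
      apply Continuous.intervalIntegrable
      fun_prop) (intervalIntegrable_of_continuousOn_ordConnected hS h0 hf hc)
  have hFc : ContinuousOn F S := fun t ht => (hF t ht).continuousAt.continuousWithinAt
  rw [intervalIntegral.integral_add] at h
  · unfold cauchyInt
    have e : (∫ s in (0 : ℝ)..c, ((-(c - s) ^ (k + 1) / (k + 1).factorial : ℝ) : ℂ) * f s) =
        -∫ s in (0 : ℝ)..c, (((c - s) ^ (k + 1) / (k + 1).factorial : ℝ) : ℂ) * f s := by
      rw [← intervalIntegral.integral_neg]
      congr 1
      ext s
      push_cast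
      ring
    rw [e] at h
    simp only [sub_self, sub_zero] at h
    rw [← sub_eq_iff_eq_add', sub_eq_add_neg, h]
    push_cast
    simp
    ring
  · exact intervalIntegrable_of_continuousOn_ordConnected hS h0
      ((by fun_prop : Continuous fun s : ℝ => (((c - s) ^ k / k.factorial : ℝ) : ℂ)).continuousOn.mul
        hFc) hc
  · exact intervalIntegrable_of_continuousOn_ordConnected hS h0
      ((by fun_prop : Continuous fun s : ℝ =>
        ((-(c - s) ^ (k + 1) / (k + 1).factorial : ℝ) : ℂ)).continuousOn.mul hf) hc

lemma hasDerivAt_cauchyInt_succ (hSo : IsOpen S) (hS : S.OrdConnected) (h0 : (0 : ℝ) ∈ S)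
    (k : ℕ) {f : ℝ → ℂ} (hf : ContinuousOn f S) {c : ℝ} (hc : c ∈ S) :
    HasDerivAt (cauchyInt (k + 1) f) (cauchyInt k f c) c := by
  -- one of the primitives moves from the kernel to the function
  have key : ∀ k, ∀ c ∈ S, cauchyInt (k + 1) f c = cauchyInt k (cauchyInt 0 f) c := by
    intro k c hc
    rw [cauchyInt_succ_primitive hS h0
      (fun t ht => hasDerivAt_cauchyInt_zero hSo hS h0 hf ht) hf k hc]
    simp [cauchyInt]
  induction k generalizing f c with
  | zero =>
    have hF : ContinuousOn (cauchyInt 0 f) S := fun t ht =>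
      (hasDerivAt_cauchyInt_zero hSo hS h0 hf ht).continuousAt.continuousWithinAt
    refine (hasDerivAt_cauchyInt_zero hSo hS h0 hF hc).congr_of_eventuallyEq ?_
    filter_upwards [hSo.mem_nhds hc] with t ht using key 0 t ht
  | succ k ih =>
    have hF : ContinuousOn (cauchyInt 0 f) S := fun t ht =>
      (hasDerivAt_cauchyInt_zero hSo hS h0 hf ht).continuousAt.continuousWithinAt
    rw [key k c hc]
    refine HasDerivAt.congr_of_eventuallyEq (f := cauchyInt (k + 1) (cauchyInt 0 f)) ?_ ?_
    · refine ih hF hc ?_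
      intro k c hc
      rw [cauchyInt_succ_primitive hS h0
        (fun t ht => hasDerivAt_cauchyInt_zero hSo hS h0 hF ht) hF k hc]
      simp [cauchyInt]
    · filter_upwards [hSo.mem_nhds hc] with t ht using key (k + 1) t ht

/-- Taylor's formula for a chain of successive derivatives. -/
lemma exists_polynomial_add_cauchyInt (hS : S.OrdConnected) (h0 : (0 : ℝ) ∈ S)
    (m : ℕ) {e : ℕ → ℝ → ℂ} (he : ∀ j < m + 1, ∀ c ∈ S, HasDerivAt (e j) (e (j + 1) c) c)
    (hc : ContinuousOn (e (m + 1)) S) :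
    ∃ P : Polynomial ℂ, P.degree < (m + 1 : ℕ) ∧
      ∀ c ∈ S, e 0 c = P.eval (c : ℂ) + cauchyInt m (e (m + 1)) c := by
  induction m with
  | zero =>
    refine ⟨Polynomial.C (e 0 0), ?_, fun c hcS => ?_⟩
    · exact Polynomial.degree_C_le.trans_lt (by norm_num)
    · have h := intervalIntegral.integral_eq_sub_of_hasDerivAt
        (fun t ht => he 0 (by norm_num) t (hS.uIcc_subset h0 hcS ht))
        (intervalIntegrable_of_continuousOn_ordConnected hS h0 hc hcS)
      simp [cauchyInt, h]
  | succ m ih =>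
    obtain ⟨P, hP, hPe⟩ := ih (fun j hj => he j (by omega)) (fun t ht =>
      (he (m + 1) (by omega) t ht).continuousAt.continuousWithinAt)
    refine ⟨P + Polynomial.C (e (m + 1) 0 * ((m + 1).factorial : ℂ)⁻¹) * Polynomial.X ^ (m + 1),
      ?_, fun c hcS => ?_⟩
    · refine (Polynomial.degree_add_le _ _).trans_lt (max_lt (hP.trans ?_) ?_)
      · exact_mod_cast Nat.lt_succ_self _
      · exact (Polynomial.degree_C_mul_X_pow_le _ _).trans_lt
          (by exact_mod_cast Nat.lt_succ_self _)
    · rw [hPe c hcS, cauchyInt_succ_primitive hS h0 (he (m + 1) (by omega)) hc m hcS]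
      simp only [Polynomial.eval_add, Polynomial.eval_mul, Polynomial.eval_C, Polynomial.eval_pow,
        Polynomial.eval_X]
      push_cast
      ring

/-- A polynomial of degree at most `m` plus an `(m + 1)`-fold primitive of `f`, followed by its
derivatives. -/
noncomputable def taylorChain (m : ℕ) (P : Polynomial ℂ) (f : ℝ → ℂ) (j : ℕ) (c : ℝ) : ℂ :=
  if j ≤ m then (Polynomial.derivative^[j] P).eval (c : ℂ) + cauchyInt (m - j) f c else f c

lemma hasDerivAt_taylorChain (hSo : IsOpen S) (hS : S.OrdConnected) (h0 : (0 : ℝ) ∈ S)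
    {m : ℕ} {P : Polynomial ℂ} (hP : P.degree < (m + 1 : ℕ)) {f : ℝ → ℂ} (hf : ContinuousOn f S)
    {j : ℕ} (hj : j < m + 1) {c : ℝ} (hc : c ∈ S) :
    HasDerivAt (taylorChain m P f j) (taylorChain m P f (j + 1) c) c := by
  have hd : HasDerivAt (fun c : ℝ => (Polynomial.derivative^[j] P).eval (c : ℂ))
      ((Polynomial.derivative^[j + 1] P).eval (c : ℂ)) c := by
    rw [Function.iterate_succ_apply']
    exact ((Polynomial.derivative^[j] P).hasDerivAt (c : ℂ)).comp_ofReal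
  have hl : taylorChain m P f j =
      fun c : ℝ => (Polynomial.derivative^[j] P).eval (c : ℂ) + cauchyInt (m - j) f c := by
    ext c
    simp [taylorChain, Nat.lt_succ_iff.1 hj]
  rw [hl]
  rcases (Nat.lt_succ_iff.1 hj).lt_or_eq with h | rfl
  · have e : m - j = (m - (j + 1)) + 1 := by omega
    rw [taylorChain, if_pos (by omega), e]
    exact hd.add (hasDerivAt_cauchyInt_succ hSo hS h0 _ hf hc)
  · rw [taylorChain, if_neg (by omega), Nat.sub_self]
    have h2 := hd.add (hasDerivAt_cauchyInt_zero hSo hS h0 hf hc)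
    have h3 : Polynomial.derivative^[j + 1] P = 0 := by
      apply Polynomial.iterate_derivative_eq_zero
      by_cases hP0 : P = 0
      · simp [hP0]
      · exact (Polynomial.natDegree_lt_iff_degree_lt hP0).2 hP
    rw [h3, Polynomial.eval_zero, zero_add] at h2
    exact h2

end

/-- Integration with respect to a parameter `ρ` commutes with the passage from the `(m + 1)`-st
derivative `b ρ` to the function `a ρ`, up to a polynomial. The polynomial parts of the functions
`a ρ` are integrable because they are determined by their values at `m + 1` nodes. -/
lemma integral_polynomial_add_cauchyInt {μ : Measure ℝ} [SFinite μ] (m : ℕ) {a b : ℝ → ℝ → ℂ}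
    (hab : ∀ᵐ ρ ∂μ, ∃ P : Polynomial ℂ, P.degree < (m + 1 : ℕ) ∧
      ∀ c ∈ Ioo (-1 : ℝ) 1, a ρ c = P.eval (c : ℂ) + cauchyInt m (b ρ) c)
    (ha : ∀ c ∈ Ioo (-1 : ℝ) 1, Integrable (fun ρ => a ρ c) μ)
    (hb : ∀ c ∈ Ioo (-1 : ℝ) 1,
      Integrable (Function.uncurry b) (μ.prod (volume.restrict (uIoc 0 c)))) :
    ∃ P : Polynomial ℂ, P.degree < (m + 1 : ℕ) ∧
      ∀ c ∈ Ioo (-1 : ℝ) 1, ∫ ρ, a ρ c ∂μ = P.eval (c : ℂ) +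
        cauchyInt m (fun s => ∫ ρ, b ρ s ∂μ) c := by
  have hw : ∀ c ∈ Ioo (-1 : ℝ) 1, Integrable (fun p : ℝ × ℝ =>
      (((c - p.2) ^ m / m.factorial : ℝ) : ℂ) * b p.1 p.2)
      (μ.prod (volume.restrict (uIoc 0 c))) := fun c hc => by
    have hK : AEStronglyMeasurable (fun p : ℝ × ℝ => (((c - p.2) ^ m / m.factorial : ℝ) : ℂ))
        (μ.prod (volume.restrict (uIoc 0 c))) :=
      (by fun_prop : Continuous fun p : ℝ × ℝ =>
        (((c - p.2) ^ m / m.factorial : ℝ) : ℂ)).aestronglyMeasurable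
    refine (hb c hc).bdd_mul (c := 2 ^ m) hK ?_
    have h1 : ∀ᵐ s ∂(volume.restrict (uIoc 0 c)), s ∈ uIoc 0 c :=
      ae_restrict_mem measurableSet_uIoc
    have h2 : ∀ᵐ p ∂(μ.prod (volume.restrict (uIoc 0 c))), p.2 ∈ uIoc 0 c :=
      Measure.quasiMeasurePreserving_snd.ae h1
    filter_upwards [h2] with p hp
    rw [Complex.norm_real, norm_div, norm_pow, Real.norm_eq_abs, RCLike.norm_natCast]
    have hp1 : |c - p.2| ≤ 2 := by
      rcases le_total 0 c with h | h
      · rw [uIoc_of_le h] at hp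
        rw [abs_le]; constructor <;> linarith [hp.1, hp.2, hc.1, hc.2]
      · rw [uIoc_of_ge h] at hp
        rw [abs_le]; constructor <;> linarith [hp.1, hp.2, hc.1, hc.2]
    calc |c - p.2| ^ m / m.factorial ≤ |c - p.2| ^ m / 1 := by
          gcongr; exact_mod_cast m.factorial_pos
      _ ≤ 2 ^ m := by rw [div_one]; gcongr
  have hform : ∀ (f : ℝ → ℂ) (c : ℝ), cauchyInt m f c =
      (if 0 ≤ c then (1 : ℝ) else -1) •
        ∫ s in uIoc 0 c, (((c - s) ^ m / m.factorial : ℝ) : ℂ) * f s := fun f c =>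
    intervalIntegral.intervalIntegral_eq_integral_uIoc _ _ _ _
  have hR1 : ∀ c ∈ Ioo (-1 : ℝ) 1, Integrable (fun ρ => cauchyInt m (b ρ) c) μ := fun c hc => by
    simp only [hform]
    exact (hw c hc).integral_prod_left.smul (if 0 ≤ c then (1 : ℝ) else -1)
  have hR2 : ∀ c ∈ Ioo (-1 : ℝ) 1, ∫ ρ, cauchyInt m (b ρ) c ∂μ =
      cauchyInt m (fun s => ∫ ρ, b ρ s ∂μ) c := fun c hc => by
    simp only [hform]
    rw [integral_smul (if 0 ≤ c then (1 : ℝ) else -1), integral_integral_swap (hw c hc)]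
    simp only [integral_const_mul]
  -- distinct nodes in `(-1, 1)` for the interpolation: `1 / (2 (i + 1))`
  set v : ℕ → ℂ := fun i => (((i + 1 : ℝ)⁻¹ / 2 : ℝ) : ℂ) with hv
  have hvm : ∀ i : ℕ, ((i + 1 : ℝ)⁻¹ / 2 : ℝ) ∈ Ioo (-1 : ℝ) 1 := fun i => by
    have h1 : (0 : ℝ) < (i + 1 : ℝ)⁻¹ := by positivity
    have h2 : (i + 1 : ℝ)⁻¹ ≤ 1 := inv_le_one_of_one_le₀ (by linarith [i.cast_nonneg (α := ℝ)])
    constructor <;> linarith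
  have hvi : InjOn v (Finset.range (m + 1) : Set ℕ) := fun i _ j _ h => by
    simp only [hv, Complex.ofReal_inj] at h
    have h3 : (i + 1 : ℝ)⁻¹ = (j + 1 : ℝ)⁻¹ := by linarith
    have := inv_injective h3
    exact_mod_cast (add_left_injective (1 : ℝ)) this
  set d : ℝ → ℝ → ℂ := fun ρ c => a ρ c - cauchyInt m (b ρ) c with hd
  have hdi : ∀ c ∈ Ioo (-1 : ℝ) 1, Integrable (fun ρ => d ρ c) μ := fun c hc =>
    (ha c hc).sub (hR1 c hc)
  refine ⟨Lagrange.interpolate (Finset.range (m + 1)) v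
    (fun i => ∫ ρ, d ρ ((i + 1 : ℝ)⁻¹ / 2) ∂μ), ?_, fun c hc => ?_⟩
  · simpa using Lagrange.degree_interpolate_lt (s := Finset.range (m + 1)) (v := v)
      (fun i : ℕ => ∫ ρ, d ρ ((i + 1 : ℝ)⁻¹ / 2) ∂μ) hvi
  · have h1 : ∫ ρ, a ρ c ∂μ = ∫ ρ, d ρ c ∂μ + ∫ ρ, cauchyInt m (b ρ) c ∂μ := by
      rw [← integral_add (hdi c hc) (hR1 c hc)]
      simp [hd]
    rw [h1, hR2 c hc]
    congr 1
    rw [Lagrange.interpolate_apply, Polynomial.eval_finsetSum]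
    simp only [Polynomial.eval_mul, Polynomial.eval_C]
    simp only [← integral_mul_const]
    rw [← integral_finsetSum _ (fun i _ => (hdi _ (hvm i)).mul_const _)]
    apply integral_congr_ae
    filter_upwards [hab] with ρ ⟨P, hP, hPe⟩
    have e1 : d ρ c = P.eval (c : ℂ) := by simp [hd, hPe c hc]
    have e2 : ∀ i : ℕ, d ρ ((i + 1 : ℝ)⁻¹ / 2) = P.eval (v i) := fun i => by
      simp only [hd, hPe _ (hvm i), hv]; ring
    rw [e1]
    simp only [e2]
    have h4 := Lagrange.eq_interpolate (f := P) hvi (by simpa using hP)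
    conv_lhs => rw [h4]
    rw [Lagrange.interpolate_apply, Polynomial.eval_finsetSum]
    simp

/-! ### Powers of `R_d` and derivatives with respect to the cosine of the angle -/

lemma hasRd_of_hasDerivAt {e e' : ℝ → ℝ → ℂ}
    (he : ∀ r > 0, ∀ c ∈ Ioo (-1 : ℝ) 1, HasDerivAt (e r) (2 * r * e' r c) c)
    {f f₁ : ℂ → ℂ} (hf : ∀ z : ℂ, z.im ≠ 0 → f z = e ‖z‖ (z.re / ‖z‖))
    (hf₁ : ∀ z : ℂ, z.im ≠ 0 → f₁ z = e' ‖z‖ (z.re / ‖z‖)) : HasRd f f₁ := by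
  intro z hz
  have hz0 : z ≠ 0 := fun h => hz (by simp [h])
  have hr : 0 < ‖z‖ := norm_pos_iff.2 hz0
  have hc : z.re / ‖z‖ ∈ Ioo (-1 : ℝ) 1 := by
    rw [mem_Ioo, ← abs_lt, abs_div, abs_norm, div_lt_one hr]
    exact (Complex.abs_re_lt_norm).2 hz
  have hd : HasDerivAt (fun t : ℝ => (cos t * z.re - sin t * z.im) / ‖z‖) (-z.im / ‖z‖) 0 := by
    have := (((hasDerivAt_cos (0 : ℝ)).mul_const z.re).sub
      ((hasDerivAt_sin (0 : ℝ)).mul_const z.im)).div_const ‖z‖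
    simpa using this
  have hre : ∀ t : ℝ, (Complex.exp (t * Complex.I) * z).re = cos t * z.re - sin t * z.im := by
    intro t
    rw [Complex.mul_re, Complex.exp_ofReal_mul_I_re, Complex.exp_ofReal_mul_I_im]
  have him : ∀ t : ℝ, (Complex.exp (t * Complex.I) * z).im = cos t * z.im + sin t * z.re := by
    intro t
    rw [Complex.mul_im, Complex.exp_ofReal_mul_I_re, Complex.exp_ofReal_mul_I_im]
  have hn : ∀ t : ℝ, ‖Complex.exp (t * Complex.I) * z‖ = ‖z‖ := fun t => by
    rw [norm_mul, Complex.norm_exp_ofReal_mul_I, one_mul]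
  have hev : (fun t : ℝ => f (Complex.exp (t * Complex.I) * z)) =ᶠ[𝓝 0]
      fun t : ℝ => e ‖z‖ ((cos t * z.re - sin t * z.im) / ‖z‖) := by
    have hcont : ContinuousAt (fun t : ℝ => cos t * z.im + sin t * z.re) 0 := by fun_prop
    have : ∀ᶠ t : ℝ in 𝓝 0, cos t * z.im + sin t * z.re ≠ 0 :=
      hcont.eventually_ne (by simpa using hz)
    filter_upwards [this] with t ht
    rw [hf _ (by rw [him]; exact ht), hn, hre]
  have hc' : (cos 0 * z.re - sin 0 * z.im) / ‖z‖ = z.re / ‖z‖ := by simp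
  have h1 : HasDerivAt (e ‖z‖) (2 * ‖z‖ * e' ‖z‖ (z.re / ‖z‖))
      ((cos 0 * z.re - sin 0 * z.im) / ‖z‖) := by
    rw [hc']; exact he _ hr _ hc
  have h2 := (h1.scomp (0 : ℝ) hd).congr_of_eventuallyEq hev
  refine ⟨h2.differentiableAt, ?_⟩
  rw [Rd, h2.deriv, hf₁ z hz, Complex.real_smul]
  have h3 : z - starRingEnd ℂ z = 2 * z.im * Complex.I := by
    rw [Complex.sub_conj]; push_cast; ring
  have h4 : (‖z‖ : ℂ) ≠ 0 := by exact_mod_cast hr.ne'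
  have h5 : (z.im : ℂ) ≠ 0 := by exact_mod_cast hz
  rw [h3]
  push_cast
  field_simp

/-- A chain of derivatives with respect to the cosine of the angle, on each circle around `0`, is a
chain for `R_d`. -/
lemma hasRdPow_of_chain (l : ℕ) {e : ℕ → ℝ → ℝ → ℂ}
    (he : ∀ r > 0, ∀ j < l, ∀ c ∈ Ioo (-1 : ℝ) 1, HasDerivAt (e j r) (2 * r * e (j + 1) r c) c)
    {f F : ℂ → ℂ} (hf : ∀ z : ℂ, z.im ≠ 0 → f z = e 0 ‖z‖ (z.re / ‖z‖))
    (hF : ∀ z : ℂ, z.im ≠ 0 → F z = e l ‖z‖ (z.re / ‖z‖)) : HasRdPow l f F := by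
  induction l generalizing e f with
  | zero => exact fun z hz => by rw [hf z hz, hF z hz]
  | succ l ih =>
    exact ⟨fun z => e 1 ‖z‖ (z.re / ‖z‖),
      hasRd_of_hasDerivAt (fun r hr => he r hr 0 l.succ_pos) hf (fun z _ => rfl),
      ih (e := fun j => e (j + 1)) (fun r hr j hj => he r hr (j + 1) (by omega))
        (fun z _ => rfl) hF⟩

/-- The point with polar coordinates `ρ` and `arccos c`, in the closed upper half plane. -/
noncomputable def upperPoint (ρ c : ℝ) : ℂ := ρ * Complex.exp (arccos c * Complex.I)

lemma im_upperPoint {ρ c : ℝ} (hρ : 0 < ρ) (hc : c ∈ Ioo (-1 : ℝ) 1) : 0 < (upperPoint ρ c).im := by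
  rw [upperPoint, Complex.im_ofReal_mul, Complex.exp_ofReal_mul_I_im, sin_arccos]
  exact mul_pos hρ (sqrt_pos.2 (by nlinarith [hc.1, hc.2]))

lemma HasRd.hasDerivAt_upperPoint {f F : ℂ → ℂ} (h : HasRd f F) {ρ c : ℝ} (hρ : 0 < ρ)
    (hc : c ∈ Ioo (-1 : ℝ) 1) :
    HasDerivAt (fun c => f (upperPoint ρ c)) (2 * ρ * F (upperPoint ρ c)) c := by
  have him := im_upperPoint hρ hc
  obtain ⟨h1, h2⟩ := h _ him.ne'
  have hs : 0 < √(1 - c ^ 2) := sqrt_pos.2 (by nlinarith [hc.1, hc.2])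
  have ha := (hasDerivAt_arccos (ne_of_gt hc.1) (ne_of_lt hc.2)).sub_const (arccos c)
  have h3 : HasDerivAt (fun t : ℝ => f (Complex.exp (t * Complex.I) * upperPoint ρ c))
      (deriv (fun t : ℝ => f (Complex.exp (t * Complex.I) * upperPoint ρ c)) 0)
      (arccos c - arccos c) := by
    rw [sub_self]; exact h1.hasDerivAt
  have h4 := h3.scomp c ha
  have h5 : (fun c' => f (upperPoint ρ c')) =
      (fun t : ℝ => f (Complex.exp (t * Complex.I) * upperPoint ρ c)) ∘
        (fun c' => arccos c' - arccos c) := by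
    ext c'
    simp only [Function.comp, upperPoint]
    congr 1
    rw [mul_left_comm, ← Complex.exp_add]
    congr 2
    push_cast
    ring
  rw [h5]
  refine h4.congr_deriv ?_
  have h6 : upperPoint ρ c - starRingEnd ℂ (upperPoint ρ c) = 2 * ρ * √(1 - c ^ 2) * Complex.I := by
    rw [Complex.sub_conj, upperPoint, Complex.im_ofReal_mul, Complex.exp_ofReal_mul_I_im,
      sin_arccos]
    push_cast; ring
  have h7 : (√(1 - c ^ 2) : ℂ) ≠ 0 := by exact_mod_cast hs.ne'
  have h8 : (ρ : ℂ) ≠ 0 := by exact_mod_cast hρ.ne'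
  rw [← h2, Rd, h6, Complex.real_smul]
  generalize deriv (fun t : ℝ => f (Complex.exp (t * Complex.I) * upperPoint ρ c)) 0 = d
  push_cast
  field_simp

/-- On each circle around `0`, a chain for `R_d` is a chain of derivatives with respect to the
cosine of the angle. -/
lemma HasRdPow.exists_chain {l : ℕ} {f F : ℂ → ℂ} (h : HasRdPow l f F) {ρ : ℝ} (hρ : 0 < ρ) :
    ∃ e : ℕ → ℝ → ℂ, (∀ j < l, ∀ c ∈ Ioo (-1 : ℝ) 1, HasDerivAt (e j) (e (j + 1) c) c) ∧
      (∀ c ∈ Ioo (-1 : ℝ) 1, e 0 c = f (upperPoint ρ c)) ∧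
      ∀ c ∈ Ioo (-1 : ℝ) 1, e l c = (2 * ρ) ^ l * F (upperPoint ρ c) := by
  induction l generalizing f with
  | zero =>
    refine ⟨fun _ c => f (upperPoint ρ c), by simp, by simp, fun c hc => ?_⟩
    simpa using h _ (im_upperPoint hρ hc).ne'
  | succ l ih =>
    obtain ⟨f₁, h1, h2⟩ := h
    obtain ⟨e, he, he0, hel⟩ := ih h2
    refine ⟨fun j => Nat.casesOn j (fun c => f (upperPoint ρ c)) (fun j c => 2 * ρ * e j c),
      ?_, fun c hc => rfl, fun c hc => ?_⟩
    · intro j hj c hc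
      cases j with
      | zero =>
        refine (h1.hasDerivAt_upperPoint hρ hc).congr_deriv ?_
        simp only [he0 c hc]
      | succ j => exact (he j (by omega) c hc).const_mul _
    · simp only [hel c hc]; ring

/-! ### The planar kernel as a function of the squared distance -/

/-- Coefficients of `q^{b-j} log q` and of `q^{b-j}` in the `j`-th derivative of
`q^b (s log q + t)`. -/
noncomputable def logPowCoeff (b s t : ℝ) : ℕ → ℝ × ℝ
  | 0 => (s, t)
  | j + 1 => ((b - j) * (logPowCoeff b s t j).1,
      (b - j) * (logPowCoeff b s t j).2 + (logPowCoeff b s t j).1)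

/-- The `j`-th derivative of `q^b (s log q + t)`. -/
noncomputable def logPow (b s t : ℝ) (j : ℕ) (q : ℝ) : ℝ :=
  q ^ (b - j) * ((logPowCoeff b s t j).1 * log q + (logPowCoeff b s t j).2)

lemma hasDerivAt_logPow (b s t : ℝ) (j : ℕ) {q : ℝ} (hq : 0 < q) :
    HasDerivAt (logPow b s t j) (logPow b s t (j + 1) q) q := by
  have h1 := (hasDerivAt_rpow_const (x := q) (p := b - j) (Or.inl hq.ne')).mul
    (((hasDerivAt_log hq.ne').const_mul (logPowCoeff b s t j).1).add_const
      (logPowCoeff b s t j).2)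
  refine h1.congr_deriv ?_
  have h2 : q ^ (b - j) = q ^ (b - j - 1) * q := by
    rw [← rpow_add_one hq.ne']; congr 1; ring
  have h3 : b - ((j + 1 : ℕ) : ℝ) = b - j - 1 := by push_cast; ring
  simp only [logPow, logPowCoeff, h3]
  rw [h2]
  field_simp
  ring

/-- The two coefficients of the planar kernel as a function of the squared distance. -/
noncomputable def planeCoeff (β : ℝ) : ℝ × ℝ :=
  open Classical in
  if ∃ k : ℕ, β = k + 1 then
    ((-1) ^ ⌊β⌋₊ / ((4 : ℝ) ^ β * π * Real.Gamma β ^ 2), 0)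
  else (0, propConst 1 β)

/-- The `j`-th derivative of the planar kernel as a function of the squared distance. -/
noncomputable def planePow (β : ℝ) (j : ℕ) (q : ℝ) : ℝ :=
  logPow (β - 1) (planeCoeff β).1 (planeCoeff β).2 j q

lemma planeKernel_eq (β : ℝ) {r : ℝ} (hr : 0 < r) : planeKernel β r = planePow β 0 (r ^ 2) := by
  have h1 : (r ^ 2) ^ (β - 1) = r ^ (2 * β - 2) := by
    rw [← rpow_natCast r 2, ← rpow_mul hr.le]; congr 1; push_cast; ring
  unfold planeKernel planePow logPow planeCoeff
  split_ifs with h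
  · simp only [logPowCoeff, Nat.cast_zero, sub_zero, h1, log_pow]
    push_cast; ring
  · simp only [logPowCoeff, Nat.cast_zero, sub_zero, h1]
    ring

/-- The derivative of order `D / 2 - 1` of the planar kernel with respect to the squared distance
is, up to a constant, the kernel in dimension `D`, for the logarithmic kernels too. -/
lemma planePow_eq (l : ℕ) {β : ℝ} (hβ' : β < (l : ℝ) + 1) (q : ℝ) :
    planePow β l q = (-1) ^ l * π ^ l * propConst ((l : ℝ) + 1) β * q ^ (-((l : ℝ) + 1 - β)) := by
  have hpi : (π : ℝ) ^ ((l : ℝ) + 1) = π ^ l * π := by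
    rw [rpow_add_one pi_pos.ne', rpow_natCast]
  have hq : q ^ (β - 1 - l) = q ^ (-((l : ℝ) + 1 - β)) := by congr 1; ring
  suffices h : logPowCoeff (β - 1) (planeCoeff β).1 (planeCoeff β).2 l =
      (0, (-1) ^ l * π ^ l * propConst ((l : ℝ) + 1) β) by
    rw [planePow, logPow, h, hq]; ring
  by_cases hk : ∃ k : ℕ, β = k + 1
  · obtain ⟨k, rfl⟩ := hk
    have hfl : ⌊(k : ℝ) + 1⌋₊ = k + 1 := by exact_mod_cast Nat.floor_natCast (R := ℝ) (k + 1)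
    have hc : planeCoeff ((k : ℝ) + 1) =
        ((-1) ^ (k + 1) / ((4 : ℝ) ^ ((k : ℝ) + 1) * π * (k.factorial : ℝ) ^ 2), 0) := by
      unfold planeCoeff
      rw [if_pos ⟨k, rfl⟩, hfl, Real.Gamma_nat_eq_factorial]
    rw [hc, add_sub_cancel_right]
    set s : ℝ := (-1) ^ (k + 1) / ((4 : ℝ) ^ ((k : ℝ) + 1) * π * (k.factorial : ℝ) ^ 2) with hs
    have h1 : ∀ j ≤ k, (logPowCoeff (k : ℝ) s 0 j).1 * (k - j).factorial =
        s * k.factorial := by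
      intro j hj
      induction j with
      | zero => simp [logPowCoeff]
      | succ j ih =>
        rw [← ih (by omega), show k - j = (k - (j + 1)) + 1 by omega, Nat.factorial_succ]
        simp only [logPowCoeff]
        have : ((k - (j + 1) : ℕ) : ℝ) = k - j - 1 := by
          rw [Nat.cast_sub hj]; push_cast; ring
        push_cast [this]
        ring
    have h2 : ∀ i : ℕ, logPowCoeff (k : ℝ) s 0 (k + 1 + i) =
        (0, (-1) ^ i * i.factorial * (s * k.factorial)) := by
      intro i
      induction i with
      | zero =>
        have := h1 k le_rfl
        simp only [Nat.sub_self, Nat.factorial_zero, Nat.cast_one, mul_one] at this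
        ext <;> simp [logPowCoeff, this]
      | succ i ih =>
        rw [← add_assoc, logPowCoeff, ih, Nat.factorial_succ]
        ext
        · simp
        · push_cast; ring
    obtain ⟨i, rfl⟩ : ∃ i, l = k + 1 + i := ⟨l - (k + 1), by
      have : (k : ℝ) < l := by linarith
      have : k < l := by exact_mod_cast this
      omega⟩
    rw [h2]
    ext
    · rfl
    · have h3 : ((k + 1 + i : ℕ) : ℝ) + 1 - ((k : ℝ) + 1) = i + 1 := by push_cast; ring
      simp only [propConst]
      rw [h3, hpi, Real.Gamma_nat_eq_factorial, Real.Gamma_nat_eq_factorial, hs]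
      have h4 : ((4 : ℝ) ^ ((k : ℝ) + 1)) ≠ 0 := by positivity
      have h5 : (k.factorial : ℝ) ≠ 0 := by positivity
      field_simp
      ring
  · have hc : planeCoeff β = (0, propConst 1 β) := if_neg hk
    rw [hc]
    have h1 : ∀ j : ℕ, logPowCoeff (β - 1) 0 (propConst 1 β) j =
        (0, (-1) ^ j * (Real.Gamma (j + 1 - β) / ((4 : ℝ) ^ β * π * Real.Gamma β))) := by
      intro j
      induction j with
      | zero => simp [logPowCoeff, propConst]
      | succ j ih =>
        have hne : (j : ℝ) + 1 - β ≠ 0 := fun h => hk ⟨j, by linarith⟩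
        rw [logPowCoeff, ih]
        ext
        · simp
        · have : ((j + 1 : ℕ) : ℝ) + 1 - β = ((j : ℝ) + 1 - β) + 1 := by push_cast; ring
          rw [this, Real.Gamma_add_one hne]
          ring
    rw [h1]
    ext
    · rfl
    · simp only [propConst]
      rw [hpi]
      have : (π : ℝ) ^ l ≠ 0 := by positivity
      field_simp

/-- The planar kernel between a circle of radius `r` and a circle of radius `ρ` as a function of the
cosine of the angle, with its derivatives. -/
noncomputable def annulusKernel (β r ρ : ℝ) (j : ℕ) (t : ℝ) : ℝ :=
  (-(2 * r * ρ)) ^ j * planePow β j (r ^ 2 + ρ ^ 2 - 2 * r * ρ * t)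

lemma annulus_dist_sq_ge {r ρ t : ℝ} (hr : 0 ≤ r) (hρ : 0 ≤ ρ) (ht : |t| ≤ 1) :
    (r - ρ) ^ 2 ≤ r ^ 2 + ρ ^ 2 - 2 * r * ρ * t := by
  nlinarith [mul_nonneg hr hρ, (abs_le.1 ht).2]

lemma isKernelChain_annulusKernel (β : ℝ) {r ρ : ℝ} (hr : 0 ≤ r) (hρ : 0 ≤ ρ) (hne : r ≠ ρ) :
    IsKernelChain (annulusKernel β r ρ) := by
  intro j t ht
  have hq : 0 < r ^ 2 + ρ ^ 2 - 2 * r * ρ * t :=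
    (sq_pos_of_ne_zero (sub_ne_zero.2 hne)).trans_le (annulus_dist_sq_ge hr hρ ht)
  have h1 : HasDerivAt (fun t => r ^ 2 + ρ ^ 2 - 2 * r * ρ * t) (-(2 * r * ρ)) t := by
    simpa using ((hasDerivAt_id t).const_mul (2 * r * ρ)).const_sub (r ^ 2 + ρ ^ 2)
  have h2 := ((hasDerivAt_logPow (β - 1) (planeCoeff β).1 (planeCoeff β).2 j hq).comp t h1).const_mul
    ((-(2 * r * ρ)) ^ j)
  refine h2.congr_deriv ?_
  simp only [annulusKernel, planePow]
  ring

lemma norm_polar_sub_sq (r ρ φ θ : ℝ) :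
    ‖(r : ℂ) * Complex.exp (φ * Complex.I) - ρ * Complex.exp (θ * Complex.I)‖ ^ 2 =
      r ^ 2 + ρ ^ 2 - 2 * r * ρ * cos (φ - θ) := by
  rw [← Complex.normSq_eq_norm_sq, Complex.normSq_apply]
  simp only [Complex.sub_re, Complex.sub_im, Complex.re_ofReal_mul, Complex.im_ofReal_mul,
    Complex.exp_ofReal_mul_I_re, Complex.exp_ofReal_mul_I_im, cos_sub]
  linear_combination r ^ 2 * sin_sq_add_cos_sq φ + ρ ^ 2 * sin_sq_add_cos_sq θ

lemma planeKernel_norm_sub (β : ℝ) {r ρ : ℝ} (hr : 0 ≤ r) (hρ : 0 ≤ ρ) (hne : r ≠ ρ) (φ θ : ℝ) :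
    planeKernel β ‖(r : ℂ) * Complex.exp (φ * Complex.I) - ρ * Complex.exp (θ * Complex.I)‖ =
      annulusKernel β r ρ 0 (cos (φ - θ)) := by
  have h := norm_polar_sub_sq r ρ φ θ
  have hq : 0 < r ^ 2 + ρ ^ 2 - 2 * r * ρ * cos (φ - θ) :=
    (sq_pos_of_ne_zero (sub_ne_zero.2 hne)).trans_le (annulus_dist_sq_ge hr hρ (abs_cos_le_one _))
  rw [planeKernel_eq, h, annulusKernel, pow_zero, one_mul]
  rw [← h] at hq
  exact lt_of_le_of_ne (norm_nonneg _) fun h0 => by simp [← h0] at hq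

/-! ### The ladder integral as an iterated integral -/

/-- The chain integral from `x` to `c` with `L` intermediate points, lines of index `γ`, and the
weight `W` at the intermediate points. -/
noncomputable def chain {l : ℕ} (γ : ℝ) (W : Space l → ENNReal) (c : Space l) :
    ℕ → Space l → ENNReal
  | 0, x => ENNReal.ofReal (‖x - c‖ ^ (-(2 * γ)))
  | L + 1, x => ∫⁻ y, ENNReal.ofReal (‖x - y‖ ^ (-(2 * γ))) * (W y * chain γ W c L y)

lemma measurable_chain {l : ℕ} (γ : ℝ) {W : Space l → ENNReal} (hW : Measurable W) (c : Space l)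
    (L : ℕ) : Measurable (chain γ W c L) := by
  induction L with
  | zero =>
    change Measurable fun x => ENNReal.ofReal (‖x - c‖ ^ (-(2 * γ)))
    fun_prop
  | succ L ih =>
    change Measurable fun x => ∫⁻ y, ENNReal.ofReal (‖x - y‖ ^ (-(2 * γ))) * (W y * chain γ W c L y)
    apply Measurable.lintegral_prod_right
    have h1 : Measurable fun p : Space l × Space l => W p.2 * chain γ W c L p.2 :=
      (hW.comp measurable_snd).mul (ih.comp measurable_snd)
    have h2 : Measurable fun p : Space l × Space l => ENNReal.ofReal (‖p.1 - p.2‖ ^ (-(2 * γ))) := by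
      fun_prop
    exact h2.mul h1

/-- The integrand of `ladderIntegral`. -/
noncomputable def ladderIntegrand (l : ℕ) (β γ : ℝ) (L : ℕ) (x₁ x₂ x₃ x₄ : Space l)
    (w : Fin L → Space l) : ℝ :=
  (∏ i : Fin L, ‖x₂ - w i‖ ^ (-(2 * β)) * ‖x₄ - w i‖ ^ (-(2 * β))) *
      ∏ m : Fin (L + 1),
        ‖(Fin.cons x₁ (Fin.snoc w x₃ : Fin (L + 1) → Space l) : Fin (L + 2) → Space l) m.castSucc -
          (Fin.cons x₁ (Fin.snoc w x₃ : Fin (L + 1) → Space l) : Fin (L + 2) → Space l) m.succ‖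
          ^ (-(2 * γ))

lemma ladderIntegrand_nonneg (l : ℕ) (β γ : ℝ) (L : ℕ) (x₁ x₂ x₃ x₄ : Space l)
    (w : Fin L → Space l) : 0 ≤ ladderIntegrand l β γ L x₁ x₂ x₃ x₄ w := by
  unfold ladderIntegrand
  refine mul_nonneg (Finset.prod_nonneg fun i _ => by positivity)
    (Finset.prod_nonneg fun i _ => by positivity)

lemma ladderIntegrand_cons (l : ℕ) (β γ : ℝ) (L : ℕ) (x₁ x₂ x₃ x₄ y : Space l)
    (w : Fin L → Space l) :
    ladderIntegrand l β γ (L + 1) x₁ x₂ x₃ x₄ (Fin.cons y w) =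
      ‖x₁ - y‖ ^ (-(2 * γ)) * ((‖x₂ - y‖ ^ (-(2 * β)) * ‖x₄ - y‖ ^ (-(2 * β))) *
        ladderIntegrand l β γ L y x₂ x₃ x₄ w) := by
  unfold ladderIntegrand
  rw [← Fin.cons_snoc_eq_snoc_cons, Fin.prod_univ_succ (n := L), Fin.prod_univ_succ (n := L + 1)]
  simp only [Fin.cons_zero, Fin.cons_succ, Fin.castSucc_zero, ← Fin.succ_castSucc]
  ring

lemma measurable_ladderIntegrand (l : ℕ) (β γ : ℝ) (L : ℕ) (x₂ x₃ x₄ : Space l) :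
    Measurable fun p : Space l × (Fin L → Space l) =>
      ladderIntegrand l β γ L p.1 x₂ x₃ x₄ p.2 := by
  unfold ladderIntegrand
  have h1 : ∀ i : Fin (L + 1), Measurable fun p : Space l × (Fin L → Space l) =>
      (Fin.snoc p.2 x₃ : Fin (L + 1) → Space l) i := fun i => by
    refine Fin.lastCases ?_ (fun i => ?_) i
    · simp
    · simp only [Fin.snoc_castSucc]; fun_prop
  have h2 : ∀ i : Fin (L + 2), Measurable fun p : Space l × (Fin L → Space l) =>
      (Fin.cons p.1 (Fin.snoc p.2 x₃ : Fin (L + 1) → Space l) : Fin (L + 2) → Space l) i :=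
    fun i => by
      refine Fin.cases ?_ (fun i => ?_) i
      · simp only [Fin.cons_zero]; fun_prop
      · simp only [Fin.cons_succ]; exact h1 i
  refine Measurable.mul ?_ ?_
  · refine Finset.measurable_prod _ fun i _ => ?_
    fun_prop
  · refine Finset.measurable_prod _ fun i _ => ?_
    exact (((h2 i.castSucc).sub (h2 i.succ)).norm).pow_const _

lemma measurable_ladderIntegrand_right (l : ℕ) (β γ : ℝ) (L : ℕ) (x₁ x₂ x₃ x₄ : Space l) :
    Measurable (ladderIntegrand l β γ L x₁ x₂ x₃ x₄) := by
  have h : Measurable fun w : Fin L → Space l => (x₁, w) := measurable_prodMk_left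
  have h2 := (measurable_ladderIntegrand l β γ L x₂ x₃ x₄).comp h
  simpa only [Function.comp_def] using h2

lemma lintegral_ladderIntegrand (l : ℕ) (β γ : ℝ) (L : ℕ) (x₁ x₂ x₃ x₄ : Space l) :
    ∫⁻ w : Fin L → Space l, ENNReal.ofReal (ladderIntegrand l β γ L x₁ x₂ x₃ x₄ w) =
      chain γ (fun y => ENNReal.ofReal (‖x₂ - y‖ ^ (-(2 * β)) * ‖x₄ - y‖ ^ (-(2 * β)))) x₃ L x₁ := by
  induction L generalizing x₁ with
  | zero =>
    rw [volume_pi, Measure.pi_of_empty, lintegral_dirac]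
    simp [ladderIntegrand, chain, Fin.snoc]
  | succ L ih =>
    rw [(volume_preserving_piFinSuccAbove (fun _ : Fin (L + 1) => Space l) 0).symm
      |>.lintegral_map_equiv]
    rw [Measure.volume_eq_prod, lintegral_prod]
    · simp only [chain, MeasurableEquiv.piFinSuccAbove_symm_apply, ← ih]
      refine lintegral_congr fun y => ?_
      have hm := measurable_ladderIntegrand_right l β γ L y x₂ x₃ x₄
      have e : ∀ A B : ENNReal, ∫⁻ w, A * (B * ENNReal.ofReal (ladderIntegrand l β γ L y x₂ x₃ x₄ w)) =
          A * (B * ∫⁻ w, ENNReal.ofReal (ladderIntegrand l β γ L y x₂ x₃ x₄ w)) := fun A B => by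
        rw [lintegral_const_mul A (hm.ennreal_ofReal.const_mul B),
          lintegral_const_mul B hm.ennreal_ofReal]
      rw [← e]
      refine lintegral_congr fun w => ?_
      have hcons : (Fin.insertNthEquiv (fun _ : Fin (L + 1) => Space l) 0) (y, w) = Fin.cons y w :=
        Fin.insertNth_zero' y w
      rw [hcons, ladderIntegrand_cons, ENNReal.ofReal_mul (by positivity),
        ENNReal.ofReal_mul (by positivity)]
    · refine (Measurable.ennreal_ofReal ?_).aemeasurable
      exact (measurable_ladderIntegrand_right l β γ (L + 1) x₁ x₂ x₃ x₄).comp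
        (MeasurableEquiv.piFinSuccAbove (fun _ : Fin (L + 1) => Space l) 0).symm.measurable

lemma ladderIntegral_eq_toReal_chain (l : ℕ) (β γ : ℝ) (L : ℕ) (x₁ x₂ x₃ x₄ : Space l) :
    ladderIntegral l β γ L x₁ x₂ x₃ x₄ =
      (chain γ (fun y => ENNReal.ofReal (‖x₂ - y‖ ^ (-(2 * β)) * ‖x₄ - y‖ ^ (-(2 * β))))
        x₃ L x₁).toReal := by
  rw [← lintegral_ladderIntegrand]
  refine integral_eq_lintegral_of_nonneg_ae
    (Eventually.of_forall (ladderIntegrand_nonneg l β γ L x₁ x₂ x₃ x₄)) ?_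
  exact (measurable_ladderIntegrand_right l β γ L x₁ x₂ x₃ x₄).aestronglyMeasurable

/-! ### Conformal changes of variables -/

/-- Behaviour of a chain integral under a conformal map `T` with conformal factor `ω ^ 2`. -/
lemma chain_conformal {l : ℕ} {γ : ℝ} {T : Space l → Space l} {ω : Space l → ℝ}
    {S : Set (Space l)} (hS : ∀ᵐ y, y ∈ S) (hω : ∀ y ∈ S, 0 < ω y)
    (hd : ∀ x ∈ S, ∀ y ∈ S, ‖T x - T y‖ = ω x * ω y * ‖x - y‖)
    (hint : ∀ f : Space l → ENNReal,
      ∫⁻ y, f y = ∫⁻ y, ENNReal.ofReal (ω y ^ (2 * (2 * l + 2))) * f (T y))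
    {W W' : Space l → ENNReal} {M : ℝ} (hM : 0 ≤ M)
    (hW : ∀ y ∈ S, ENNReal.ofReal (ω y ^ (2 * (2 * l + 2)) * (ω y ^ (-(2 * γ)) * ω y ^ (-(2 * γ))))
      * W' (T y) = ENNReal.ofReal M * W y) {c : Space l} (hc : c ∈ S) (L : ℕ)
    {x : Space l} (hx : x ∈ S) :
    chain γ W' (T c) L (T x) =
      ENNReal.ofReal (ω x ^ (-(2 * γ)) * ω c ^ (-(2 * γ)) * M ^ L) * chain γ W c L x := by
  have hk : ∀ x ∈ S, ∀ y ∈ S, ENNReal.ofReal (‖T x - T y‖ ^ (-(2 * γ))) =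
      ENNReal.ofReal (ω x ^ (-(2 * γ))) * ENNReal.ofReal (ω y ^ (-(2 * γ))) *
        ENNReal.ofReal (‖x - y‖ ^ (-(2 * γ))) := fun x hx y hy => by
    have h1 := (hω x hx).le
    have h2 := (hω y hy).le
    rw [hd x hx y hy, mul_rpow (by positivity) (norm_nonneg _), mul_rpow h1 h2,
      ENNReal.ofReal_mul (by positivity), ENNReal.ofReal_mul (by positivity)]
  induction L generalizing x with
  | zero =>
    have h1 := (hω x hx).le
    simp only [chain]
    rw [hk x hx c hc, pow_zero, mul_one, ENNReal.ofReal_mul (by positivity)]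
  | succ L ih =>
    simp only [chain]
    rw [hint, ← lintegral_const_mul' _ _ ENNReal.ofReal_ne_top]
    apply lintegral_congr_ae
    filter_upwards [hS] with y hy
    have h1 := (hω x hx).le
    have h2 := (hω y hy).le
    have h3 := (hω c hc).le
    rw [hk x hx y hy, ih hy, pow_succ]
    have hW' := hW y hy
    rw [ENNReal.ofReal_mul (by positivity), ENNReal.ofReal_mul (by positivity)] at hW'
    have e1 : ENNReal.ofReal (ω x ^ (-(2 * γ)) * ω c ^ (-(2 * γ)) * (M ^ L * M)) =
        ENNReal.ofReal (ω x ^ (-(2 * γ))) * ENNReal.ofReal (ω c ^ (-(2 * γ)) * M ^ L) *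
          ENNReal.ofReal M := by
      rw [← ENNReal.ofReal_mul (by positivity), ← ENNReal.ofReal_mul (by positivity)]
      congr 1; ring
    have e2 : ENNReal.ofReal (ω y ^ (-(2 * γ)) * ω c ^ (-(2 * γ)) * M ^ L) =
        ENNReal.ofReal (ω y ^ (-(2 * γ))) * ENNReal.ofReal (ω c ^ (-(2 * γ)) * M ^ L) := by
      rw [← ENNReal.ofReal_mul (by positivity)]
      congr 1; ring
    rw [e1, e2]
    calc _ = (ENNReal.ofReal (ω x ^ (-(2 * γ))) *
          ENNReal.ofReal (‖x - y‖ ^ (-(2 * γ))) * ENNReal.ofReal (ω c ^ (-(2 * γ)) * M ^ L) *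
          chain γ W c L y) * (ENNReal.ofReal (ω y ^ (2 * (2 * l + 2))) *
          (ENNReal.ofReal (ω y ^ (-(2 * γ))) * ENNReal.ofReal (ω y ^ (-(2 * γ)))) * W' (T y)) := by
          ring
      _ = _ := by rw [hW']; ring

lemma finrank_space (l : ℕ) : Module.finrank ℝ (Space l) = 2 * l + 2 := by simp

lemma lintegral_comp_smul_space {l : ℕ} {s : ℝ} (hs : 0 < s) (f : Space l → ENNReal) :
    ∫⁻ y, f y = ∫⁻ y, ENNReal.ofReal (s ^ (2 * l + 2)) * f (s • y) := by
  have h := lintegral_image_eq_lintegral_abs_det_fderiv_mul (volume : Measure (Space l))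
    (f := fun y => s • y) (f' := fun _ => s • ContinuousLinearMap.id ℝ (Space l)) MeasurableSet.univ
    (fun x _ => ((hasFDerivAt_id (𝕜 := ℝ) x).const_smul s).hasFDerivWithinAt)
    ((smul_right_injective _ hs.ne').injOn) f
  have h1 : (fun y : Space l => s • y) '' univ = univ :=
    image_univ_of_surjective fun y => ⟨s⁻¹ • y, by simp [smul_smul, hs.ne']⟩
  have h2 : (s • ContinuousLinearMap.id ℝ (Space l)).det = s ^ (2 * l + 2) := by
    rw [ContinuousLinearMap.det, ContinuousLinearMap.toLinearMap_smul, LinearMap.det_smul,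
      finrank_space]
    simp
  rw [h1] at h
  simp only [Measure.restrict_univ, h2, abs_of_pos (pow_pos hs _)] at h
  exact h

lemma lintegral_comp_inversion {l : ℕ} (p : Space l) (f : Space l → ENNReal) :
    ∫⁻ y, f y = ∫⁻ y, ENNReal.ofReal ((1 / ‖y - p‖) ^ (2 * (2 * l + 2))) *
      f (EuclideanGeometry.inversion p 1 y) := by
  have h := lintegral_image_eq_lintegral_abs_det_fderiv_mul (volume : Measure (Space l))
    (s := {p}ᶜ) (measurableSet_singleton p).compl
    (fun x hx => (EuclideanGeometry.hasFDerivAt_inversion (R := 1) (c := p) hx).hasFDerivWithinAt)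
    (EuclideanGeometry.inversion_injective p one_ne_zero).injOn f
  have h1 : EuclideanGeometry.inversion p 1 '' {p}ᶜ = {p}ᶜ := by
    rw [image_compl_eq (EuclideanGeometry.inversion_bijective p one_ne_zero), image_singleton,
      EuclideanGeometry.inversion_self]
  have h2 : ∀ y : Space l,
      |((1 / dist y p) ^ 2 • (((Submodule.span ℝ {y - p})ᗮ.reflection : Space l ≃ₗᵢ[ℝ] Space l) :
        Space l →L[ℝ] Space l)).det| = (1 / ‖y - p‖) ^ (2 * (2 * l + 2)) := fun y => by
    rw [ContinuousLinearMap.det, ContinuousLinearMap.toLinearMap_smul, LinearMap.det_smul,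
      finrank_space, abs_mul, dist_eq_norm, ← pow_mul, abs_of_nonneg (by positivity)]
    have := Submodule.det_reflection (K := (Submodule.span ℝ {y - p})ᗮ)
    erw [this]
    simp
  have h3 : ∀ g : Space l → ENNReal, ∫⁻ y in {p}ᶜ, g y = ∫⁻ y, g y := fun g => by
    rw [restrict_compl_singleton]
  rw [h1, h3, h3] at h
  rw [h]
  refine lintegral_congr fun y => ?_
  rw [h2]

/-- Two pairs of vectors with the same norms and the same distance differ by an isometry: the
product of two reflections. -/
lemma exists_isometry_pair {l : ℕ} {a b a' b' : Space l} (ha : ‖a‖ = ‖a'‖) (hb : ‖b‖ = ‖b'‖)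
    (hab : ‖a - b‖ = ‖a' - b'‖) : ∃ U : Space l ≃ₗᵢ[ℝ] Space l, U a = a' ∧ U b = b' := by
  set U₁ := (Submodule.span ℝ {a - a'})ᗮ.reflection with hU₁
  have h1 : U₁ a = a' := Submodule.reflection_sub ha
  set U₂ := (Submodule.span ℝ {U₁ b - b'})ᗮ.reflection with hU₂
  have h2 : ‖U₁ b‖ = ‖b'‖ := by rw [U₁.norm_map, hb]
  have h3 : U₂ (U₁ b) = b' := Submodule.reflection_sub h2
  have h4 : U₂ a' = a' := by
    apply Submodule.reflection_mem_subspace_eq_self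
    rw [Submodule.mem_orthogonal_singleton_iff_inner_right, inner_sub_left]
    have e1 : ‖a' - U₁ b‖ = ‖a' - b'‖ := by
      rw [← h1, ← map_sub, U₁.norm_map, hab, h1]
    have e2 := norm_sub_sq_real a' (U₁ b)
    have e3 := norm_sub_sq_real a' b'
    rw [e1, h2] at e2
    rw [real_inner_comm a' (U₁ b), real_inner_comm a' b']
    linarith
  exact ⟨U₁.trans U₂, by simp [h1, h4], by simp [h3]⟩

/-! ### Reduction of the ladder to a function of one point -/

/-- The complex plane as a plane in Euclidean space. -/
noncomputable def emb (l : ℕ) (z : ℂ) : Space l :=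
  EuclideanSpace.single 0 z.re + EuclideanSpace.single 1 z.im

lemma norm_emb (l : ℕ) (z : ℂ) : ‖emb l z‖ = ‖z‖ := by
  have h : ‖emb l z‖ ^ 2 = ‖z‖ ^ 2 := by
    rw [← Complex.normSq_eq_norm_sq, Complex.normSq_apply, emb, norm_add_sq_real]
    simp only [PiLp.norm_single, EuclideanSpace.inner_single_left, norm_eq_abs, sq_abs]
    have : (EuclideanSpace.single (1 : Fin (2 * l + 2)) z.im : Space l) 0 = 0 := by
      simp
    rw [this]
    simp
    ring
  exact (sq_eq_sq₀ (norm_nonneg _) (norm_nonneg _)).1 h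

lemma emb_sub (l : ℕ) (z w : ℂ) : emb l z - emb l w = emb l (z - w) := by
  unfold emb
  ext i
  simp only [PiLp.sub_apply, PiLp.add_apply, PiLp.single_apply, Complex.sub_re,
    Complex.sub_im]
  split_ifs <;> ring

lemma continuous_emb (l : ℕ) : Continuous (emb l) := by
  refine Isometry.continuous (Isometry.of_dist_eq fun z w => ?_)
  rw [dist_eq_norm, emb_sub, norm_emb, dist_eq_norm]

/-- The weight `|y|^{-2β}` at the intermediate points. -/
noncomputable def radialWeight {l : ℕ} (β : ℝ) (y : Space l) : ENNReal :=
  ENNReal.ofReal (‖y‖ ^ (-(2 * β)))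

lemma measurable_radialWeight {l : ℕ} (β : ℝ) : Measurable (radialWeight (l := l) β) := by
  unfold radialWeight; fun_prop

/-- The ladder integral with `x₁ = x`, `x₂ = 0`, `x₃` the unit vector of the first axis, and `x₄` at
infinity. -/
noncomputable def ladderChain (l : ℕ) (β : ℝ) (L : ℕ) : Space l → ENNReal :=
  chain ((l : ℝ) + 1 - β) (radialWeight β) (emb l 1) L

lemma measurable_ladderChain (l : ℕ) (β : ℝ) (L : ℕ) : Measurable (ladderChain l β L) :=
  measurable_chain _ (measurable_radialWeight β) _ L

lemma lintegral_comp_similarity_inversion {l : ℕ} (p v₀ : Space l) {s : ℝ} (hs : 0 < s)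
    (U : Space l ≃ₗᵢ[ℝ] Space l) (f : Space l → ENNReal) :
    ∫⁻ y, f y = ∫⁻ y, ENNReal.ofReal ((√s / ‖y - p‖) ^ (2 * (2 * l + 2))) *
      f (U (s • (EuclideanGeometry.inversion p 1 y - v₀))) := by
  have h1 : ∫⁻ y, f y = ∫⁻ y, f (U y) :=
    (U.measurePreserving.lintegral_comp_emb U.toHomeomorph.measurableEmbedding f).symm
  rw [h1, lintegral_comp_smul_space hs,
    ← lintegral_sub_right_eq_self (fun y => ENNReal.ofReal (s ^ (2 * l + 2)) * f (U (s • y))) v₀,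
    lintegral_comp_inversion p]
  refine lintegral_congr fun y => ?_
  rw [← mul_assoc, ← ENNReal.ofReal_mul (by positivity), ← Real.sq_sqrt hs.le, ← pow_mul,
    ← mul_pow, Real.sq_sqrt hs.le]
  congr 3
  ring

/-- Conformal invariance: the normalized ladder integral depends on the cross-ratios only. The
inversion at `x₄`, a translation, a dilation and an isometry send the four points to `z`, `0`, `1`
and infinity. -/
theorem ladderF_eq {l : ℕ} {β : ℝ} (L : ℕ) {z : ℂ} {x₁ x₂ x₃ x₄ : Space l}
    (h : IsConfiguration l z x₁ x₂ x₃ x₄) :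
    ladderF l β L x₁ x₂ x₃ x₄ =
      (‖1 - z‖ ^ 2) ^ ((l : ℝ) + 1 - β) * (ladderChain l β L (emb l z)).toReal := by
  obtain ⟨n12, n13, n14, n23, n24, n34, hu, hv⟩ := h
  set γ : ℝ := (l : ℝ) + 1 - β with hγ
  have d12 : 0 < ‖x₁ - x₂‖ := norm_pos_iff.2 (sub_ne_zero.2 n12)
  have d13 : 0 < ‖x₁ - x₃‖ := norm_pos_iff.2 (sub_ne_zero.2 n13)
  have d14 : 0 < ‖x₁ - x₄‖ := norm_pos_iff.2 (sub_ne_zero.2 n14)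
  have d23 : 0 < ‖x₂ - x₃‖ := norm_pos_iff.2 (sub_ne_zero.2 n23)
  have d24 : 0 < ‖x₂ - x₄‖ := norm_pos_iff.2 (sub_ne_zero.2 n24)
  have d34 : 0 < ‖x₃ - x₄‖ := norm_pos_iff.2 (sub_ne_zero.2 n34)
  have hz1 : 0 < ‖1 - z‖ := by
    rcases (norm_nonneg (1 - z)).eq_or_lt with h0 | h0
    · rw [← h0] at hv
      have : 0 < (‖x₁ - x₄‖ ^ 2 * ‖x₂ - x₃‖ ^ 2) / (‖x₂ - x₄‖ ^ 2 * ‖x₁ - x₃‖ ^ 2) := by positivity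
      rw [hv] at this
      simp at this
    · exact h0
  have hab : ‖1 - z‖ = ‖x₁ - x₃‖ * ‖x₂ - x₄‖ / (‖x₁ - x₄‖ * ‖x₂ - x₃‖) := by
    rw [← sq_eq_sq₀ hz1.le (by positivity)]
    rw [div_eq_div_iff (by positivity) (by positivity)] at hv
    rw [div_pow, eq_div_iff (by positivity)]
    linear_combination hv
  have ha : ‖z‖ = ‖x₁ - x₂‖ * ‖x₃ - x₄‖ / (‖x₁ - x₄‖ * ‖x₂ - x₃‖) := by
    rw [← sq_eq_sq₀ (norm_nonneg z) (by positivity)]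
    rw [hab] at hu
    field_simp at hu ⊢
    linear_combination -hu
  set ι : Space l → Space l := EuclideanGeometry.inversion x₄ 1 with hι
  have hdist : ∀ x y, x ≠ x₄ → y ≠ x₄ →
      ‖ι x - ι y‖ = 1 / (‖x - x₄‖ * ‖y - x₄‖) * ‖x - y‖ := fun x y hx hy => by
    have := EuclideanGeometry.dist_inversion_inversion hx hy 1
    simpa only [dist_eq_norm, one_pow] using this
  -- the dilation factor that brings the images of `x₂` and `x₃` to distance `1`
  set s : ℝ := (‖ι x₃ - ι x₂‖)⁻¹ with hs
  have hs' : s = ‖x₃ - x₄‖ * ‖x₂ - x₄‖ / ‖x₂ - x₃‖ := by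
    rw [hs, hdist _ _ n34 n24, norm_sub_rev x₃ x₂]
    field_simp
  have hspos : 0 < s := by rw [hs']; positivity
  obtain ⟨U, hU1, hU3⟩ := exists_isometry_pair (a := s • (ι x₁ - ι x₂)) (b := s • (ι x₃ - ι x₂))
    (a' := emb l z) (b' := emb l 1)
    (by rw [norm_smul, norm_eq_abs, abs_of_pos hspos, hdist _ _ n14 n24, norm_emb, ha, hs']
        field_simp)
    (by rw [norm_smul, norm_eq_abs, abs_of_pos hspos, hdist _ _ n34 n24, norm_emb, hs', norm_one,
          norm_sub_rev x₃ x₂]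
        field_simp)
    (by rw [← smul_sub, sub_sub_sub_cancel_right, norm_smul, norm_eq_abs, abs_of_pos hspos,
          hdist _ _ n14 n34, emb_sub, norm_emb, norm_sub_rev z 1, hab, hs']
        field_simp)
  -- `T` sends `x₂` to `0`, `x₁` to `z` and `x₃` to `1`, with conformal factor `ω ^ 2`
  set T : Space l → Space l := fun y => U (s • (ι y - ι x₂)) with hT
  set ω : Space l → ℝ := fun y => √s / ‖y - x₄‖ with hω
  have hωpos : ∀ y ∈ ({x₄}ᶜ : Set (Space l)), 0 < ω y := fun y hy =>
    div_pos (sqrt_pos.2 hspos) (norm_pos_iff.2 (sub_ne_zero.2 hy))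
  have hd : ∀ x ∈ ({x₄}ᶜ : Set (Space l)), ∀ y ∈ ({x₄}ᶜ : Set (Space l)),
      ‖T x - T y‖ = ω x * ω y * ‖x - y‖ := fun x hx y hy => by
    simp only [hT, hω]
    rw [← map_sub, U.norm_map, ← smul_sub, sub_sub_sub_cancel_right, norm_smul, norm_eq_abs,
      abs_of_pos hspos, hdist _ _ hx hy, div_mul_div_comm, Real.mul_self_sqrt hspos.le]
    ring
  have hT2 : T x₂ = 0 := by simp [hT]
  have key := chain_conformal (γ := γ) (T := T) (ω := ω) (S := {x₄}ᶜ)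
    (by
      rw [ae_iff]
      simp)
    hωpos hd (lintegral_comp_similarity_inversion x₄ (ι x₂) hspos U)
    (W := fun y => ENNReal.ofReal (‖x₂ - y‖ ^ (-(2 * β)) * ‖x₄ - y‖ ^ (-(2 * β))))
    (W' := radialWeight β) (M := ‖x₂ - x₄‖ ^ (2 * β)) (by positivity)
    (by
      intro y hy
      have hy0 : 0 < ‖y - x₄‖ := norm_pos_iff.2 (sub_ne_zero.2 hy)
      have hωy := hωpos y hy
      have hω2 := hωpos x₂ n24
      have e : ‖T y‖ = ω y * ω x₂ * ‖y - x₂‖ := by rw [← hd y hy x₂ n24, hT2, sub_zero]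
      rw [radialWeight, ← ENNReal.ofReal_mul (by positivity), ← ENNReal.ofReal_mul (by positivity),
        e, mul_rpow (by positivity) (norm_nonneg _), mul_rpow hωy.le hω2.le, norm_sub_rev y x₂,
        norm_sub_rev x₄ y]
      congr 1
      -- the powers of `ω` from the Jacobian, the two adjacent lines and the weight combine
      have e1 : ω y ^ (2 * (2 * l + 2)) * (ω y ^ (-(2 * γ)) * ω y ^ (-(2 * γ))) * ω y ^ (-(2 * β)) =
          ω y ^ (2 * β) := by
        rw [← rpow_natCast, ← rpow_add hωy, ← rpow_add hωy, ← rpow_add hωy]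
        congr 1
        rw [hγ]
        push_cast
        ring
      have e2 : ω y ^ (2 * β) * ω x₂ ^ (-(2 * β)) =
          ‖x₂ - x₄‖ ^ (2 * β) * ‖y - x₄‖ ^ (-(2 * β)) := by
        simp only [hω]
        rw [div_rpow (sqrt_nonneg _) hy0.le, div_rpow (sqrt_nonneg _) d24.le,
          rpow_neg (sqrt_nonneg _), rpow_neg d24.le, rpow_neg hy0.le]
        have := rpow_pos_of_pos (sqrt_pos.2 hspos) (2 * β)
        have := rpow_pos_of_pos hy0 (2 * β)
        have := rpow_pos_of_pos d24 (2 * β)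
        field_simp
      calc _ = (ω y ^ (2 * (2 * l + 2)) * (ω y ^ (-(2 * γ)) * ω y ^ (-(2 * γ))) *
            ω y ^ (-(2 * β))) * ω x₂ ^ (-(2 * β)) * ‖x₂ - y‖ ^ (-(2 * β)) := by ring
        _ = _ := by rw [e1, e2]; ring)
    (c := x₃) n34 L (x := x₁) n14
  have e1 : T x₁ = emb l z := hU1
  have e3 : T x₃ = emb l 1 := hU3
  have e13 : ‖1 - z‖ = ω x₁ * ω x₃ * ‖x₁ - x₃‖ := by
    rw [← hd x₁ n14 x₃ n34, e1, e3, emb_sub, norm_emb, norm_sub_rev]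
  have p1 := hωpos x₁ n14
  have p3 := hωpos x₃ n34
  rw [e1, e3] at key
  rw [ladderChain, key, ENNReal.toReal_mul, ENNReal.toReal_ofReal (by positivity), ladderF,
    ladderIntegral_eq_toReal_chain, ← hγ, e13, ← rpow_natCast _ 2, ← rpow_mul (by positivity),
    mul_rpow (by positivity) d13.le, mul_rpow p1.le p3.le, rpow_neg p1.le, rpow_neg p3.le,
    ← rpow_natCast _ L, ← rpow_mul d24.le]
  have q1 := rpow_pos_of_pos p1 (2 * γ)
  have q3 := rpow_pos_of_pos p3 (2 * γ)
  push_cast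
  rw [show 2 * (L : ℝ) * β = 2 * β * L by ring]
  field_simp

lemma ladderChain_comp_isometry {l : ℕ} (β : ℝ) (L : ℕ) (U : Space l ≃ₗᵢ[ℝ] Space l)
    (hU : U (emb l 1) = emb l 1) (x : Space l) : ladderChain l β L (U x) = ladderChain l β L x := by
  have key := chain_conformal (γ := (l : ℝ) + 1 - β) (T := U) (ω := fun _ => 1) (S := univ)
    (W := radialWeight β) (W' := radialWeight β) (M := 1) (c := emb l 1) (x := x)
    (by simp) (by simp) (fun x _ y _ => by rw [← map_sub, U.norm_map]; simp)
    (fun f => by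
      simpa using (U.measurePreserving.lintegral_comp_emb U.toHomeomorph.measurableEmbedding f).symm)
    zero_le_one (fun y _ => by simp [radialWeight]) (mem_univ _) L (mem_univ _)
  rw [hU] at key
  simpa [ladderChain] using key

/-- The reduced ladder is a zonal function. -/
lemma ladderChain_congr {l : ℕ} (β : ℝ) (L : ℕ) {x y : Space l} (hn : ‖x‖ = ‖y‖)
    (hd : ‖x - emb l 1‖ = ‖y - emb l 1‖) : ladderChain l β L x = ladderChain l β L y := by
  obtain ⟨U, hU, hU1⟩ := exists_isometry_pair hn rfl hd
  rw [← hU, ladderChain_comp_isometry β L U hU1]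

/-! ### Bounds and continuity of the ladder -/

/-- Dominated convergence with a dominating function that depends on the parameter. -/
lemma tendsto_lintegral_of_le_tendsto {α ι : Type*} [MeasurableSpace α] {μ : Measure α}
    {u : Filter ι} [u.IsCountablyGenerated] {F G : ι → α → ENNReal} {f g : α → ENNReal}
    (hF : ∀ i, Measurable (F i)) (hG : ∀ i, Measurable (G i)) (hg : Measurable g)
    (hFG : ∀ᶠ i in u, ∀ᵐ a ∂μ, F i a ≤ G i a)
    (hFf : ∀ᵐ a ∂μ, Tendsto (fun i => F i a) u (𝓝 (f a)))
    (hGg : ∀ᵐ a ∂μ, Tendsto (fun i => G i a) u (𝓝 (g a)))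
    (hfg : ∀ᵐ a ∂μ, f a ≤ g a) (hga : ∀ᵐ a ∂μ, g a ≠ ⊤)
    (hfin : ∫⁻ a, g a ∂μ ≠ ⊤) (hlim : Tendsto (fun i => ∫⁻ a, G i a ∂μ) u (𝓝 (∫⁻ a, g a ∂μ))) :
    Tendsto (fun i => ∫⁻ a, F i a ∂μ) u (𝓝 (∫⁻ a, f a ∂μ)) := by
  have h1 : Tendsto (fun i => ∫⁻ a, min (F i a) (g a) ∂μ) u (𝓝 (∫⁻ a, f a ∂μ)) := by
    have h := tendsto_lintegral_filter_of_dominated_convergence (μ := μ) (l := u)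
      (F := fun i a => min (F i a) (g a)) (f := fun a => min (f a) (g a)) g
      (Eventually.of_forall fun i => (hF i).min hg)
      (Eventually.of_forall fun i => Eventually.of_forall fun a => min_le_right _ _) hfin
      (by filter_upwards [hFf] with a ha using ha.min tendsto_const_nhds)
    have e : ∫⁻ a, min (f a) (g a) ∂μ = ∫⁻ a, f a ∂μ := by
      apply lintegral_congr_ae
      filter_upwards [hfg] with a ha using min_eq_left ha
    rwa [e] at h
  have h2 : Tendsto (fun i => ∫⁻ a, (g a - G i a) ∂μ) u (𝓝 0) := by
    have h := tendsto_lintegral_filter_of_dominated_convergence (μ := μ) (l := u)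
      (F := fun i a => g a - G i a) (f := fun _ => 0) g
      (Eventually.of_forall fun i => hg.sub (hG i))
      (Eventually.of_forall fun i => Eventually.of_forall fun a => tsub_le_self) hfin
      (by
        filter_upwards [hGg, hga] with a ha hb
        have := ENNReal.Tendsto.sub (tendsto_const_nhds (x := g a) (f := u)) ha (Or.inl hb)
        simpa using this)
    simpa using h
  have h3 : Tendsto (fun i => ∫⁻ a, (G i a - g a) ∂μ) u (𝓝 0) := by
    have e : ∀ i, ∫⁻ a, (G i a - g a) ∂μ =
        (∫⁻ a, G i a ∂μ + ∫⁻ a, (g a - G i a) ∂μ) - ∫⁻ a, g a ∂μ := fun i => by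
      rw [← lintegral_add_left (hG i)]
      have : ∫⁻ a, (G i a + (g a - G i a)) ∂μ = ∫⁻ a, g a ∂μ + ∫⁻ a, (G i a - g a) ∂μ := by
        rw [← lintegral_add_left hg]
        refine lintegral_congr fun a => ?_
        rw [add_tsub_eq_max, add_tsub_eq_max, max_comm]
      rw [this, ENNReal.add_sub_cancel_left hfin]
    simp only [e]
    have := ENNReal.Tendsto.sub (hlim.add h2) (tendsto_const_nhds (x := ∫⁻ a, g a ∂μ) (f := u))
      (Or.inr hfin)
    simpa using this
  refine tendsto_of_tendsto_of_tendsto_of_le_of_le' h1 (by simpa using h1.add h3) ?_ ?_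
  · exact Eventually.of_forall fun i => lintegral_mono fun a => min_le_left _ _
  · filter_upwards [hFG] with i hi
    rw [← lintegral_add_left ((hF i).min hg)]
    apply lintegral_mono_ae
    filter_upwards [hi] with a ha
    rcases le_total (F i a) (g a) with h | h
    · rw [min_eq_left h]; exact le_self_add
    · rw [min_eq_right h, add_tsub_eq_max]; exact ha.trans (le_max_right _ _)

lemma lintegral_ball_norm_rpow_lt_top {E : Type*} [NormedAddCommGroup E] [NormedSpace ℝ E]
    [FiniteDimensional ℝ E] [Nontrivial E] [MeasurableSpace E] [BorelSpace E] (μ : Measure E)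
    [μ.IsAddHaarMeasure] {a : ℝ} (ha : a < Module.finrank ℝ E) (r : ℝ) :
    ∫⁻ y in Metric.ball (0 : E) r, ENNReal.ofReal (‖y‖ ^ (-a)) ∂μ < ⊤ := by
  have h : IntegrableOn (fun y : E => ‖y‖ ^ (-a)) (Metric.ball 0 r) μ := by
    rw [integrableOn_fun_norm_addHaar μ (f := fun t : ℝ => t ^ (-a))]
    rcases le_or_gt r 0 with hr | hr
    · rw [Ioo_eq_empty (by simpa using hr)]; exact integrableOn_empty
    have h1 : IntegrableOn (fun t : ℝ => t ^ ((Module.finrank ℝ E : ℝ) - 1 - a)) (Ioo 0 r) := by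
      rw [intervalIntegral.integrableOn_Ioo_rpow_iff hr]
      linarith
    refine h1.congr_fun (fun t ht => ?_) measurableSet_Ioo
    have hn : 1 ≤ Module.finrank ℝ E := Module.finrank_pos
    rw [smul_eq_mul, ← rpow_natCast, ← rpow_add ht.1, Nat.cast_sub hn]
    push_cast; ring_nf
  have h2 := h.2
  rw [HasFiniteIntegral] at h2
  refine lt_of_eq_of_lt (lintegral_congr fun y => ?_) h2
  rw [← ofReal_norm, norm_of_nonneg (by positivity)]

section
variable {l : ℕ} {β : ℝ}

/-- The integral of the propagator against a power of the norm for which it converges. -/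
noncomputable def powerIntegral (l : ℕ) (β : ℝ) (x : Space l) : ENNReal :=
  ∫⁻ y, ENNReal.ofReal (‖x - y‖ ^ (-(2 * ((l : ℝ) + 1 - β))) *
    ‖y‖ ^ (-(2 * β) - ((l : ℝ) + 1 - β)))

/-- The singularities at `0` and at the unit vector are integrable, and the total exponent
`2 γ + 2 β + γ` exceeds the dimension `2 β + 2 γ`. -/
lemma powerIntegral_axis_lt_top (hβ : 0 < β) (hβ' : β < (l : ℝ) + 1) :
    powerIntegral l β (emb l 1) < ⊤ := by
  set γ : ℝ := (l : ℝ) + 1 - β with hγ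
  have hγ0 : 0 < γ := by linarith
  set n := emb l 1 with hn
  have hn1 : ‖n‖ = 1 := by rw [hn, norm_emb]; simp
  have hD : (Module.finrank ℝ (Space l) : ℝ) = 2 * β + 2 * γ := by
    rw [finrank_space, hγ]; push_cast; ring
  set a : ℝ := 2 * β + γ with ha
  have hapos : 0 < a := by linarith
  have hb : ∀ y : Space l, ENNReal.ofReal (‖n - y‖ ^ (-(2 * γ)) * ‖y‖ ^ (-(2 * β) - γ)) ≤
      (Metric.ball (0 : Space l) (1 / 2)).indicator
        (fun y => ENNReal.ofReal (2 ^ (2 * γ)) * ENNReal.ofReal (‖y‖ ^ (-a))) y +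
      ((Metric.ball (0 : Space l) (1 / 2)).indicator
        (fun y => ENNReal.ofReal (2 ^ a) * ENNReal.ofReal (‖y‖ ^ (-(2 * γ)))) (y - n) +
      ENNReal.ofReal (5 ^ (2 * γ) * 3 ^ a) * ENNReal.ofReal ((1 + ‖y‖) ^ (-(2 * γ + a)))) := by
    intro y
    have hea : -(2 * β) - γ = -a := by rw [ha]; ring
    rw [hea]
    -- close to `0`, close to `n`, and away from both
    by_cases h1 : ‖y‖ < 1 / 2
    · refine le_trans ?_ le_self_add
      rw [indicator_of_mem (by simpa using h1), ← ENNReal.ofReal_mul (by positivity)]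
      apply ENNReal.ofReal_le_ofReal
      gcongr
      have h2 : 1 / 2 ≤ ‖n - y‖ := by
        have := norm_sub_norm_le n y; linarith
      have h3 : (2 : ℝ) ^ (2 * γ) = (1 / 2) ^ (-(2 * γ)) := by
        rw [rpow_neg (by norm_num), one_div, inv_rpow (by norm_num), inv_inv]
      rw [h3]
      exact rpow_le_rpow_of_nonpos (by norm_num) h2 (by linarith)
    push Not at h1
    by_cases h2 : ‖y - n‖ < 1 / 2
    · refine le_trans ?_ (le_trans le_self_add le_add_self)
      rw [indicator_of_mem (by simpa using h2), ← ENNReal.ofReal_mul (by positivity)]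
      apply ENNReal.ofReal_le_ofReal
      rw [norm_sub_rev, mul_comm]
      gcongr
      have h3 : (2 : ℝ) ^ a = (1 / 2) ^ (-a) := by
        rw [rpow_neg (by norm_num), one_div, inv_rpow (by norm_num), inv_inv]
      rw [h3]
      exact rpow_le_rpow_of_nonpos (by norm_num) h1 (by linarith)
    push Not at h2
    refine le_trans ?_ (le_trans le_add_self le_add_self)
    rw [← ENNReal.ofReal_mul (by positivity)]
    apply ENNReal.ofReal_le_ofReal
    have hy0 : 0 < ‖y‖ := by linarith
    have h3 : 1 + ‖y‖ ≤ 5 * ‖n - y‖ := by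
      have := norm_sub_norm_le y n
      rw [norm_sub_rev]; linarith
    have h4 : 1 + ‖y‖ ≤ 3 * ‖y‖ := by linarith
    have h5 : ‖n - y‖ ^ (-(2 * γ)) ≤ 5 ^ (2 * γ) * (1 + ‖y‖) ^ (-(2 * γ)) := by
      have : (5 : ℝ) ^ (2 * γ) * (1 + ‖y‖) ^ (-(2 * γ)) = ((1 + ‖y‖) / 5) ^ (-(2 * γ)) := by
        rw [div_rpow (by positivity) (by norm_num), rpow_neg (by norm_num : (0 : ℝ) ≤ 5),
          div_inv_eq_mul, mul_comm]
      rw [this]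
      exact rpow_le_rpow_of_nonpos (by positivity) (by linarith) (by linarith)
    have h6 : ‖y‖ ^ (-a) ≤ 3 ^ a * (1 + ‖y‖) ^ (-a) := by
      have : (3 : ℝ) ^ a * (1 + ‖y‖) ^ (-a) = ((1 + ‖y‖) / 3) ^ (-a) := by
        rw [div_rpow (by positivity) (by norm_num), rpow_neg (by norm_num : (0 : ℝ) ≤ 3),
          div_inv_eq_mul, mul_comm]
      rw [this]
      exact rpow_le_rpow_of_nonpos (by positivity) (by linarith) (by linarith)
    calc _ ≤ (5 ^ (2 * γ) * (1 + ‖y‖) ^ (-(2 * γ))) * (3 ^ a * (1 + ‖y‖) ^ (-a)) := by gcongr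
      _ = 5 ^ (2 * γ) * 3 ^ a * ((1 + ‖y‖) ^ (-(2 * γ)) * (1 + ‖y‖) ^ (-a)) := by ring
      _ = _ := by rw [← rpow_add (by positivity)]; congr 2; ring
  unfold powerIntegral
  refine lt_of_le_of_lt (lintegral_mono hb) ?_
  have m1 : Measurable ((Metric.ball (0 : Space l) (1 / 2)).indicator
        (fun y => ENNReal.ofReal (2 ^ (2 * γ)) * ENNReal.ofReal (‖y‖ ^ (-a)))) :=
    (by fun_prop : Measurable fun y : Space l =>
      ENNReal.ofReal (2 ^ (2 * γ)) * ENNReal.ofReal (‖y‖ ^ (-a))).indicator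
        Metric.isOpen_ball.measurableSet
  have m2 : Measurable ((Metric.ball (0 : Space l) (1 / 2)).indicator
        (fun y => ENNReal.ofReal (2 ^ a) * ENNReal.ofReal (‖y‖ ^ (-(2 * γ))))) :=
    (by fun_prop : Measurable fun y : Space l =>
      ENNReal.ofReal (2 ^ a) * ENNReal.ofReal (‖y‖ ^ (-(2 * γ)))).indicator
        Metric.isOpen_ball.measurableSet
  have m3 : Measurable fun y => (Metric.ball (0 : Space l) (1 / 2)).indicator
        (fun y => ENNReal.ofReal (2 ^ a) * ENNReal.ofReal (‖y‖ ^ (-(2 * γ)))) (y - n) :=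
    m2.comp (measurable_sub_const n)
  rw [lintegral_add_left m1, lintegral_add_left m3,
    lintegral_sub_right_eq_self ((Metric.ball (0 : Space l) (1 / 2)).indicator
        (fun y => ENNReal.ofReal (2 ^ a) * ENNReal.ofReal (‖y‖ ^ (-(2 * γ))))) n,
    lintegral_indicator Metric.isOpen_ball.measurableSet,
    lintegral_indicator Metric.isOpen_ball.measurableSet,
    lintegral_const_mul' _ _ ENNReal.ofReal_ne_top, lintegral_const_mul' _ _ ENNReal.ofReal_ne_top,
    lintegral_const_mul' _ _ ENNReal.ofReal_ne_top]
  refine ENNReal.add_lt_top.2 ⟨ENNReal.mul_lt_top ENNReal.ofReal_lt_top ?_,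
    ENNReal.add_lt_top.2 ⟨ENNReal.mul_lt_top ENNReal.ofReal_lt_top ?_,
      ENNReal.mul_lt_top ENNReal.ofReal_lt_top ?_⟩⟩
  · exact lintegral_ball_norm_rpow_lt_top _ (by rw [hD, ha]; linarith) _
  · exact lintegral_ball_norm_rpow_lt_top _ (by rw [hD]; linarith) _
  · exact finite_integral_one_add_norm (by rw [hD, ha]; linarith)

/-- By scaling and rotation, the integral is a power of the norm. -/
lemma powerIntegral_eq {x : Space l} (hx : x ≠ 0) :
    powerIntegral l β x =
      ENNReal.ofReal (‖x‖ ^ (-((l : ℝ) + 1 - β))) * powerIntegral l β (emb l 1) := by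
  set γ : ℝ := (l : ℝ) + 1 - β with hγ
  have hr : 0 < ‖x‖ := norm_pos_iff.2 hx
  obtain ⟨U, hU, -⟩ := exists_isometry_pair (a := emb l 1) (b := emb l 1) (a' := ‖x‖⁻¹ • x)
    (b' := ‖x‖⁻¹ • x) (by rw [norm_emb, norm_smul]; simp [hr.ne'])
    (by rw [norm_emb, norm_smul]; simp [hr.ne']) (by simp)
  have hx' : ‖x‖ • U (emb l 1) = x := by rw [hU, smul_smul, mul_inv_cancel₀ hr.ne', one_smul]
  unfold powerIntegral
  rw [← hγ, lintegral_comp_smul_space hr,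
    ← (U.measurePreserving.lintegral_comp_emb U.toHomeomorph.measurableEmbedding _),
    ← lintegral_const_mul' _ _ ENNReal.ofReal_ne_top]
  refine lintegral_congr fun y => ?_
  rw [← ENNReal.ofReal_mul (by positivity), ← ENNReal.ofReal_mul (by positivity)]
  congr 1
  have h1 : ‖x - ‖x‖ • U y‖ = ‖x‖ * ‖emb l 1 - y‖ := by
    have h0 : x - ‖x‖ • U y = ‖x‖ • U (emb l 1 - y) := by rw [map_sub, smul_sub, hx']
    rw [h0, norm_smul, U.norm_map, norm_norm]
  rw [h1, norm_smul, U.norm_map, norm_norm, mul_rpow hr.le (norm_nonneg _),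
    mul_rpow hr.le (norm_nonneg _)]
  have h2 : ‖x‖ ^ (2 * l + 2) * (‖x‖ ^ (-(2 * γ)) * ‖x‖ ^ (-(2 * β) - γ)) = ‖x‖ ^ (-γ) := by
    rw [← rpow_natCast, ← rpow_add hr, ← rpow_add hr]
    congr 1
    rw [hγ]; push_cast; ring
  rw [← h2]
  ring

/-- The constant, singular at the unit vector of the first axis, with which a product of two
propagators is bounded by their sum, see `rpow_mul_rpow_le_singFactor`. -/
noncomputable def singFactor (l : ℕ) (β : ℝ) (x : Space l) : ℝ :=
  (4 / ‖x - emb l 1‖ ^ 2 + 2 / ‖x - emb l 1‖) ^ ((l : ℝ) + 1 - β)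

lemma singFactor_nonneg (x : Space l) : 0 ≤ singFactor l β x := by
  unfold singFactor; positivity

/-- The larger of `|x - y|` and `|y - n|` is at least half of `|x - n|`, and it is comparable to `|y|`
for large `y`. -/
lemma rpow_mul_rpow_le_singFactor (hβ' : β < (l : ℝ) + 1) {x y : Space l} (hx : x ≠ emb l 1) (hy : y ≠ 0) :
    ‖x - y‖ ^ (-(2 * ((l : ℝ) + 1 - β))) * ‖y - emb l 1‖ ^ (-(2 * ((l : ℝ) + 1 - β))) ≤
      singFactor l β x * ((‖x - y‖ ^ (-(2 * ((l : ℝ) + 1 - β))) +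
        ‖emb l 1 - y‖ ^ (-(2 * ((l : ℝ) + 1 - β)))) * ‖y‖ ^ (-((l : ℝ) + 1 - β))) := by
  unfold singFactor
  set γ : ℝ := (l : ℝ) + 1 - β with hγ
  have hγ0 : 0 < γ := by linarith
  set n := emb l 1 with hn
  have hn1 : ‖n‖ = 1 := by rw [hn, norm_emb]; simp
  have ht : 0 < ‖x - n‖ := norm_pos_iff.2 (sub_ne_zero.2 hx)
  have hy0 : 0 < ‖y‖ := norm_pos_iff.2 hy
  set t := ‖x - n‖ with htdef
  have key : ∀ m : ℝ, t / 2 ≤ m → ‖y‖ ≤ 1 + m →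
      m ^ (-(2 * γ)) ≤ (4 / t ^ 2 + 2 / t) ^ γ * ‖y‖ ^ (-γ) := by
    intro m hm1 hm2
    have hm0 : 0 < m := by linarith
    have h1 : ‖y‖ ≤ (4 / t ^ 2 + 2 / t) * m ^ 2 := by
      have e1 : 1 ≤ 2 / t * m := by
        rw [div_mul_eq_mul_div, le_div_iff₀ ht]; linarith
      have e2 : 1 ≤ (2 / t * m) ^ 2 := one_le_pow₀ e1
      have e3 : (2 / t * m) ^ 2 = 4 / t ^ 2 * m ^ 2 := by rw [mul_pow, div_pow]; norm_num
      nlinarith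
    have h2 : ‖y‖ ^ γ ≤ (4 / t ^ 2 + 2 / t) ^ γ * m ^ (2 * γ) := by
      calc ‖y‖ ^ γ ≤ ((4 / t ^ 2 + 2 / t) * m ^ 2) ^ γ := by gcongr
        _ = _ := by
          rw [mul_rpow (by positivity) (by positivity), ← rpow_natCast m 2, ← rpow_mul hm0.le]
          norm_num
    rw [rpow_neg hm0.le, rpow_neg hy0.le, ← div_eq_mul_inv, le_div_iff₀ (by positivity),
      inv_mul_le_iff₀ (by positivity)]
    exact h2.trans_eq (mul_comm _ _)
  have htri : t ≤ ‖x - y‖ + ‖y - n‖ := by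
    have := norm_add_le (x - y) (y - n); rwa [sub_add_sub_cancel] at this
  have hyn : ‖y‖ ≤ 1 + ‖y - n‖ := by
    have := norm_add_le n (y - n); rw [add_sub_cancel, hn1] at this; exact this
  rw [norm_sub_rev n y]
  have pa : 0 ≤ ‖x - y‖ ^ (-(2 * γ)) := by positivity
  have pb : 0 ≤ ‖y - n‖ ^ (-(2 * γ)) := by positivity
  have pc : 0 ≤ (4 / t ^ 2 + 2 / t) ^ γ * ‖y‖ ^ (-γ) := by positivity
  rcases le_total ‖x - y‖ ‖y - n‖ with h | h
  · have := key ‖y - n‖ (by linarith) hyn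
    nlinarith [mul_le_mul_of_nonneg_left this pa, mul_nonneg pc pb]
  · have := key ‖x - y‖ (by linarith) (by linarith)
    nlinarith [mul_le_mul_of_nonneg_right this pb, mul_nonneg pc pa]

/-- The bound for the ladders, up to a constant. -/
noncomputable def ladderBound (l : ℕ) (β : ℝ) (x : Space l) : ℝ :=
  ‖x‖ ^ (-((l : ℝ) + 1 - β)) + ‖x - emb l 1‖ ^ (-(2 * ((l : ℝ) + 1 - β)))

lemma ladderBound_nonneg (x : Space l) : 0 ≤ ladderBound l β x := by
  unfold ladderBound; positivity

/-- An integrable function of `y`, with an integral continuous in `x`, that dominates the integrand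
of the next ladder. -/
noncomputable def ladderDom (l : ℕ) (β : ℝ) (x y : Space l) : ℝ :=
  (1 + singFactor l β x) * (‖x - y‖ ^ (-(2 * ((l : ℝ) + 1 - β))) *
      ‖y‖ ^ (-(2 * β) - ((l : ℝ) + 1 - β))) +
    singFactor l β x * (‖emb l 1 - y‖ ^ (-(2 * ((l : ℝ) + 1 - β))) *
      ‖y‖ ^ (-(2 * β) - ((l : ℝ) + 1 - β)))

lemma le_ladderDom (hβ' : β < (l : ℝ) + 1) {x y : Space l} (hx : x ≠ emb l 1) (hy : y ≠ 0) :
    ‖x - y‖ ^ (-(2 * ((l : ℝ) + 1 - β))) * (‖y‖ ^ (-(2 * β)) * ladderBound l β y) ≤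
      ladderDom l β x y := by
  have h := rpow_mul_rpow_le_singFactor hβ' hx hy
  unfold ladderBound ladderDom
  have hy0 : 0 < ‖y‖ := norm_pos_iff.2 hy
  have e : ‖y‖ ^ (-(2 * β) - ((l : ℝ) + 1 - β)) = ‖y‖ ^ (-(2 * β)) * ‖y‖ ^ (-((l : ℝ) + 1 - β)) := by
    rw [← rpow_add hy0]; congr 1
  rw [e]
  have hp : 0 ≤ ‖y‖ ^ (-(2 * β)) := by positivity
  nlinarith [mul_le_mul_of_nonneg_left h hp]

lemma measurable_ladderDom (x : Space l) : Measurable fun y => ENNReal.ofReal (ladderDom l β x y) := by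
  unfold ladderDom; fun_prop

lemma lintegral_ladderDom (hβ : 0 < β) (hβ' : β < (l : ℝ) + 1) {x : Space l} (hx : x ≠ 0) :
    ∫⁻ y, ENNReal.ofReal (ladderDom l β x y) = ENNReal.ofReal
      ((powerIntegral l β (emb l 1)).toReal * ((1 + singFactor l β x) *
        ‖x‖ ^ (-((l : ℝ) + 1 - β)) + singFactor l β x)) := by
  have hC := singFactor_nonneg (β := β) x
  have hfin := (powerIntegral_axis_lt_top hβ hβ').ne
  unfold ladderDom
  have m1 : Measurable fun y : Space l => ENNReal.ofReal (1 + singFactor l β x) *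
      ENNReal.ofReal (‖x - y‖ ^ (-(2 * ((l : ℝ) + 1 - β))) *
      ‖y‖ ^ (-(2 * β) - ((l : ℝ) + 1 - β))) := by fun_prop
  have e : ∀ y : Space l, ENNReal.ofReal ((1 + singFactor l β x) *
      (‖x - y‖ ^ (-(2 * ((l : ℝ) + 1 - β))) * ‖y‖ ^ (-(2 * β) - ((l : ℝ) + 1 - β))) +
      singFactor l β x * (‖emb l 1 - y‖ ^ (-(2 * ((l : ℝ) + 1 - β))) *
      ‖y‖ ^ (-(2 * β) - ((l : ℝ) + 1 - β)))) =
      ENNReal.ofReal (1 + singFactor l β x) *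
      ENNReal.ofReal (‖x - y‖ ^ (-(2 * ((l : ℝ) + 1 - β))) *
      ‖y‖ ^ (-(2 * β) - ((l : ℝ) + 1 - β))) + ENNReal.ofReal (singFactor l β x) *
      ENNReal.ofReal (‖emb l 1 - y‖ ^ (-(2 * ((l : ℝ) + 1 - β))) *
      ‖y‖ ^ (-(2 * β) - ((l : ℝ) + 1 - β))) := fun y => by
    rw [ENNReal.ofReal_add (by positivity) (by positivity), ENNReal.ofReal_mul (by positivity),
      ENNReal.ofReal_mul hC]
  simp only [e]
  rw [lintegral_add_left m1, lintegral_const_mul' _ _ ENNReal.ofReal_ne_top,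
    lintegral_const_mul' _ _ ENNReal.ofReal_ne_top]
  have e1 := powerIntegral_eq (β := β) hx
  have e2 : powerIntegral l β (emb l 1) =
      ENNReal.ofReal (powerIntegral l β (emb l 1)).toReal := (ENNReal.ofReal_toReal hfin).symm
  unfold powerIntegral at e1 e2
  unfold powerIntegral
  rw [e1, e2, ENNReal.toReal_ofReal ENNReal.toReal_nonneg, ← ENNReal.ofReal_mul (by positivity),
    ← ENNReal.ofReal_mul (by positivity), ← ENNReal.ofReal_mul (by positivity),
    ← ENNReal.ofReal_add (by positivity) (by positivity)]
  congr 1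
  ring

lemma dom_le_ladderBound (hβ' : β < (l : ℝ) + 1) : ∃ C : ℝ, 0 ≤ C ∧ ∀ x : Space l, x ≠ 0 →
    x ≠ emb l 1 → (1 + singFactor l β x) * ‖x‖ ^ (-((l : ℝ) + 1 - β)) + singFactor l β x ≤
      C * ladderBound l β x := by
  unfold singFactor ladderBound
  set γ : ℝ := (l : ℝ) + 1 - β with hγ
  have hγ0 : 0 < γ := by linarith
  set n := emb l 1 with hn
  have hn1 : ‖n‖ = 1 := by rw [hn, norm_emb]; simp
  refine ⟨1 + 5 ^ γ * (2 ^ γ + 1) + (20 ^ γ + 30 ^ γ), by positivity, fun x hx hxn => ?_⟩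
  have ht : 0 < ‖x - n‖ := norm_pos_iff.2 (sub_ne_zero.2 hxn)
  have hr : 0 < ‖x‖ := norm_pos_iff.2 hx
  set t := ‖x - n‖
  set r := ‖x‖
  have hrt : r ≤ 1 + t := by
    have := norm_add_le n (x - n); rw [add_sub_cancel, hn1] at this; exact this
  have hrt' : 1 ≤ r + t := by
    have := norm_sub_le x (x - n); rw [sub_sub_cancel, hn1] at this; exact this
  have p1 : 0 < r ^ (-γ) := by positivity
  have p2 : 0 < t ^ (-(2 * γ)) := by positivity
  have a2 : (0 : ℝ) ≤ 20 ^ γ + 30 ^ γ := by positivity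
  have a1 : (0 : ℝ) ≤ 5 ^ γ * (2 ^ γ + 1) := by positivity
  suffices h : (4 / t ^ 2 + 2 / t) ^ γ * (r ^ (-γ) + 1) ≤
      5 ^ γ * (2 ^ γ + 1) * t ^ (-(2 * γ)) + (20 ^ γ + 30 ^ γ) * r ^ (-γ) by
    nlinarith [mul_nonneg a2 p2.le, mul_nonneg a1 p1.le]
  rcases le_total t (1 / 2) with h | h
  · have h1 : (4 / t ^ 2 + 2 / t) ^ γ ≤ 5 ^ γ * t ^ (-(2 * γ)) := by
      have : 4 / t ^ 2 + 2 / t ≤ 5 / t ^ 2 := by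
        rw [div_add_div _ _ (by positivity) ht.ne', div_le_div_iff₀ (by positivity) (by positivity)]
        nlinarith [mul_pos ht ht, pow_pos ht 3, pow_pos ht 4]
      calc (4 / t ^ 2 + 2 / t) ^ γ ≤ (5 / t ^ 2) ^ γ := by gcongr
        _ = _ := by
          rw [div_rpow (by norm_num) (by positivity), ← rpow_natCast t 2, ← rpow_mul ht.le,
            rpow_neg ht.le, div_eq_mul_inv]
          norm_num
    have h2 : r ^ (-γ) ≤ 2 ^ γ := by
      have h3 : (2 : ℝ) ^ γ = (1 / 2) ^ (-γ) := by
        rw [rpow_neg (by norm_num), one_div, inv_rpow (by norm_num), inv_inv]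
      rw [h3]
      exact rpow_le_rpow_of_nonpos (by norm_num) (by linarith) (by linarith)
    calc _ ≤ 5 ^ γ * t ^ (-(2 * γ)) * (2 ^ γ + 1) := by gcongr
      _ = 5 ^ γ * (2 ^ γ + 1) * t ^ (-(2 * γ)) := by ring
      _ ≤ _ := by nlinarith [mul_nonneg a2 p1.le]
  · have h0 : 4 / t ^ 2 + 2 / t ≤ 10 / t := by
      rw [div_add_div _ _ (by positivity) ht.ne', div_le_div_iff₀ (by positivity) ht]
      nlinarith [mul_pos ht ht, pow_pos ht 3, mul_nonneg (mul_pos ht ht).le (sub_nonneg.2 h)]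
    have h1 : (4 / t ^ 2 + 2 / t) ^ γ ≤ 20 ^ γ := by
      have : 10 / t ≤ 20 := by rw [div_le_iff₀ ht]; linarith
      gcongr; linarith
    have h2 : (4 / t ^ 2 + 2 / t) ^ γ ≤ 30 ^ γ * r ^ (-γ) := by
      have : 10 / t ≤ 30 / r := by
        rw [div_le_div_iff₀ ht hr]; linarith
      calc (4 / t ^ 2 + 2 / t) ^ γ ≤ (30 / r) ^ γ := by gcongr; linarith
        _ = _ := by rw [div_rpow (by norm_num) hr.le, rpow_neg hr.le, div_eq_mul_inv]
    nlinarith [mul_le_mul_of_nonneg_right h1 p1.le, mul_nonneg a1 p2.le]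

lemma ae_ne_zero_space (l : ℕ) : ∀ᵐ y : Space l, y ≠ 0 := by
  rw [ae_iff]; simp

lemma ae_ne_space {l : ℕ} (x : Space l) : ∀ᵐ y : Space l, y ≠ x := by
  rw [ae_iff]; simp

lemma ladderIntegrand_le_dom (hβ' : β < (l : ℝ) + 1) {L : ℕ} {C : ℝ} (hC : 0 ≤ C)
    (h : ∀ x : Space l, x ≠ 0 → x ≠ emb l 1 →
      ladderChain l β L x ≤ ENNReal.ofReal (C * ladderBound l β x)) {x : Space l}
    (hx : x ≠ emb l 1) :
    ∀ᵐ y, ENNReal.ofReal (‖x - y‖ ^ (-(2 * ((l : ℝ) + 1 - β)))) *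
      (radialWeight β y * ladderChain l β L y) ≤
        ENNReal.ofReal C * ENNReal.ofReal (ladderDom l β x y) := by
  filter_upwards [ae_ne_zero_space l, ae_ne_space (emb l 1)] with y h0 h1
  have hb := ladderBound_nonneg (β := β) y
  calc _ ≤ ENNReal.ofReal (‖x - y‖ ^ (-(2 * ((l : ℝ) + 1 - β)))) *
      (radialWeight β y * ENNReal.ofReal (C * ladderBound l β y)) := by
        gcongr; exact h y h0 h1
    _ = ENNReal.ofReal (C * (‖x - y‖ ^ (-(2 * ((l : ℝ) + 1 - β))) *
        (‖y‖ ^ (-(2 * β)) * ladderBound l β y))) := by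
      rw [radialWeight, ← ENNReal.ofReal_mul (by positivity), ← ENNReal.ofReal_mul (by positivity)]
      congr 1; ring
    _ ≤ _ := by
      rw [← ENNReal.ofReal_mul hC]
      apply ENNReal.ofReal_le_ofReal
      gcongr
      exact le_ladderDom hβ' hx h0

/-- The ladders are bounded by powers of the distances to the two singular points. The exponents do
not depend on the number of loops, because integration against the propagator preserves the class of
functions bounded by a multiple of `ladderBound`. -/
lemma exists_ladderChain_le (hβ : 0 < β) (hβ' : β < (l : ℝ) + 1) (L : ℕ) :
    ∃ C : ℝ, 0 ≤ C ∧ ∀ x : Space l, x ≠ 0 → x ≠ emb l 1 →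
      ladderChain l β L x ≤ ENNReal.ofReal (C * ladderBound l β x) := by
  induction L with
  | zero =>
    refine ⟨1, zero_le_one, fun x hx hxn => ENNReal.ofReal_le_ofReal ?_⟩
    rw [one_mul, ladderBound]
    exact le_add_of_nonneg_left (by positivity)
  | succ L ih =>
    obtain ⟨C, hC, h⟩ := ih
    obtain ⟨C', hC', h'⟩ := dom_le_ladderBound (l := l) hβ'
    refine ⟨C * ((powerIntegral l β (emb l 1)).toReal * C'), by positivity, fun x hx hxn => ?_⟩
    refine (lintegral_mono_ae (ladderIntegrand_le_dom hβ' hC h hxn)).trans ?_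
    rw [lintegral_const_mul' _ _ ENNReal.ofReal_ne_top, lintegral_ladderDom hβ hβ' hx,
      ← ENNReal.ofReal_mul hC]
    apply ENNReal.ofReal_le_ofReal
    rw [mul_assoc, mul_assoc]
    gcongr
    exact h' x hx hxn

lemma ladderChain_lt_top (hβ : 0 < β) (hβ' : β < (l : ℝ) + 1) (L : ℕ) {x : Space l} (hx : x ≠ 0)
    (hxn : x ≠ emb l 1) : ladderChain l β L x < ⊤ := by
  obtain ⟨C, -, h⟩ := exists_ladderChain_le hβ hβ' L
  exact (h x hx hxn).trans_lt ENNReal.ofReal_lt_top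

lemma continuousAt_singFactor (hβ' : β < (l : ℝ) + 1) {x : Space l} (hx : x ≠ emb l 1) :
    ContinuousAt (singFactor l β) x := by
  have ht : ‖x - emb l 1‖ ≠ 0 := norm_ne_zero_iff.2 (sub_ne_zero.2 hx)
  unfold singFactor
  refine ContinuousAt.rpow_const ?_ (Or.inr (by linarith))
  have h1 : ContinuousAt (fun x : Space l => ‖x - emb l 1‖) x := by fun_prop
  exact (continuousAt_const.div (h1.pow 2) (pow_ne_zero 2 ht)).add (continuousAt_const.div h1 ht)

lemma continuousAt_norm_sub_rpow (a : ℝ) {x y : Space l} (h : x ≠ y) :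
    ContinuousAt (fun x : Space l => ‖x - y‖ ^ a) x :=
  ContinuousAt.rpow_const (by fun_prop) (Or.inl (norm_ne_zero_iff.2 (sub_ne_zero.2 h)))

lemma continuousAt_ladderChain (hβ : 0 < β) (hβ' : β < (l : ℝ) + 1) (L : ℕ) {x : Space l}
    (hx : x ≠ 0) (hxn : x ≠ emb l 1) : ContinuousAt (ladderChain l β L) x := by
  cases L with
  | zero =>
    exact ENNReal.continuous_ofReal.continuousAt.comp (continuousAt_norm_sub_rpow _ hxn)
  | succ L =>
    obtain ⟨C, hC, h⟩ := exists_ladderChain_le hβ hβ' L (l := l)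
    have hev : ∀ᶠ x' in 𝓝 x, x' ≠ 0 ∧ x' ≠ emb l 1 :=
      (eventually_ne_nhds hx).and (eventually_ne_nhds hxn)
    have hsing := continuousAt_singFactor hβ' hxn
    have hmJ : Measurable fun y => radialWeight β y * ladderChain l β L y :=
      (measurable_radialWeight β).mul (measurable_ladderChain l β L)
    refine tendsto_lintegral_of_le_tendsto (μ := (volume : Measure (Space l))) (u := 𝓝 x)
      (F := fun x y => ENNReal.ofReal (‖x - y‖ ^ (-(2 * ((l : ℝ) + 1 - β)))) *
        (radialWeight β y * ladderChain l β L y))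
      (G := fun x y => ENNReal.ofReal C * ENNReal.ofReal (ladderDom l β x y))
      (f := fun y => ENNReal.ofReal (‖x - y‖ ^ (-(2 * ((l : ℝ) + 1 - β)))) *
        (radialWeight β y * ladderChain l β L y))
      (g := fun y => ENNReal.ofReal C * ENNReal.ofReal (ladderDom l β x y))
      (fun x => (by fun_prop : Measurable fun y : Space l =>
        ENNReal.ofReal (‖x - y‖ ^ (-(2 * ((l : ℝ) + 1 - β))))).mul hmJ)
      (fun x => (measurable_ladderDom x).const_mul _)
      ((measurable_ladderDom x).const_mul _) ?_ ?_ ?_ ?_ ?_ ?_ ?_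
    · filter_upwards [hev] with x' hx' using ladderIntegrand_le_dom hβ' hC h hx'.2
    · filter_upwards [ae_ne_space x, ae_ne_zero_space l, ae_ne_space (emb l 1)] with y h1 h2 h3
      refine ENNReal.Tendsto.mul_const ?_ (Or.inr (ENNReal.mul_ne_top ENNReal.ofReal_ne_top
        (ladderChain_lt_top hβ hβ' L h2 h3).ne))
      exact (ENNReal.continuous_ofReal.continuousAt.comp (continuousAt_norm_sub_rpow _ h1.symm))
    · filter_upwards [ae_ne_space x] with y h1
      refine ENNReal.Tendsto.const_mul ?_ (Or.inr ENNReal.ofReal_ne_top)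
      refine (ENNReal.continuous_ofReal.tendsto _).comp ?_
      have hp := continuousAt_norm_sub_rpow (-(2 * ((l : ℝ) + 1 - β))) h1.symm
      exact ((hsing.const_add 1).mul (hp.mul_const _)).add (hsing.mul_const _)
    · exact ladderIntegrand_le_dom hβ' hC h hxn
    · exact Eventually.of_forall fun y => ENNReal.mul_ne_top ENNReal.ofReal_ne_top
        ENNReal.ofReal_ne_top
    · rw [lintegral_const_mul' _ _ ENNReal.ofReal_ne_top, lintegral_ladderDom hβ hβ' hx]
      exact ENNReal.mul_ne_top ENNReal.ofReal_ne_top ENNReal.ofReal_ne_top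
    · have hev2 : (fun x' => ENNReal.ofReal C * ENNReal.ofReal
          ((powerIntegral l β (emb l 1)).toReal * ((1 + singFactor l β x') *
            ‖x'‖ ^ (-((l : ℝ) + 1 - β)) + singFactor l β x'))) =ᶠ[𝓝 x]
          fun x' => ∫⁻ y, ENNReal.ofReal C * ENNReal.ofReal (ladderDom l β x' y) := by
        filter_upwards [hev] with x' hx'
        rw [lintegral_const_mul' _ _ ENNReal.ofReal_ne_top, lintegral_ladderDom hβ hβ' hx'.1]
      refine Tendsto.congr' hev2 ?_
      rw [lintegral_const_mul' _ _ ENNReal.ofReal_ne_top, lintegral_ladderDom hβ hβ' hx]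
      refine ENNReal.Tendsto.const_mul ?_ (Or.inr ENNReal.ofReal_ne_top)
      refine (ENNReal.continuous_ofReal.tendsto _).comp ?_
      have hp : ContinuousAt (fun x : Space l => ‖x‖ ^ (-((l : ℝ) + 1 - β))) x :=
        ContinuousAt.rpow_const (by fun_prop) (Or.inl (norm_ne_zero_iff.2 hx))
      exact (((hsing.const_add 1).mul hp).add hsing).const_mul _

end

/-! ### Integration in bispherical slices -/

/-- The lower integral of a measurable radial function in polar coordinates; no integrability is
needed. -/
lemma lintegral_fun_norm {E : Type*} [NormedAddCommGroup E] [NormedSpace ℝ E]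
    [FiniteDimensional ℝ E] [Nontrivial E] [MeasurableSpace E] [BorelSpace E] (μ : Measure E)
    [μ.IsAddHaarMeasure] {f : ℝ → ENNReal} (hf : Measurable f) :
    ∫⁻ x, f ‖x‖ ∂μ = (Module.finrank ℝ E * μ (Metric.ball 0 1)) *
      ∫⁻ t in Ioi (0 : ℝ), ENNReal.ofReal (t ^ (Module.finrank ℝ E - 1)) * f t := by
  calc
    ∫⁻ x, f ‖x‖ ∂μ = ∫⁻ x : ({(0)}ᶜ : Set E), f ‖x.1‖ ∂(μ.comap (↑)) := by
      rw [lintegral_subtype_comap (measurableSet_singleton _).compl fun x => f ‖x‖,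
        restrict_compl_singleton]
    _ = ∫⁻ x, f x.2 ∂μ.toSphere.prod (.volumeIoiPow (Module.finrank ℝ E - 1)) := by
      have h := μ.measurePreserving_homeomorphUnitSphereProd.lintegral_comp_emb
        (Homeomorph.measurableEmbedding _) (f ∘ Subtype.val ∘ Prod.snd)
      simpa using h
    _ = μ.toSphere univ * ∫⁻ x : Ioi (0 : ℝ), f x ∂.volumeIoiPow (Module.finrank ℝ E - 1) := by
      rw [lintegral_prod _ (by fun_prop)]
      simp only [lintegral_const]
      rw [mul_comm]
    _ = _ := by
      rw [μ.toSphere_apply_univ, Measure.volumeIoiPow,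
        lintegral_withDensity_eq_lintegral_mul _ (by fun_prop) (by fun_prop)]
      congr 1
      exact lintegral_subtype_comap measurableSet_Ioi
        fun t => ENNReal.ofReal (t ^ (Module.finrank ℝ E - 1)) * f t

/-- Polar coordinates of the upper half plane. -/
lemma lintegral_halfPlane {f : ℝ → ℝ → ENNReal} (hf : Measurable (Function.uncurry f)) :
    ∫⁻ a, ∫⁻ t in Ioi (0 : ℝ), f a t =
      ∫⁻ ρ in Ioi (0 : ℝ), ∫⁻ θ in Ioo 0 π, ENNReal.ofReal ρ * f (ρ * cos θ) (ρ * sin θ) := by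
  set S : Set (ℝ × ℝ) := {p | 0 < p.2} with hS
  have hSm : MeasurableSet S := measurableSet_lt measurable_const measurable_snd
  have hFm : Measurable (S.indicator (Function.uncurry f)) := hf.indicator hSm
  have h1 : ∫⁻ a, ∫⁻ t in Ioi (0 : ℝ), f a t = ∫⁻ p, S.indicator (Function.uncurry f) p := by
    rw [Measure.volume_eq_prod, lintegral_prod _ hFm.aemeasurable]
    refine lintegral_congr fun a => ?_
    rw [← lintegral_indicator measurableSet_Ioi]
    rfl
  rw [h1, ← lintegral_comp_polarCoord_symm]
  have h2 : polarCoord.target = Ioi (0 : ℝ) ×ˢ Ioo (-π) π := rfl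
  rw [h2, Measure.volume_eq_prod, setLIntegral_prod _ (by
    refine Measurable.aemeasurable ?_
    simp only [smul_eq_mul, polarCoord_symm_apply]
    exact (by fun_prop : Measurable fun p : ℝ × ℝ => ENNReal.ofReal p.1).mul
      (hFm.comp (by fun_prop)))]
  refine setLIntegral_congr_fun measurableSet_Ioi fun ρ hρ => ?_
  have hρ0 : (0 : ℝ) < ρ := hρ
  rw [← lintegral_indicator measurableSet_Ioo, ← lintegral_indicator measurableSet_Ioo]
  refine lintegral_congr fun θ => ?_
  simp only [polarCoord_symm_apply, smul_eq_mul]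
  by_cases hθ : θ ∈ Ioo 0 π
  · have hs : 0 < sin θ := sin_pos_of_pos_of_lt_pi hθ.1 hθ.2
    have hm : (ρ * cos θ, ρ * sin θ) ∈ S := mul_pos hρ0 hs
    rw [indicator_of_mem hθ, indicator_of_mem (show θ ∈ Ioo (-π) π from
      ⟨by linarith [hθ.1, pi_pos], hθ.2⟩), indicator_of_mem hm]
    rfl
  · rw [indicator_of_notMem hθ]
    by_cases hθ' : θ ∈ Ioo (-π) π
    · have hs : sin θ ≤ 0 := by
        refine sin_nonpos_of_nonpos_of_neg_pi_le ?_ hθ'.1.le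
        by_contra h
        exact hθ ⟨by linarith, hθ'.2⟩
      have hm : (ρ * cos θ, ρ * sin θ) ∉ S := by
        simp only [hS, mem_ofPred_eq, not_lt]
        exact mul_nonpos_of_nonneg_of_nonpos hρ0.le hs
      rw [indicator_of_mem hθ', indicator_of_notMem hm, mul_zero]
    · rw [indicator_of_notMem hθ']

/-- The area of the unit sphere of `ℝ^{2l}`. -/
noncomputable def sphereArea (l : ℕ) : ℝ := 2 * l * (π ^ l / l.factorial)

lemma sphereArea_nonneg (l : ℕ) : 0 ≤ sphereArea l := by unfold sphereArea; positivity

/-- The coordinates orthogonal to the plane of the first two axes. -/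
noncomputable def perp {l : ℕ} (y : Space l) : EuclideanSpace ℝ (Fin (2 * l)) :=
  WithLp.toLp 2 fun i => y i.succ.succ

lemma norm_sq_eq_perp {l : ℕ} (y : Space l) :
    ‖y‖ ^ 2 = y 0 ^ 2 + y 1 ^ 2 + ‖perp y‖ ^ 2 := by
  rw [EuclideanSpace.norm_sq_eq, EuclideanSpace.norm_sq_eq, Fin.sum_univ_succ, Fin.sum_univ_succ]
  simp [perp, add_assoc]

/-- Fubini's theorem for the splitting of the first two coordinates. -/
lemma lintegral_space_eq {l : ℕ} {F : ℝ → ℝ → EuclideanSpace ℝ (Fin (2 * l)) → ENNReal}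
    (hF : Measurable fun p : ℝ × ℝ × EuclideanSpace ℝ (Fin (2 * l)) => F p.1 p.2.1 p.2.2) :
    ∫⁻ y : Space l, F (y 0) (y 1) (perp y) = ∫⁻ a, ∫⁻ b, ∫⁻ w, F a b w := by
  have h1 := EuclideanSpace.volume_preserving_symm_measurableEquiv_toLp (Fin (2 * l + 2))
  have h2 := volume_preserving_piFinSuccAbove (fun _ : Fin (2 * l + 1 + 1) => ℝ) 0
  have h3 := volume_preserving_piFinSuccAbove (fun _ : Fin (2 * l + 1) => ℝ) 0
  have h4 := (EuclideanSpace.volume_preserving_symm_measurableEquiv_toLp (Fin (2 * l))).symm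
  have h5 := (MeasurePreserving.id (volume : Measure ℝ)).prod
    (((MeasurePreserving.id (volume : Measure ℝ)).prod h4).comp h3)
  have h6 := (h5.comp h2).comp h1
  have h7 := h6.lintegral_comp hF
  rw [lintegral_prod _ hF.aemeasurable] at h7
  refine Eq.trans ?_ (h7.trans ?_)
  · rfl
  · refine lintegral_congr fun a => ?_
    rw [lintegral_prod _ (by
      exact (hF.comp (measurable_prodMk_left (x := a))).aemeasurable)]

/-- Integration over Euclidean space of a function of two coordinates and the distance to their
plane. -/
lemma lintegral_slice {l : ℕ} (hl : 0 < l) {F : ℝ → ℝ → ℝ → ENNReal}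
    (hF : Measurable fun p : ℝ × ℝ × ℝ => F p.1 p.2.1 p.2.2) :
    ∫⁻ y : Space l, F (y 0) (y 1) ‖perp y‖ =
      ∫⁻ ρ in Ioi (0 : ℝ), ∫⁻ θ in Ioo 0 π, ∫⁻ ψ in Ioo 0 π,
        ENNReal.ofReal (sphereArea l * ρ ^ (2 * l + 1) * (sin θ ^ (2 * l) * sin ψ ^ (2 * l - 1))) *
          F (ρ * cos θ) (ρ * sin θ * cos ψ) (ρ * sin θ * sin ψ) := by
  have : Nonempty (Fin (2 * l)) := ⟨⟨0, by omega⟩⟩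
  have : Nontrivial (EuclideanSpace ℝ (Fin (2 * l))) := by
    refine Module.nontrivial_of_finrank_pos (R := ℝ) ?_
    rw [finrank_euclideanSpace, Fintype.card_fin]; omega
  rw [lintegral_space_eq (F := fun a b w => F a b ‖w‖)
    (hF.comp (by fun_prop :
      Measurable fun p : ℝ × ℝ × EuclideanSpace ℝ (Fin (2 * l)) => (p.1, p.2.1, ‖p.2.2‖)))]
  have hvol : (Module.finrank ℝ (EuclideanSpace ℝ (Fin (2 * l))) : ENNReal) *
      volume (Metric.ball (0 : EuclideanSpace ℝ (Fin (2 * l))) 1) =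
      ENNReal.ofReal (sphereArea l) := by
    rw [InnerProductSpace.volume_ball_of_dim_even (k := l) (by simp), finrank_euclideanSpace,
      Fintype.card_fin, sphereArea, ENNReal.ofReal_mul (by positivity)]
    congr 1
    · rw [← ENNReal.ofReal_natCast]; push_cast; rfl
    · simp
  have hbt : ∀ a b, ∫⁻ w : EuclideanSpace ℝ (Fin (2 * l)), F a b ‖w‖ =
      ∫⁻ t in Ioi (0 : ℝ), ENNReal.ofReal (sphereArea l) *
        (ENNReal.ofReal (t ^ (2 * l - 1)) * F a b t) := by
    intro a b
    rw [lintegral_fun_norm _ (f := fun t => F a b t)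
      (hF.comp (by fun_prop : Measurable fun t : ℝ => (a, b, t))), hvol,
      lintegral_const_mul' _ _ ENNReal.ofReal_ne_top, finrank_euclideanSpace, Fintype.card_fin]
  have hGm : Measurable fun p : ℝ × ℝ × ℝ => ENNReal.ofReal (sphereArea l) *
      (ENNReal.ofReal (p.2.2 ^ (2 * l - 1)) * F p.1 p.2.1 p.2.2) :=
    measurable_const.mul ((by fun_prop :
      Measurable fun p : ℝ × ℝ × ℝ => ENNReal.ofReal (p.2.2 ^ (2 * l - 1))).mul hF)
  have hps : ∀ a, ∫⁻ b, ∫⁻ t in Ioi (0 : ℝ), ENNReal.ofReal (sphereArea l) *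
        (ENNReal.ofReal (t ^ (2 * l - 1)) * F a b t) =
      ∫⁻ s in Ioi (0 : ℝ), ∫⁻ ψ in Ioo 0 π, ENNReal.ofReal s * (ENNReal.ofReal (sphereArea l) *
        (ENNReal.ofReal ((s * sin ψ) ^ (2 * l - 1)) * F a (s * cos ψ) (s * sin ψ))) := by
    intro a
    exact lintegral_halfPlane (f := fun b t => ENNReal.ofReal (sphereArea l) *
        (ENNReal.ofReal (t ^ (2 * l - 1)) * F a b t)) (hGm.comp (measurable_prodMk_left (x := a)))
  -- polar coordinates in the plane of `y 1` and `‖perp y‖`, then in that of `y 0` and their radius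
  simp_rw [hbt, hps]
  have hm2 : Measurable fun q : (ℝ × ℝ) × ℝ => ENNReal.ofReal q.1.2 *
      (ENNReal.ofReal (sphereArea l) * (ENNReal.ofReal ((q.1.2 * sin q.2) ^ (2 * l - 1)) *
        F q.1.1 (q.1.2 * cos q.2) (q.1.2 * sin q.2))) :=
    (by fun_prop : Measurable fun q : (ℝ × ℝ) × ℝ => ENNReal.ofReal q.1.2).mul
      (hGm.comp (by fun_prop : Measurable fun q : (ℝ × ℝ) × ℝ =>
        (q.1.1, q.1.2 * cos q.2, q.1.2 * sin q.2)))
  rw [lintegral_halfPlane (f := fun a s => ∫⁻ ψ in Ioo 0 π, ENNReal.ofReal s *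
    (ENNReal.ofReal (sphereArea l) * (ENNReal.ofReal ((s * sin ψ) ^ (2 * l - 1)) *
      F a (s * cos ψ) (s * sin ψ)))) (Measurable.lintegral_prod_right hm2)]
  refine setLIntegral_congr_fun measurableSet_Ioi fun ρ hρ => ?_
  have hρ0 : (0 : ℝ) < ρ := hρ
  refine setLIntegral_congr_fun measurableSet_Ioo fun θ hθ => ?_
  have hsθ : 0 < sin θ := sin_pos_of_pos_of_lt_pi hθ.1 hθ.2
  rw [← lintegral_const_mul' _ _ ENNReal.ofReal_ne_top]
  refine setLIntegral_congr_fun measurableSet_Ioo fun ψ hψ => ?_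
  have hsψ : 0 < sin ψ := sin_pos_of_pos_of_lt_pi hψ.1 hψ.2
  have hω := sphereArea_nonneg l
  rw [← mul_assoc, ← mul_assoc, ← mul_assoc, ← ENNReal.ofReal_mul hρ0.le,
    ← ENNReal.ofReal_mul (by positivity), ← ENNReal.ofReal_mul (by positivity)]
  congr 2
  obtain ⟨m, rfl⟩ : ∃ m, l = m + 1 := ⟨l - 1, by omega⟩
  have e : 2 * (m + 1) - 1 = 2 * m + 1 := by omega
  rw [e]
  ring

lemma perp_emb (l : ℕ) (z : ℂ) : perp (emb l z) = 0 := by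
  ext i
  simp [perp, emb, Fin.ext_iff]

lemma emb_apply_zero (l : ℕ) (z : ℂ) : emb l z 0 = z.re := by
  simp [emb]

lemma emb_apply_one (l : ℕ) (z : ℂ) : emb l z 1 = z.im := by
  simp [emb]

lemma norm_emb_sub_sq (l : ℕ) (z : ℂ) (y : Space l) :
    ‖emb l z - y‖ ^ 2 = (z.re - y 0) ^ 2 + (z.im - y 1) ^ 2 + ‖perp y‖ ^ 2 := by
  rw [norm_sq_eq_perp]
  have h : perp (emb l z - y) = -perp y := by
    have h0 := perp_emb l z
    ext i
    have := congrArg (fun v => v i) h0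
    simp only [perp, PiLp.zero_apply] at this
    simp [perp, this]
  rw [h, norm_neg, PiLp.sub_apply, PiLp.sub_apply, emb_apply_zero, emb_apply_one]

/-- The ladders are functions of the first coordinate and the distance to the first axis. -/
lemma ladderChain_eq_emb (l : ℕ) (β : ℝ) (L : ℕ) (y : Space l) :
    ladderChain l β L y =
      ladderChain l β L (emb l ⟨y 0, √(y 1 ^ 2 + ‖perp y‖ ^ 2)⟩) := by
  have h1 : ‖y‖ ^ 2 = ‖emb l ⟨y 0, √(y 1 ^ 2 + ‖perp y‖ ^ 2)⟩‖ ^ 2 := by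
    rw [norm_sq_eq_perp, norm_emb, ← Complex.normSq_eq_norm_sq, Complex.normSq_apply]
    simp only
    rw [Real.mul_self_sqrt (by positivity)]; ring
  have h2 : ‖y - emb l 1‖ ^ 2 = ‖emb l ⟨y 0, √(y 1 ^ 2 + ‖perp y‖ ^ 2)⟩ - emb l 1‖ ^ 2 := by
    rw [norm_sub_rev, norm_emb_sub_sq, emb_sub, norm_emb, ← Complex.normSq_eq_norm_sq,
      Complex.normSq_apply]
    simp only [Complex.sub_re, Complex.sub_im, Complex.one_re, Complex.one_im, sub_zero]
    rw [Real.mul_self_sqrt (by positivity)]; ring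
  exact ladderChain_congr β L ((sq_eq_sq₀ (norm_nonneg _) (norm_nonneg _)).1 h1)
    ((sq_eq_sq₀ (norm_nonneg _) (norm_nonneg _)).1 h2)

/-- The restriction of the ladder to a plane through the first axis, in polar coordinates. -/
noncomputable def planarLadder (l : ℕ) (β : ℝ) (L : ℕ) (ρ θ : ℝ) : ENNReal :=
  ladderChain l β L (emb l (ρ * Complex.exp (θ * Complex.I)))

lemma measurable_planarLadder (l : ℕ) (β : ℝ) (L : ℕ) :
    Measurable (Function.uncurry (planarLadder l β L)) := by
  refine (measurable_ladderChain l β L).comp ((continuous_emb l).measurable.comp ?_)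
  exact Continuous.measurable (by fun_prop)

lemma measurable_planarLadder_fst (l : ℕ) (β : ℝ) (L : ℕ) (ρ : ℝ) :
    Measurable fun p : ℝ × ℝ => planarLadder l β L ρ p.1 := by
  have h : Measurable (planarLadder l β L ρ) := (measurable_planarLadder l β L).of_uncurry_left
  exact h.comp measurable_fst

set_option maxHeartbeats 800000 in
/-- One more loop, as an integral over the plane of the ladder and one angle. -/
lemma planarLadder_succ {l : ℕ} (hl : 0 < l) (β : ℝ) (L : ℕ) (r φ : ℝ) :
    planarLadder l β (L + 1) r φ =
      ∫⁻ ρ in Ioi (0 : ℝ), ENNReal.ofReal (sphereArea l * ρ ^ (2 * l + 1) * ρ ^ (-(2 * β))) *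
        ∫⁻ p in angleSquare,
          ENNReal.ofReal ((r ^ 2 + ρ ^ 2 - 2 * r * ρ * sphereDot φ p) ^ (-((l : ℝ) + 1 - β)) *
            (sin p.1 ^ (2 * l) * sin p.2 ^ (2 * l - 1))) * planarLadder l β L ρ p.1 := by
  set γ : ℝ := (l : ℝ) + 1 - β with hγ
  set z : ℂ := r * Complex.exp (φ * Complex.I) with hz
  have hzre : z.re = r * cos φ := by
    rw [hz, Complex.re_ofReal_mul, Complex.exp_ofReal_mul_I_re]
  have hzim : z.im = r * sin φ := by
    rw [hz, Complex.im_ofReal_mul, Complex.exp_ofReal_mul_I_im]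
  set F : ℝ → ℝ → ℝ → ENNReal := fun a b t =>
    ENNReal.ofReal (((z.re - a) ^ 2 + (z.im - b) ^ 2 + t ^ 2) ^ (-γ)) *
      (ENNReal.ofReal ((a ^ 2 + b ^ 2 + t ^ 2) ^ (-β)) *
        ladderChain l β L (emb l ⟨a, √(b ^ 2 + t ^ 2)⟩)) with hFdef
  have hFm : Measurable fun p : ℝ × ℝ × ℝ => F p.1 p.2.1 p.2.2 := by
    refine Measurable.mul (by fun_prop) (Measurable.mul (by fun_prop)
      ((measurable_ladderChain l β L).comp ((continuous_emb l).measurable.comp ?_)))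
    have : (fun p : ℝ × ℝ × ℝ => (⟨p.1, √(p.2.1 ^ 2 + p.2.2 ^ 2)⟩ : ℂ)) =
        fun p => (p.1 : ℂ) + (√(p.2.1 ^ 2 + p.2.2 ^ 2) : ℝ) * Complex.I := by
      funext p; apply Complex.ext <;> simp
    rw [this]
    exact Continuous.measurable (by fun_prop)
  have h1 : planarLadder l β (L + 1) r φ = ∫⁻ y : Space l, F (y 0) (y 1) ‖perp y‖ := by
    refine lintegral_congr fun y => ?_
    simp only [hFdef]
    rw [← norm_emb_sub_sq, ← norm_sq_eq_perp, ← ladderChain_eq_emb, radialWeight,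
      ← rpow_natCast, ← rpow_natCast, ← rpow_mul (norm_nonneg _), ← rpow_mul (norm_nonneg _)]
    have e1 : ((2 : ℕ) : ℝ) * -γ = -(2 * γ) := by push_cast; ring
    have e2 : ((2 : ℕ) : ℝ) * -β = -(2 * β) := by push_cast; ring
    rw [e1, e2]
    rfl
  rw [h1, lintegral_slice hl hFm]
  refine setLIntegral_congr_fun measurableSet_Ioi fun ρ hρ => ?_
  have hρ0 : (0 : ℝ) < ρ := hρ
  have hae : (angleSquare : Set (ℝ × ℝ)) =ᵐ[volume] Ioo 0 π ×ˢ Ioo 0 π := by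
    rw [Measure.volume_eq_prod]
    exact (Measure.set_prod_ae_eq Ioo_ae_eq_Icc Ioo_ae_eq_Icc).symm
  have hJm : Measurable fun p : ℝ × ℝ =>
      ENNReal.ofReal ((r ^ 2 + ρ ^ 2 - 2 * r * ρ * sphereDot φ p) ^ (-γ) *
            (sin p.1 ^ (2 * l) * sin p.2 ^ (2 * l - 1))) * planarLadder l β L ρ p.1 := by
    have hc := (continuous_sphereDot φ).measurable
    exact (((((hc.const_mul (2 * r * ρ)).const_sub (r ^ 2 + ρ ^ 2)).pow_const (-γ)).mul
      (by fun_prop : Measurable fun p : ℝ × ℝ => sin p.1 ^ (2 * l) * sin p.2 ^ (2 * l - 1))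
      ).ennreal_ofReal).mul (measurable_planarLadder_fst l β L ρ)
  rw [setLIntegral_congr hae, Measure.volume_eq_prod, setLIntegral_prod _ hJm.aemeasurable,
    ← lintegral_const_mul' _ _ ENNReal.ofReal_ne_top]
  refine setLIntegral_congr_fun measurableSet_Ioo fun θ hθ => ?_
  simp only
  rw [← lintegral_const_mul' _ _ ENNReal.ofReal_ne_top]
  refine setLIntegral_congr_fun measurableSet_Ioo fun ψ hψ => ?_
  have hsθ : 0 < sin θ := sin_pos_of_pos_of_lt_pi hθ.1 hθ.2
  have hsψ : 0 < sin ψ := sin_pos_of_pos_of_lt_pi hψ.1 hψ.2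
  have hω := sphereArea_nonneg l
  have q1 : (z.re - ρ * cos θ) ^ 2 + (z.im - ρ * sin θ * cos ψ) ^ 2 + (ρ * sin θ * sin ψ) ^ 2 =
      r ^ 2 + ρ ^ 2 - 2 * r * ρ * sphereDot φ (θ, ψ) := by
    rw [hzre, hzim, sphereDot]
    linear_combination r ^ 2 * sin_sq_add_cos_sq φ + ρ ^ 2 * sin_sq_add_cos_sq θ +
      ρ ^ 2 * sin θ ^ 2 * sin_sq_add_cos_sq ψ
  have q2 : (ρ * cos θ) ^ 2 + (ρ * sin θ * cos ψ) ^ 2 + (ρ * sin θ * sin ψ) ^ 2 = ρ ^ 2 := by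
    linear_combination ρ ^ 2 * sin_sq_add_cos_sq θ + ρ ^ 2 * sin θ ^ 2 * sin_sq_add_cos_sq ψ
  have q3 : (⟨ρ * cos θ, √((ρ * sin θ * cos ψ) ^ 2 + (ρ * sin θ * sin ψ) ^ 2)⟩ : ℂ) =
      ρ * Complex.exp (θ * Complex.I) := by
    have : (ρ * sin θ * cos ψ) ^ 2 + (ρ * sin θ * sin ψ) ^ 2 = (ρ * sin θ) ^ 2 := by
      linear_combination ρ ^ 2 * sin θ ^ 2 * sin_sq_add_cos_sq ψ
    rw [this, Real.sqrt_sq (by positivity)]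
    apply Complex.ext
    · simp [Complex.exp_ofReal_mul_I_re]
    · simp [Complex.exp_ofReal_mul_I_im]
  have q4 : (ρ ^ 2) ^ (-β) = ρ ^ (-(2 * β)) := by
    rw [← rpow_natCast, ← rpow_mul hρ0.le]; congr 1; push_cast; ring
  have q0 : 0 ≤ r ^ 2 + ρ ^ 2 - 2 * r * ρ * sphereDot φ (θ, ψ) := by rw [← q1]; positivity
  simp only [hFdef]
  have e3 : ∀ (A B C : ℝ) (J : ENNReal), 0 ≤ A → 0 ≤ B → ENNReal.ofReal A *
      (ENNReal.ofReal B * (ENNReal.ofReal C * J)) = ENNReal.ofReal (A * B * C) * J := by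
    intro A B C J hA hB
    rw [← mul_assoc, ← mul_assoc, ← ENNReal.ofReal_mul hA, ← ENNReal.ofReal_mul (by positivity)]
  have e2 : ∀ (A B : ℝ) (J : ENNReal), 0 ≤ A → ENNReal.ofReal A * (ENNReal.ofReal B * J) =
      ENNReal.ofReal (A * B) * J := by
    intro A B J hA
    rw [← mul_assoc, ← ENNReal.ofReal_mul hA]
  rw [q1, q2, q3, q4, planarLadder, e3 _ _ _ _ (by positivity) (by positivity),
    e2 _ _ _ (by positivity)]
  congr 2
  ring

/-! ### The ladder functions on circles -/

section
variable {l : ℕ} {β : ℝ}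

/-- The normalization of the ladder functions. -/
noncomputable def ladderScale (l : ℕ) (β : ℝ) (L : ℕ) : ℝ :=
  propConst ((l : ℝ) + 1) β ^ (L + 1) * (2 * π ^ (l + 2))

/-- The normalized ladder function. -/
noncomputable def ladderFun (l : ℕ) (β : ℝ) (L : ℕ) (z : ℂ) : ℂ :=
  ((ladderScale l β L * ‖z‖ * (ladderChain l β L (emb l z)).toReal : ℝ) : ℂ)

lemma isLadderFunction_ladderFun (l : ℕ) (β : ℝ) (L : ℕ) :
    IsLadderFunction l β L (ladderFun l β L) := by
  intro z x₁ x₂ x₃ x₄ h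
  rw [ladderF_eq L h, ladderFun, ladderScale]
  congr 1
  have hz : 0 < ‖1 - z‖ := by
    rcases (norm_nonneg (1 - z)).eq_or_lt with h0 | h0
    · have hv := h.cross_v
      have n14 := norm_pos_iff.2 (sub_ne_zero.2 h.ne₁₄)
      have n23 := norm_pos_iff.2 (sub_ne_zero.2 h.ne₂₃)
      have n24 := norm_pos_iff.2 (sub_ne_zero.2 h.ne₂₄)
      have n13 := norm_pos_iff.2 (sub_ne_zero.2 h.ne₁₃)
      have hp : 0 < (‖x₁ - x₄‖ ^ 2 * ‖x₂ - x₃‖ ^ 2) / (‖x₂ - x₄‖ ^ 2 * ‖x₁ - x₃‖ ^ 2) := by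
        positivity
      rw [hv, ← h0] at hp
      simp at hp
    · exact h0
  have he : (l : ℝ) + 1 - β = (l : ℝ) - β + 1 := by ring
  have hp : (0 : ℝ) < (‖1 - z‖ ^ 2) ^ ((l : ℝ) - β + 1) := by positivity
  rw [he]
  field_simp

lemma ladderFun_conj (L : ℕ) (z : ℂ) :
    ladderFun l β L (starRingEnd ℂ z) = ladderFun l β L z := by
  have h1 : ladderChain l β L (emb l (starRingEnd ℂ z)) = ladderChain l β L (emb l z) := by
    refine ladderChain_congr β L ?_ ?_
    · rw [norm_emb, norm_emb, RCLike.norm_conj]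
    · rw [emb_sub, emb_sub, norm_emb, norm_emb, ← RCLike.norm_conj (z - 1), map_sub, map_one]
  rw [ladderFun, ladderFun, h1, RCLike.norm_conj]

lemma norm_upperPoint {ρ : ℝ} (hρ : 0 ≤ ρ) (c : ℝ) : ‖upperPoint ρ c‖ = ρ := by
  rw [upperPoint, norm_mul, Complex.norm_exp_ofReal_mul_I, mul_one, Complex.norm_real,
    norm_of_nonneg hρ]

lemma re_div_norm_mem_Ioo {z : ℂ} (hz : z.im ≠ 0) : z.re / ‖z‖ ∈ Ioo (-1 : ℝ) 1 := by
  have h0 : 0 < ‖z‖ := norm_pos_iff.2 fun h => hz (by simp [h])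
  have h1 : |z.re| < ‖z‖ := Complex.abs_re_lt_norm.2 hz
  have := abs_lt.1 h1
  constructor
  · rw [lt_div_iff₀ h0]; linarith
  · rw [div_lt_iff₀ h0]; linarith

lemma eq_upperPoint {z : ℂ} (hz : 0 < z.im) : z = upperPoint ‖z‖ (z.re / ‖z‖) := by
  have h0 : 0 < ‖z‖ := norm_pos_iff.2 fun h => hz.ne' (by simp [h])
  have hc := re_div_norm_mem_Ioo hz.ne'
  have h1 : arccos (z.re / ‖z‖) = z.arg := (Complex.arg_of_im_nonneg_of_ne_zero hz.le
    (norm_pos_iff.1 h0)).symm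
  rw [upperPoint, h1, Complex.norm_mul_exp_arg_mul_I]

lemma upperPoint_cos {ρ θ : ℝ} (hθ : θ ∈ Icc 0 π) :
    upperPoint ρ (cos θ) = ρ * Complex.exp (θ * Complex.I) := by
  rw [upperPoint, arccos_cos hθ.1 hθ.2]

/-- The ladder integral on the circle of radius `ρ` as a function of the cosine of the angle. -/
noncomputable def ladderProfile (l : ℕ) (β : ℝ) (L : ℕ) (ρ c : ℝ) : ℝ :=
  (planarLadder l β L ρ (arccos c)).toReal

lemma ladderProfile_nonneg (L : ℕ) (ρ c : ℝ) : 0 ≤ ladderProfile l β L ρ c :=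
  ENNReal.toReal_nonneg

lemma ladderFun_upperPoint (L : ℕ) {ρ : ℝ} (hρ : 0 ≤ ρ) (c : ℝ) :
    ladderFun l β L (upperPoint ρ c) =
      ((ladderScale l β L * ρ * ladderProfile l β L ρ c : ℝ) : ℂ) := by
  rw [ladderFun, norm_upperPoint hρ]
  rfl

lemma emb_ne_zero {z : ℂ} (hz : z ≠ 0) : emb l z ≠ 0 := by
  rw [← norm_pos_iff, norm_emb]; exact norm_pos_iff.2 hz

lemma emb_ne_one {z : ℂ} (hz : z ≠ 1) : emb l z ≠ emb l 1 := by
  rw [← sub_ne_zero, emb_sub]; exact emb_ne_zero (sub_ne_zero.2 hz)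

lemma polar_ne_zero {ρ : ℝ} (hρ : 0 < ρ) (θ : ℝ) : (ρ : ℂ) * Complex.exp (θ * Complex.I) ≠ 0 :=
  mul_ne_zero (by exact_mod_cast hρ.ne') (Complex.exp_ne_zero _)

lemma norm_polar {ρ : ℝ} (hρ : 0 ≤ ρ) (θ : ℝ) : ‖(ρ : ℂ) * Complex.exp (θ * Complex.I)‖ = ρ := by
  rw [norm_mul, Complex.norm_exp_ofReal_mul_I, mul_one, Complex.norm_real, norm_of_nonneg hρ]

lemma polar_ne_one {ρ : ℝ} (hρ : 0 < ρ) (h1 : ρ ≠ 1) (θ : ℝ) :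
    (ρ : ℂ) * Complex.exp (θ * Complex.I) ≠ 1 := fun h => h1 (by
  rw [← norm_polar hρ.le θ, h, norm_one])

lemma upperPoint_ne_one {ρ c : ℝ} (hρ : 0 < ρ) (hc : c ∈ Ioo (-1 : ℝ) 1) :
    upperPoint ρ c ≠ 1 := fun h => by
  have := im_upperPoint hρ hc
  rw [h] at this; simp at this

lemma planarLadder_lt_top (hβ : 0 < β) (hβ' : β < (l : ℝ) + 1) (L : ℕ) {ρ θ : ℝ} (hρ : 0 < ρ)
    (h : (ρ : ℂ) * Complex.exp (θ * Complex.I) ≠ 1) : planarLadder l β L ρ θ < ⊤ :=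
  ladderChain_lt_top hβ hβ' L (emb_ne_zero (polar_ne_zero hρ θ)) (emb_ne_one h)

lemma continuousAt_ladderProfile (hβ : 0 < β) (hβ' : β < (l : ℝ) + 1) (L : ℕ) {ρ c : ℝ}
    (hρ : 0 < ρ) (h : upperPoint ρ c ≠ 1) : ContinuousAt (ladderProfile l β L ρ) c := by
  have h0 : emb l (upperPoint ρ c) ≠ 0 := emb_ne_zero (polar_ne_zero hρ _)
  have h1 := emb_ne_one (l := l) h
  have hc : Continuous (upperPoint ρ) := by
    unfold upperPoint
    exact continuous_const.mul (Complex.continuous_exp.comp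
      ((Complex.continuous_ofReal.comp continuous_arccos).mul continuous_const))
  have h2 := (continuousAt_ladderChain hβ hβ' L h0 h1).comp (f := fun c => emb l (upperPoint ρ c))
    ((continuous_emb l).comp hc).continuousAt
  exact (ENNReal.tendsto_toReal (ladderChain_lt_top hβ hβ' L h0 h1).ne).comp h2

lemma continuous_ladderProfile (hβ : 0 < β) (hβ' : β < (l : ℝ) + 1) (L : ℕ) {ρ : ℝ}
    (hρ : 0 < ρ) (h1 : ρ ≠ 1) : Continuous (ladderProfile l β L ρ) :=
  continuous_iff_continuousAt.2 fun _ =>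
    continuousAt_ladderProfile hβ hβ' L hρ (polar_ne_one hρ h1 _)

lemma continuousOn_ladderProfile (hβ : 0 < β) (hβ' : β < (l : ℝ) + 1) (L : ℕ) {ρ : ℝ}
    (hρ : 0 < ρ) : ContinuousOn (ladderProfile l β L ρ) (Ioo (-1) 1) := fun _ hc =>
  (continuousAt_ladderProfile hβ hβ' L hρ (upperPoint_ne_one hρ hc)).continuousWithinAt

lemma measurable_planarLadder_comp (l : ℕ) (β : ℝ) (L : ℕ) {α : Type*} [MeasurableSpace α]
    {f g : α → ℝ} (hf : Measurable f) (hg : Measurable g) :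
    Measurable fun a => planarLadder l β L (f a) (g a) := by
  unfold planarLadder
  refine (measurable_ladderChain l β L).comp ((continuous_emb l).measurable.comp ?_)
  fun_prop

/-! ### The contribution of one circle to the next ladder -/

/-- The contribution of the circle of radius `ρ` to the ladder with one more loop, at the point with
polar coordinates `r` and `arccos c`. -/
noncomputable def loopDensity (l : ℕ) (β : ℝ) (L : ℕ) (r ρ c : ℝ) : ENNReal :=
  ENNReal.ofReal (sphereArea l * ρ ^ (2 * l + 1) * ρ ^ (-(2 * β))) *
    ∫⁻ p in angleSquare,
      ENNReal.ofReal ((r ^ 2 + ρ ^ 2 - 2 * r * ρ * sphereDot (arccos c) p) ^ (-((l : ℝ) + 1 - β)) *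
        (sin p.1 ^ (2 * l) * sin p.2 ^ (2 * l - 1))) * planarLadder l β L ρ p.1

lemma measurable_loopDensity (l : ℕ) (β : ℝ) (L : ℕ) (r : ℝ) :
    Measurable (Function.uncurry (loopDensity l β L r)) := by
  unfold loopDensity Function.uncurry
  refine Measurable.mul (by fun_prop) (Measurable.lintegral_prod_right ?_)
  have h1 : Measurable fun q : (ℝ × ℝ) × ℝ × ℝ => sphereDot (arccos q.1.2) q.2 := by
    unfold sphereDot
    have ha : Measurable fun q : (ℝ × ℝ) × ℝ × ℝ => arccos q.1.2 :=
      continuous_arccos.measurable.comp (by fun_prop)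
    fun_prop
  have h2 : Measurable fun q : (ℝ × ℝ) × ℝ × ℝ => planarLadder l β L q.1.1 q.2.1 :=
    measurable_planarLadder_comp l β L (by fun_prop) (by fun_prop)
  refine Measurable.mul ?_ h2
  refine ((Measurable.pow_const ?_ _).mul (by fun_prop)).ennreal_ofReal
  exact Measurable.sub (by fun_prop)
    ((by fun_prop : Measurable fun q : (ℝ × ℝ) × ℝ × ℝ => 2 * r * q.1.1).mul h1)

lemma lintegral_loopDensity (hl : 0 < l) (β : ℝ) (L : ℕ) (r c : ℝ) :
    ∫⁻ ρ in Ioi (0 : ℝ), loopDensity l β L r ρ c = planarLadder l β (L + 1) r (arccos c) :=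
  (planarLadder_succ hl β L r (arccos c)).symm

/-- The `l`-th derivative of the planar kernel is the propagator of `ℝ^D`, up to the constant
`(2 r ρ)^l π^l a(β)`. -/
lemma sphereIntegral_eq_lintegral (hβ : 0 < β) (hβ' : β < (l : ℝ) + 1) (L : ℕ)
    {r ρ : ℝ} (hr : 0 < r) (hρ : 0 < ρ) (h1 : ρ ≠ 1) (A φ : ℝ) :
    sphereIntegral l (annulusKernel β r ρ l)
        (fun t => ((A * ladderProfile l β L ρ t : ℝ) : ℂ)) φ =
      (((2 * r * ρ) ^ l * π ^ l * propConst ((l : ℝ) + 1) β * A *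
        (∫⁻ p in angleSquare, ENNReal.ofReal
          ((r ^ 2 + ρ ^ 2 - 2 * r * ρ * sphereDot φ p) ^ (-((l : ℝ) + 1 - β)) *
          (sin p.1 ^ (2 * l) * sin p.2 ^ (2 * l - 1))) * planarLadder l β L ρ p.1).toReal : ℝ) : ℂ) := by
  set γ : ℝ := (l : ℝ) + 1 - β with hγ
  have hq : ∀ p, 0 ≤ r ^ 2 + ρ ^ 2 - 2 * r * ρ * sphereDot φ p := fun p =>
    (sq_nonneg _).trans (annulus_dist_sq_ge hr.le hρ.le (abs_sphereDot_le φ p))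
  have hlt : ∫⁻ p in angleSquare, ENNReal.ofReal
          ((r ^ 2 + ρ ^ 2 - 2 * r * ρ * sphereDot φ p) ^ (-γ) *
          (sin p.1 ^ (2 * l) * sin p.2 ^ (2 * l - 1))) * planarLadder l β L ρ p.1 =
      ∫⁻ p in angleSquare, ENNReal.ofReal
          ((r ^ 2 + ρ ^ 2 - 2 * r * ρ * sphereDot φ p) ^ (-γ) *
          (sin p.1 ^ (2 * l) * sin p.2 ^ (2 * l - 1)) * ladderProfile l β L ρ (cos p.1)) := by
    refine setLIntegral_congr_fun measurableSet_angleSquare fun p hp => ?_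
    have hs1 : 0 ≤ sin p.1 := sin_nonneg_of_nonneg_of_le_pi hp.1.1 hp.1.2
    have hs2 : 0 ≤ sin p.2 := sin_nonneg_of_nonneg_of_le_pi hp.2.1 hp.2.2
    have := hq p
    symm
    rw [ENNReal.ofReal_mul (by positivity), ladderProfile, arccos_cos hp.1.1 hp.1.2,
      ENNReal.ofReal_toReal (planarLadder_lt_top hβ hβ' L hρ (polar_ne_one hρ h1 _)).ne]
  have hm : Measurable fun p : ℝ × ℝ =>
      (r ^ 2 + ρ ^ 2 - 2 * r * ρ * sphereDot φ p) ^ (-γ) *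
          (sin p.1 ^ (2 * l) * sin p.2 ^ (2 * l - 1)) * ladderProfile l β L ρ (cos p.1) := by
    have hc := (continuous_sphereDot φ).measurable
    have hp : Measurable fun p : ℝ × ℝ => ladderProfile l β L ρ (cos p.1) :=
      (continuous_ladderProfile hβ hβ' L hρ h1).measurable.comp (by fun_prop)
    exact (((hc.const_mul (2 * r * ρ)).const_sub (r ^ 2 + ρ ^ 2)).pow_const (-γ)).mul
      (by fun_prop : Measurable fun p : ℝ × ℝ => sin p.1 ^ (2 * l) * sin p.2 ^ (2 * l - 1))
      |>.mul hp
  rw [hlt, ← integral_eq_lintegral_of_nonneg_ae ?_ hm.aestronglyMeasurable, sphereIntegral,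
    ← integral_const_mul, ← integral_complex_ofReal]
  · refine setIntegral_congr_fun measurableSet_angleSquare fun p hp => ?_
    rw [annulusKernel, planePow_eq l hβ', ← Complex.ofReal_mul]
    congr 1
    have e : (-(2 * r * ρ)) ^ l * ((-1) ^ l * π ^ l) = (2 * r * ρ) ^ l * π ^ l := by
      rw [← mul_assoc, ← mul_pow]; congr 2; ring
    linear_combination (propConst ((l : ℝ) + 1) β * (r ^ 2 + ρ ^ 2 - 2 * r * ρ * sphereDot φ p) ^ (-γ) *
      (sin p.1 ^ (2 * l) * sin p.2 ^ (2 * l - 1)) * (A * ladderProfile l β L ρ (cos p.1))) * e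
  · filter_upwards [ae_restrict_mem measurableSet_angleSquare] with p hp
    have hs1 : 0 ≤ sin p.1 := sin_nonneg_of_nonneg_of_le_pi hp.1.1 hp.1.2
    have hs2 : 0 ≤ sin p.2 := sin_nonneg_of_nonneg_of_le_pi hp.2.1 hp.2.2
    have := hq p
    have := ladderProfile_nonneg (l := l) (β := β) L ρ (cos p.1)
    simp only [Pi.zero_apply]
    positivity

/-- The values on a circle of a preimage of the ladder function under the `(m + 1)`-st power of
`R_d`, divided by the radius, with the derivatives with respect to the cosine of the angle. -/
noncomputable def preimageChain (m : ℕ) (β : ℝ) (L : ℕ) (P : Polynomial ℂ) (ρ : ℝ) (j : ℕ)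
    (t : ℝ) : ℂ :=
  taylorChain m P (fun t => (((2 * ρ) ^ (m + 1) * ladderScale (m + 1) β L *
    ladderProfile (m + 1) β L ρ t : ℝ) : ℂ)) j t

/-- The last derivative in the dimension shift is the contribution of a sphere to the next ladder. The
constants agree because `2 π^(m+1) / m!` is the area of the unit sphere of `ℝ^{2(m+1)}`. -/
lemma shiftChain_eq_loopDensity {m : ℕ} (hβ : 0 < β) (hβ' : β < ((m + 1 : ℕ) : ℝ) + 1) (L : ℕ)
    (P : Polynomial ℂ) {r ρ : ℝ} (hr : 0 < r) (hρ : 0 < ρ) (h1 : ρ ≠ 1) (c : ℝ) :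
    ((ρ ^ (-(2 * β)) * ρ : ℝ) : ℂ) *
      shiftChain (annulusKernel β r ρ) (preimageChain m β L P ρ) (m + 1) c =
    (((2 * r) ^ (m + 1) * ladderScale (m + 1) β (L + 1) *
      (loopDensity (m + 1) β L r ρ c).toReal : ℝ) : ℂ) := by
  have e1 : preimageChain m β L P ρ (m + 1) = fun t => (((2 * ρ) ^ (m + 1) *
      ladderScale (m + 1) β L * ladderProfile (m + 1) β L ρ t : ℝ) : ℂ) := by
    funext t
    rw [preimageChain, taylorChain, if_neg (by omega)]
  have hω := sphereArea_nonneg (m + 1)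
  rw [shiftChain, e1, sphereIntegral_eq_lintegral hβ hβ' L hr hρ h1, loopDensity,
    ENNReal.toReal_mul, ENNReal.toReal_ofReal (by positivity), ← Complex.ofReal_mul,
    ← Complex.ofReal_mul]
  congr 1
  generalize (∫⁻ p in angleSquare, _ : ENNReal).toReal = I
  have e2 : sphereArea (m + 1) = 2 * π ^ (m + 1) / m.factorial := by
    rw [sphereArea, Nat.factorial_succ]
    have : (m.factorial : ℝ) ≠ 0 := by positivity
    push_cast
    field_simp
  have e3 : ladderScale (m + 1) β (L + 1) =
      propConst (((m + 1 : ℕ) : ℝ) + 1) β * ladderScale (m + 1) β L := by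
    rw [ladderScale, ladderScale, pow_succ]; ring
  rw [e2, e3]
  have : (m.factorial : ℝ) ≠ 0 := by positivity
  field_simp
  ring

end

/-! ### The operator on an arbitrary preimage -/

lemma integral_circleIntegrand_conj (β : ℝ) {f : ℂ → ℂ} (hf : ∀ z, f (starRingEnd ℂ z) = f z)
    (x : ℂ) (ρ : ℝ) :
    ∫ θ in (-π)..π, circleIntegrand β f (starRingEnd ℂ x) ρ θ =
      ∫ θ in (-π)..π, circleIntegrand β f x ρ θ := by
  have h : ∀ θ : ℝ, circleIntegrand β f (starRingEnd ℂ x) ρ (-θ) = circleIntegrand β f x ρ θ := by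
    intro θ
    have e : (ρ : ℂ) * Complex.exp (((-θ : ℝ) : ℂ) * Complex.I) =
        starRingEnd ℂ (ρ * Complex.exp (θ * Complex.I)) := by
      rw [map_mul, Complex.conj_ofReal, ← Complex.exp_conj, map_mul, Complex.conj_ofReal,
        Complex.conj_I]
      push_cast
      ring_nf
    rw [circleIntegrand, circleIntegrand, e, hf, ← map_sub, RCLike.norm_conj]
  have h2 := intervalIntegral.integral_comp_neg (a := -π) (b := π)
    (circleIntegrand β f (starRingEnd ℂ x) ρ)
  rw [neg_neg] at h2
  rw [← h2]
  simp only [h]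

lemma Hhat_conj (β : ℝ) {f : ℂ → ℂ} (hf : ∀ z, f (starRingEnd ℂ z) = f z) (x : ℂ) :
    Hhat β f (starRingEnd ℂ x) = Hhat β f x := by
  simp only [Hhat, integral_circleIntegrand_conj β hf]

lemma eq_comp_upperPoint {h : ℂ → ℂ} (hs : ∀ z, h (starRingEnd ℂ z) = h z) {z : ℂ}
    (hz : z.im ≠ 0) : h z = h (upperPoint ‖z‖ (z.re / ‖z‖)) := by
  rcases lt_or_gt_of_ne hz with h0 | h0
  · have h1 := eq_upperPoint (z := starRingEnd ℂ z) (by rw [Complex.conj_im]; linarith)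
    rw [RCLike.norm_conj, Complex.conj_re] at h1
    rw [← h1, hs]
  · rw [← eq_upperPoint h0]

/-- A symmetric function whose values on the upper half of a circle are a function of the cosine of
the angle is that function on the whole circle, up to the two real points. -/
lemma polar_eq_of_symm {f : ℂ → ℂ} (hf : ∀ z, f (starRingEnd ℂ z) = f z) {ρ : ℝ} {G : ℝ → ℂ}
    (hG : ∀ c ∈ Ioo (-1 : ℝ) 1, f (upperPoint ρ c) = G c) {θ : ℝ} (hθ : θ ∈ Ioo (-π) π)
    (h0 : θ ≠ 0) : f (ρ * Complex.exp (θ * Complex.I)) = G (cos θ) := by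
  have key : ∀ θ ∈ Ioo 0 π, f (ρ * Complex.exp (θ * Complex.I)) = G (cos θ) := by
    intro θ hθ
    rw [← upperPoint_cos ⟨hθ.1.le, hθ.2.le⟩]
    refine hG _ ⟨?_, ?_⟩
    · rw [← cos_pi]; exact cos_lt_cos_of_nonneg_of_le_pi hθ.1.le le_rfl hθ.2
    · rw [← cos_zero]; exact cos_lt_cos_of_nonneg_of_le_pi le_rfl hθ.2.le hθ.1
  rcases lt_or_gt_of_ne h0 with h | h
  · have h1 := key (-θ) ⟨by linarith, by linarith [hθ.1]⟩
    have e : (ρ : ℂ) * Complex.exp (θ * Complex.I) =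
        starRingEnd ℂ (ρ * Complex.exp (((-θ : ℝ) : ℂ) * Complex.I)) := by
      rw [map_mul, Complex.conj_ofReal, ← Complex.exp_conj, map_mul, Complex.conj_ofReal,
        Complex.conj_I]
      push_cast
      ring_nf
    rw [e, hf, h1, cos_neg]
  · exact key θ ⟨h, hθ.2⟩

lemma ae_circleIntegrand_eq (β : ℝ) {f : ℂ → ℂ} (hf : ∀ z, f (starRingEnd ℂ z) = f z)
    {r ρ : ℝ} (hr : 0 ≤ r) (hρ : 0 ≤ ρ) (hne : r ≠ ρ) {G : ℝ → ℂ}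
    (hG : ∀ c ∈ Ioo (-1 : ℝ) 1, f (upperPoint ρ c) = G c) (φ : ℝ) :
    ∀ᵐ θ : ℝ, θ ∈ uIoc (-π) π →
      circleIntegrand β f (r * Complex.exp (φ * Complex.I)) ρ θ =
        (annulusKernel β r ρ 0 (cos (φ - θ)) : ℂ) * G (cos θ) := by
  have h1 : ∀ᵐ θ : ℝ, θ ≠ 0 ∧ θ ≠ π := (Measure.ae_ne volume 0).and (Measure.ae_ne volume π)
  filter_upwards [h1] with θ h2 hθ
  rw [uIoc_of_le (by linarith [pi_pos])] at hθ
  rw [circleIntegrand, planeKernel_norm_sub β hr hρ hne,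
    polar_eq_of_symm hf hG ⟨hθ.1, lt_of_le_of_ne hθ.2 h2.2⟩ h2.1]

lemma integral_circleIntegrand_eq (β : ℝ) {f : ℂ → ℂ} (hf : ∀ z, f (starRingEnd ℂ z) = f z)
    {r ρ : ℝ} (hr : 0 ≤ r) (hρ : 0 ≤ ρ) (hne : r ≠ ρ) {G : ℝ → ℂ}
    (hG : ∀ c ∈ Ioo (-1 : ℝ) 1, f (upperPoint ρ c) = G c) (φ : ℝ) :
    ∫ θ in (-π)..π, circleIntegrand β f (r * Complex.exp (φ * Complex.I)) ρ θ =
      circleConv (annulusKernel β r ρ 0) G φ :=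
  intervalIntegral.integral_congr_ae (ae_circleIntegrand_eq β hf hr hρ hne hG φ)

section
variable {m : ℕ} {β : ℝ}

lemma continuous_preimageProfile (hβ : 0 < β) (hβ' : β < ((m + 1 : ℕ) : ℝ) + 1) (L : ℕ) {ρ : ℝ}
    (hρ : 0 < ρ) (h1 : ρ ≠ 1) : Continuous fun t => (((2 * ρ) ^ (m + 1) *
      ladderScale (m + 1) β L * ladderProfile (m + 1) β L ρ t : ℝ) : ℂ) :=
  Complex.continuous_ofReal.comp (continuous_const.mul (continuous_ladderProfile hβ hβ' L hρ h1))

lemma hasDerivAt_preimageChain (hβ : 0 < β) (hβ' : β < ((m + 1 : ℕ) : ℝ) + 1) (L : ℕ)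
    {P : Polynomial ℂ} (hP : P.degree < (m + 1 : ℕ)) {ρ : ℝ} (hρ : 0 < ρ) (h1 : ρ ≠ 1) {j : ℕ}
    (hj : j < m + 1) (t : ℝ) :
    HasDerivAt (preimageChain m β L P ρ j) (preimageChain m β L P ρ (j + 1) t) t :=
  hasDerivAt_taylorChain isOpen_univ ordConnected_univ (mem_univ _) hP
    (continuous_preimageProfile hβ hβ' L hρ h1).continuousOn hj (mem_univ t)

/-- On a circle, a preimage of the ladder function is determined up to a polynomial in the cosine of
the angle. -/
lemma exists_preimageChain (hβ : 0 < β) (hβ' : β < ((m + 1 : ℕ) : ℝ) + 1) (L : ℕ)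
    {g : ℂ → ℂ} (hg : HasRdPow (m + 1) g (ladderFun (m + 1) β L)) {ρ : ℝ} (hρ : 0 < ρ) :
    ∃ P : Polynomial ℂ, P.degree < (m + 1 : ℕ) ∧ ∀ c ∈ Ioo (-1 : ℝ) 1,
      g (upperPoint ρ c) / (‖upperPoint ρ c‖ : ℂ) = preimageChain m β L P ρ 0 c := by
  obtain ⟨e, he, he0, hel⟩ := hg.exists_chain hρ
  have hρ' : (ρ : ℂ) ≠ 0 := by exact_mod_cast hρ.ne'
  have hel' : ∀ c ∈ Ioo (-1 : ℝ) 1, e (m + 1) c / ρ = (((2 * ρ) ^ (m + 1) *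
      ladderScale (m + 1) β L * ladderProfile (m + 1) β L ρ c : ℝ) : ℂ) := by
    intro c hc
    rw [hel c hc, ladderFun_upperPoint L hρ.le]
    push_cast
    field_simp
  have hcont : ContinuousOn (fun c => e (m + 1) c / (ρ : ℂ)) (Ioo (-1) 1) := by
    refine ContinuousOn.congr ?_ hel'
    exact Complex.continuous_ofReal.comp_continuousOn
      (continuousOn_const.mul (continuousOn_ladderProfile hβ hβ' L hρ))
  obtain ⟨P, hP, h⟩ := exists_polynomial_add_cauchyInt ordConnected_Ioo
    (by norm_num : (0 : ℝ) ∈ Ioo (-1 : ℝ) 1) m (e := fun j c => e j c / (ρ : ℂ))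
    (fun j hj c hc => (he j hj c hc).div_const _) hcont
  refine ⟨P, hP, fun c hc => ?_⟩
  rw [norm_upperPoint hρ.le, ← he0 c hc, h c hc, preimageChain, taylorChain, if_pos (Nat.zero_le m)]
  simp only [Function.iterate_zero, id_eq, Nat.sub_zero]
  congr 1
  refine intervalIntegral.integral_congr fun s hs => ?_
  have hs' : s ∈ Ioo (-1 : ℝ) 1 :=
    ordConnected_Ioo.uIcc_subset (by norm_num) hc hs
  simp only
  rw [hel' s hs']

lemma continuous_shiftChain_succ (j : ℕ) {k : ℕ → ℝ → ℝ} (hk : IsKernelChain k) {G : ℕ → ℝ → ℂ}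
    (hG : Continuous (G (j + 1))) : Continuous (shiftChain k G (j + 1)) :=
  continuous_const.mul ((continuous_sphereIntegral (j + 1) hk (j + 1) hG).comp continuous_arccos)

/-- The next ladder as an integral over the radius, in a form suited to the Cauchy formula. -/
lemma integral_loopDensity (hβ : 0 < β) (hβ' : β < ((m + 1 : ℕ) : ℝ) + 1) (L : ℕ) {r c : ℝ}
    (hr : 0 < r) (hc : c ∈ Ioo (-1 : ℝ) 1) :
    ∫ ρ in Ioi (0 : ℝ), (loopDensity (m + 1) β L r ρ c).toReal =
      ladderProfile (m + 1) β (L + 1) r c := by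
  have hm : Measurable fun ρ => loopDensity (m + 1) β L r ρ c :=
    (measurable_loopDensity (m + 1) β L r).of_uncurry_right
  have hlt : planarLadder (m + 1) β (L + 1) r (arccos c) < ⊤ :=
    planarLadder_lt_top hβ hβ' (L + 1) hr (upperPoint_ne_one hr hc)
  rw [← lintegral_loopDensity (Nat.succ_pos m)] at hlt
  rw [integral_toReal hm.aemeasurable (ae_lt_top hm hlt.ne), lintegral_loopDensity (Nat.succ_pos m),
    ladderProfile]

/-- The density is nonnegative, and its integral over the radius is the next ladder, which is
bounded on compact parts of the open arc. -/
lemma integrable_loopDensity (hβ : 0 < β) (hβ' : β < ((m + 1 : ℕ) : ℝ) + 1) (L : ℕ) {r c : ℝ}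
    (hr : 0 < r) (hc : c ∈ Ioo (-1 : ℝ) 1) :
    Integrable (fun q : ℝ × ℝ => (loopDensity (m + 1) β L r q.1 q.2).toReal)
      ((volume.restrict (Ioi 0)).prod (volume.restrict (uIoc 0 c))) := by
  have hm := measurable_loopDensity (m + 1) β L r
  refine integrable_toReal_of_lintegral_ne_top hm.aemeasurable ?_
  change ∫⁻ q, Function.uncurry (loopDensity (m + 1) β L r) q ∂_ ≠ ⊤
  rw [lintegral_prod_symm' _ hm]
  have h1 : ∀ s, ∫⁻ ρ in Ioi (0 : ℝ), Function.uncurry (loopDensity (m + 1) β L r) (ρ, s) =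
      planarLadder (m + 1) β (L + 1) r (arccos s) := fun s =>
    lintegral_loopDensity (Nat.succ_pos m) β L r s
  simp only [h1]
  have hsub : uIoc 0 c ⊆ Ioo (-1) 1 :=
    uIoc_subset_uIcc.trans (ordConnected_Ioo.uIcc_subset (by norm_num) hc)
  have h2 : ∫⁻ s in uIoc 0 c, planarLadder (m + 1) β (L + 1) r (arccos s) =
      ∫⁻ s in uIoc 0 c, ENNReal.ofReal (ladderProfile (m + 1) β (L + 1) r s) := by
    refine setLIntegral_congr_fun measurableSet_uIoc fun s hs => ?_
    rw [ladderProfile, ENNReal.ofReal_toReal]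
    exact (planarLadder_lt_top hβ hβ' (L + 1) hr (upperPoint_ne_one hr (hsub hs))).ne
  rw [h2]
  have hint : IntegrableOn (ladderProfile (m + 1) β (L + 1) r) (uIoc 0 c) :=
    (((continuousOn_ladderProfile hβ hβ' (L + 1) hr).mono
      (ordConnected_Ioo.uIcc_subset (by norm_num) hc)).integrableOn_compact isCompact_uIcc).mono_set
      uIoc_subset_uIcc
  exact hint.lintegral_lt_top.ne

/-- The heart of the matter: on each circle, the value of the operator at a preimage of a ladder
function is, up to a polynomial in the cosine of the angle, an iterated primitive of the ladder
function with one more loop. -/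
lemma exists_Hhat_eq (hβ : 0 < β) (hβ' : β < ((m + 1 : ℕ) : ℝ) + 1) (L : ℕ) {g : ℂ → ℂ}
    (hg : IsRdPreimage (m + 1) β (ladderFun (m + 1) β L) g) {r : ℝ} (hr : 0 < r) :
    ∃ P : Polynomial ℂ, P.degree < (m + 1 : ℕ) ∧ ∀ c ∈ Ioo (-1 : ℝ) 1,
      Hhat β (fun w => g w / (‖w‖ : ℂ)) (upperPoint r c) = P.eval (c : ℂ) +
        cauchyInt m (fun s => (((2 * r) ^ (m + 1) * ladderScale (m + 1) β (L + 1) *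
          ladderProfile (m + 1) β (L + 1) r s : ℝ) : ℂ)) c := by
  set κ : ℝ := (2 * r) ^ (m + 1) * ladderScale (m + 1) β (L + 1) with hκ
  set f : ℂ → ℂ := fun w => g w / (‖w‖ : ℂ) with hf
  have hfs : ∀ z, f (starRingEnd ℂ z) = f z := fun z => by
    simp only [hf]; rw [hg.symm, RCLike.norm_conj]
  set μ : Measure ℝ := volume.restrict (Ioi 0) with hμ
  set a : ℝ → ℝ → ℂ := fun ρ c => ((ρ ^ (-(2 * β)) * ρ : ℝ) : ℂ) *
    ∫ θ in (-π)..π, circleIntegrand β f (upperPoint r c) ρ θ with ha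
  set b : ℝ → ℝ → ℂ := fun ρ c => ((κ * (loopDensity (m + 1) β L r ρ c).toReal : ℝ) : ℂ) with hb
  have hab : ∀ᵐ ρ ∂μ, ∃ P : Polynomial ℂ, P.degree < (m + 1 : ℕ) ∧
      ∀ c ∈ Ioo (-1 : ℝ) 1, a ρ c = P.eval (c : ℂ) + cauchyInt m (b ρ) c := by
    have hne : ∀ᵐ ρ ∂μ, ρ ≠ 1 ∧ ρ ≠ r :=
      ae_restrict_of_ae ((Measure.ae_ne volume 1).and (Measure.ae_ne volume r))
    filter_upwards [hne, ae_restrict_mem measurableSet_Ioi] with ρ hρne hρ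
    have hρ0 : (0 : ℝ) < ρ := hρ
    obtain ⟨P, hP, hPg⟩ := exists_preimageChain hβ hβ' L hg.rdPow hρ0
    have hk := isKernelChain_annulusKernel β hr.le hρ0.le hρne.2.symm
    have hb' : ∀ c, b ρ c = ((ρ ^ (-(2 * β)) * ρ : ℝ) : ℂ) *
        shiftChain (annulusKernel β r ρ) (preimageChain m β L P ρ) (m + 1) c := fun c =>
      (shiftChain_eq_loopDensity hβ hβ' L P hr hρ0 hρne.1 c).symm
    have hGl : Continuous (preimageChain m β L P ρ (m + 1)) := by
      have : preimageChain m β L P ρ (m + 1) = fun t => (((2 * ρ) ^ (m + 1) *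
          ladderScale (m + 1) β L * ladderProfile (m + 1) β L ρ t : ℝ) : ℂ) := by
        funext t
        rw [preimageChain, taylorChain, if_neg (by omega)]
      rw [this]
      exact continuous_preimageProfile hβ hβ' L hρ0 hρne.1
    obtain ⟨Q, hQ, h⟩ := exists_polynomial_add_cauchyInt ordConnected_Ioo
      (by norm_num : (0 : ℝ) ∈ Ioo (-1 : ℝ) 1) m
      (e := fun j c => ((ρ ^ (-(2 * β)) * ρ : ℝ) : ℂ) *
        shiftChain (annulusKernel β r ρ) (preimageChain m β L P ρ) j c)
      (fun j hj c hc => (hasDerivAt_shiftChain hk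
        (fun j hj t => hasDerivAt_preimageChain hβ hβ' L hP hρ0 hρne.1 hj t) hGl hj hc).const_mul _)
      (continuous_const.mul (continuous_shiftChain_succ m hk hGl)).continuousOn
    refine ⟨Q, hQ, fun c hc => ?_⟩
    have h0 : a ρ c = ((ρ ^ (-(2 * β)) * ρ : ℝ) : ℂ) *
        shiftChain (annulusKernel β r ρ) (preimageChain m β L P ρ) 0 c := by
      simp only [ha]
      congr 1
      exact integral_circleIntegrand_eq β hfs hr.le hρ0.le hρne.2.symm hPg (arccos c)
    rw [h0, h c hc, show b ρ = _ from funext hb']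
  have hai : ∀ c ∈ Ioo (-1 : ℝ) 1, Integrable (fun ρ => a ρ c) μ := fun c hc =>
    (hg.dom _ (im_upperPoint hr hc).ne').2
  have hbi : ∀ c ∈ Ioo (-1 : ℝ) 1,
      Integrable (Function.uncurry b) (μ.prod (volume.restrict (uIoc 0 c))) := fun c hc =>
    ((integrable_loopDensity hβ hβ' L hr hc).const_mul κ).ofReal
  obtain ⟨P, hP, h⟩ := integral_polynomial_add_cauchyInt m hab hai hbi
  refine ⟨P, hP, fun c hc => ?_⟩
  refine (h c hc).trans ?_
  congr 1
  refine intervalIntegral.integral_congr fun s hs => ?_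
  have hs' : s ∈ Ioo (-1 : ℝ) 1 := ordConnected_Ioo.uIcc_subset (by norm_num) hc hs
  simp only [hb]
  congr 1
  rw [integral_complex_ofReal, integral_const_mul, integral_loopDensity hβ hβ' L hr hs']

/-- The operator sends every preimage of a ladder function to the ladder function with one more
loop. -/
lemma hasRdPow_Hhat (hβ : 0 < β) (hβ' : β < ((m + 1 : ℕ) : ℝ) + 1) (L : ℕ) {g : ℂ → ℂ}
    (hg : IsRdPreimage (m + 1) β (ladderFun (m + 1) β L) g) :
    HasRdPow (m + 1) (fun z => (‖z‖ : ℂ) * Hhat β (fun w => g w / (‖w‖ : ℂ)) z)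
      (ladderFun (m + 1) β (L + 1)) := by
  have hfs : ∀ z, (fun w => g w / (‖w‖ : ℂ)) (starRingEnd ℂ z) = (fun w => g w / (‖w‖ : ℂ)) z :=
    fun z => by simp only; rw [hg.symm, RCLike.norm_conj]
  have hP : ∀ r : ℝ, ∃ P : Polynomial ℂ, P.degree < (m + 1 : ℕ) ∧ (0 < r → ∀ c ∈ Ioo (-1 : ℝ) 1,
      Hhat β (fun w => g w / (‖w‖ : ℂ)) (upperPoint r c) = P.eval (c : ℂ) +
        cauchyInt m (fun s => (((2 * r) ^ (m + 1) * ladderScale (m + 1) β (L + 1) *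
          ladderProfile (m + 1) β (L + 1) r s : ℝ) : ℂ)) c) := by
    intro r
    by_cases hr : 0 < r
    · obtain ⟨P, h1, h2⟩ := exists_Hhat_eq hβ hβ' L hg hr
      exact ⟨P, h1, fun _ => h2⟩
    · exact ⟨0, by rw [Polynomial.degree_zero]; exact WithBot.bot_lt_coe _, fun h => absurd h hr⟩
  choose P hPd hPe using hP
  set F : ℝ → ℝ → ℂ := fun r s => (((2 * r) ^ (m + 1) * ladderScale (m + 1) β (L + 1) *
          ladderProfile (m + 1) β (L + 1) r s : ℝ) : ℂ) with hF
  have hFc : ∀ r > 0, ContinuousOn (F r) (Ioo (-1) 1) := fun r hr =>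
    Complex.continuous_ofReal.comp_continuousOn
      (continuousOn_const.mul (continuousOn_ladderProfile hβ hβ' (L + 1) hr))
  refine hasRdPow_of_chain (m + 1)
    (e := fun j r c => r * taylorChain m (P r) (F r) j c / (2 * r) ^ j) ?_ ?_ ?_
  · intro r hr j hj c hc
    have hr' : (r : ℂ) ≠ 0 := by exact_mod_cast hr.ne'
    refine (((hasDerivAt_taylorChain isOpen_Ioo ordConnected_Ioo (by norm_num) (hPd r) (hFc r hr) hj
      hc).const_mul (r : ℂ)).div_const _).congr_deriv ?_
    rw [pow_succ]
    field_simp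
  · intro z hz
    have hz0 : 0 < ‖z‖ := norm_pos_iff.2 fun h => hz (by simp [h])
    have hc := re_div_norm_mem_Ioo hz
    refine (eq_comp_upperPoint (h := fun z => (‖z‖ : ℂ) * Hhat β (fun w => g w / (‖w‖ : ℂ)) z)
      (fun z => by rw [Hhat_conj β hfs, RCLike.norm_conj]) hz).trans ?_
    rw [hPe _ hz0 _ hc, norm_upperPoint hz0.le, taylorChain, if_pos (Nat.zero_le m)]
    simp [hF]
  · intro z hz
    have hz0 : 0 < ‖z‖ := norm_pos_iff.2 fun h => hz (by simp [h])
    have hz' : (‖z‖ : ℂ) ≠ 0 := by exact_mod_cast hz0.ne'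
    rw [eq_comp_upperPoint (ladderFun_conj (L + 1)) hz, ladderFun_upperPoint _ hz0.le, taylorChain,
      if_neg (by omega)]
    simp only [hF]
    push_cast
    field_simp

end

/-! ### Removal of the low Fourier modes -/

/-- The Fourier coefficient of `f (cos θ)` with respect to `cos (n θ)`, without normalization. -/
noncomputable def cosMode (f : ℝ → ℂ) (n : ℕ) : ℂ :=
  ∫ θ in (-π)..π, ((cos (n * θ) : ℝ) : ℂ) * f (cos θ)

/-- The integral of the square of `cos (n θ)`. -/
noncomputable def cosNorm (n : ℕ) : ℝ := if n = 0 then 2 * π else π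

lemma pi_le_cosNorm (n : ℕ) : π ≤ cosNorm n := by
  unfold cosNorm; split_ifs <;> linarith [pi_pos]

lemma integral_cos_int_mul (j : ℤ) :
    ∫ θ in (-π)..π, cos (j * θ) = if j = 0 then 2 * π else 0 := by
  split_ifs with h
  · simp [h]; ring
  · have hj : (j : ℝ) ≠ 0 := by exact_mod_cast h
    rw [intervalIntegral.integral_comp_mul_left _ hj, integral_cos]
    simp [sin_int_mul_pi]

lemma integral_cos_mul_cos (n k : ℕ) :
    ∫ θ in (-π)..π, cos (n * θ) * cos (k * θ) = if n = k then cosNorm n else 0 := by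
  have h : ∀ θ : ℝ, cos (n * θ) * cos (k * θ) =
      (1 / 2) * (cos (((n - k : ℤ) : ℝ) * θ) + cos (((n + k : ℤ) : ℝ) * θ)) := by
    intro θ
    push_cast
    rw [sub_mul, add_mul, cos_sub, cos_add]; ring
  simp_rw [h]
  rw [intervalIntegral.integral_const_mul, intervalIntegral.integral_add
    (Continuous.intervalIntegrable (by fun_prop) _ _)
    (Continuous.intervalIntegrable (by fun_prop) _ _), integral_cos_int_mul, integral_cos_int_mul]
  unfold cosNorm
  by_cases hnk : n = k
  · subst hnk
    by_cases h0 : n = 0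
    · subst h0; simp; ring
    · have : (n : ℤ) + n ≠ 0 := by omega
      simp [h0, this]
  · have h1 : (n : ℤ) - k ≠ 0 := by omega
    have h2 : (n : ℤ) + k ≠ 0 := by omega
    simp [hnk, h1, h2]

lemma eval_chebyshev_cos (n : ℕ) (θ : ℝ) :
    (Polynomial.Chebyshev.T ℂ n).eval ((cos θ : ℝ) : ℂ) = ((cos (n * θ) : ℝ) : ℂ) := by
  rw [Complex.ofReal_cos, Polynomial.Chebyshev.T_complex_cos]
  push_cast
  rfl

/-- The part of degree at most `m` of the Chebyshev expansion of `f`. -/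
noncomputable def chebyshevPart (m : ℕ) (f : ℝ → ℂ) : Polynomial ℂ :=
  ∑ n ∈ Finset.range (m + 1),
    Polynomial.C (cosMode f n / cosNorm n) * Polynomial.Chebyshev.T ℂ n

lemma degree_chebyshevPart (m : ℕ) (f : ℝ → ℂ) : (chebyshevPart m f).degree < (m + 1 : ℕ) := by
  refine (Polynomial.degree_sum_le _ _).trans_lt ((Finset.sup_lt_iff (WithBot.bot_lt_coe _)).2 ?_)
  intro n hn
  rw [← Polynomial.smul_eq_C_mul]
  refine (Polynomial.degree_smul_le _ _).trans_lt ?_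
  rw [Polynomial.Chebyshev.degree_T]
  exact_mod_cast Finset.mem_range.1 hn

lemma eval_chebyshevPart_cos (m : ℕ) (f : ℝ → ℂ) (θ : ℝ) :
    (chebyshevPart m f).eval ((cos θ : ℝ) : ℂ) =
      ∑ n ∈ Finset.range (m + 1), cosMode f n / cosNorm n * ((cos (n * θ) : ℝ) : ℂ) := by
  simp only [chebyshevPart, Polynomial.eval_finsetSum, Polynomial.eval_mul, Polynomial.eval_C,
    eval_chebyshev_cos]

lemma cosMode_sub_chebyshevPart {m n : ℕ} (hn : n ≤ m) {f : ℝ → ℂ}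
    (hf : Continuous fun θ => f (cos θ)) :
    cosMode (fun t => f t - (chebyshevPart m f).eval (t : ℂ)) n = 0 := by
  have h1 : cosMode (fun t => f t - (chebyshevPart m f).eval (t : ℂ)) n = cosMode f n -
      ∑ k ∈ Finset.range (m + 1), ∫ θ in (-π)..π,
        cosMode f k / cosNorm k * ((cos (n * θ) * cos (k * θ) : ℝ) : ℂ) := by
    rw [← intervalIntegral.integral_finsetSum
      (fun k _ => Continuous.intervalIntegrable (by fun_prop) _ _), cosMode, cosMode,
      ← intervalIntegral.integral_sub]
    · refine intervalIntegral.integral_congr fun θ _ => ?_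
      rw [eval_chebyshevPart_cos, mul_sub, Finset.mul_sum]
      congr 1
      refine Finset.sum_congr rfl fun k _ => ?_
      push_cast; ring
    · exact Continuous.intervalIntegrable
        ((Complex.continuous_ofReal.comp (by fun_prop)).mul hf) _ _
    · exact Continuous.intervalIntegrable (by fun_prop) _ _
  rw [h1, Finset.sum_eq_single n]
  · rw [intervalIntegral.integral_const_mul, intervalIntegral.integral_ofReal,
      integral_cos_mul_cos, if_pos rfl, div_mul_cancel₀, sub_self]
    have := (pi_pos.trans_le (pi_le_cosNorm n)).ne'
    exact_mod_cast this
  · intro k _ hk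
    rw [intervalIntegral.integral_const_mul, intervalIntegral.integral_ofReal,
      integral_cos_mul_cos, if_neg hk.symm]
    simp
  · intro h
    exact absurd (Finset.mem_range.2 (by omega)) h

lemma norm_cosMode_le {f : ℝ → ℂ} {B : ℝ} (hB : ∀ θ, ‖f (cos θ)‖ ≤ B) (n : ℕ) :
    ‖cosMode f n‖ ≤ 2 * π * B := by
  have h := intervalIntegral.norm_integral_le_of_norm_le_const (a := -π) (b := π) (C := B)
    (f := fun θ => ((cos (n * θ) : ℝ) : ℂ) * f (cos θ)) (fun θ _ => by
      rw [norm_mul, Complex.norm_real]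
      have := mul_le_mul (abs_cos_le_one (n * θ)) (hB θ) (norm_nonneg _) zero_le_one
      simpa using this)
  rw [sub_neg_eq_add, abs_of_pos (by linarith [pi_pos])] at h
  calc _ ≤ _ := h
    _ = _ := by ring

lemma norm_eval_chebyshevPart_le (m : ℕ) {f : ℝ → ℂ} {B : ℝ} (hB : ∀ θ, ‖f (cos θ)‖ ≤ B) (θ : ℝ) :
    ‖(chebyshevPart m f).eval ((cos θ : ℝ) : ℂ)‖ ≤ (m + 1) * (2 * B) := by
  rw [eval_chebyshevPart_cos]
  refine (norm_sum_le_of_le (f := fun n : ℕ => cosMode f n / cosNorm n * ((cos (n * θ) : ℝ) : ℂ))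
    (n := fun _ => 2 * B) _ fun n _ => ?_).trans ?_
  · have hB0 : 0 ≤ B := (norm_nonneg _).trans (hB 0)
    have hp := pi_le_cosNorm n
    have hp0 := pi_pos
    rw [norm_mul, norm_div, Complex.norm_real, Complex.norm_real, norm_of_nonneg (by linarith)]
    calc ‖cosMode f n‖ / cosNorm n * ‖cos (n * θ)‖ ≤ 2 * π * B / π * 1 := by
          gcongr
          · exact norm_cosMode_le hB n
          · exact abs_cos_le_one _
      _ = 2 * B := by field_simp
  · simp

/-- The Chebyshev polynomials of degree at most `m` span the polynomials of degree at most `m`, and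
`cos (k (φ - θ))` is a combination of `cos (k θ)` and `sin (k θ)`; so a function whose low modes
vanish is orthogonal to every polynomial of low degree in `cos (φ - θ)`. -/
lemma integral_eval_mul_eq_zero {m : ℕ} {G : ℝ → ℂ} (hG : Continuous fun θ => G (cos θ))
    (hmode : ∀ n ≤ m, cosMode G n = 0) (φ : ℝ) :
    ∀ k ≤ m + 1, ∀ P : Polynomial ℂ, P.degree < (k : ℕ) →
      ∫ θ in (-π)..π, P.eval ((cos (φ - θ) : ℝ) : ℂ) * G (cos θ) = 0 := by
  intro k
  induction k with
  | zero =>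
    intro _ P hP
    have : P = 0 := by
      rw [← Polynomial.degree_eq_bot]
      exact Nat.WithBot.lt_zero_iff.1 (by exact_mod_cast hP)
    simp [this]
  | succ k ih =>
    intro hk P hP
    set T := Polynomial.Chebyshev.T ℂ k with hT
    have hTd : T.degree = (k : ℕ) := by rw [hT, Polynomial.Chebyshev.degree_T]; rfl
    have hTl : T.leadingCoeff ≠ 0 := Polynomial.leadingCoeff_ne_zero.2 fun h => by
      rw [h, Polynomial.degree_zero] at hTd; exact absurd hTd (by simp)
    -- the multiple of the Chebyshev polynomial that lowers the degree
    set a : ℂ := P.coeff k / T.leadingCoeff with ha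
    have hd : (P - Polynomial.C a * T).degree < (k : ℕ) := by
      rw [Polynomial.degree_lt_iff_coeff_zero]
      intro i hi
      rcases hi.eq_or_lt with rfl | hi
      · rw [Polynomial.coeff_sub, Polynomial.coeff_C_mul]
        have : T.coeff k = T.leadingCoeff := by
          rw [Polynomial.leadingCoeff, Polynomial.natDegree_eq_of_degree_eq_some hTd]
        rw [this, ha, div_mul_cancel₀ _ hTl, sub_self]
      · rw [Polynomial.coeff_sub, Polynomial.coeff_C_mul,
          Polynomial.coeff_eq_zero_of_degree_lt (hP.trans_le (by exact_mod_cast hi)),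
          Polynomial.coeff_eq_zero_of_degree_lt (hTd.trans_lt (by exact_mod_cast hi))]
        simp
    have h1 := ih (by omega) _ hd
    have hTi : ∫ θ in (-π)..π, T.eval ((cos (φ - θ) : ℝ) : ℂ) * G (cos θ) = 0 := by
      have e : ∀ θ : ℝ, T.eval ((cos (φ - θ) : ℝ) : ℂ) * G (cos θ) =
          (cos (k * φ) : ℂ) * (((cos (k * θ) : ℝ) : ℂ) * G (cos θ)) +
          (sin (k * φ) : ℂ) * (((sin (k * θ) : ℝ) : ℂ) * G (cos θ)) := by
        intro θ
        rw [hT, eval_chebyshev_cos, mul_sub, cos_sub]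
        push_cast; ring
      -- the sine part vanishes by parity
      have hodd : ∫ θ in (-π)..π, ((sin (k * θ) : ℝ) : ℂ) * G (cos θ) = 0 := by
        have h2 := intervalIntegral.integral_comp_neg (a := -π) (b := π)
          (fun θ => ((sin (k * θ) : ℝ) : ℂ) * G (cos θ))
        rw [neg_neg] at h2
        simp only [mul_neg, sin_neg, cos_neg, Complex.ofReal_neg, neg_mul,
          intervalIntegral.integral_neg] at h2
        have := neg_eq_self.1 h2
        exact this
      simp_rw [e]
      rw [intervalIntegral.integral_add, intervalIntegral.integral_const_mul,
        intervalIntegral.integral_const_mul, hodd]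
      · have := hmode k (by omega)
        rw [cosMode] at this
        rw [this]; simp
      · exact Continuous.intervalIntegrable (continuous_const.mul
          ((Complex.continuous_ofReal.comp (by fun_prop)).mul hG)) _ _
      · exact Continuous.intervalIntegrable (continuous_const.mul
          ((Complex.continuous_ofReal.comp (by fun_prop)).mul hG)) _ _
    have e2 : ∀ θ : ℝ, P.eval ((cos (φ - θ) : ℝ) : ℂ) * G (cos θ) =
        (P - Polynomial.C a * T).eval ((cos (φ - θ) : ℝ) : ℂ) * G (cos θ) +
          a * (T.eval ((cos (φ - θ) : ℝ) : ℂ) * G (cos θ)) := by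
      intro θ
      rw [Polynomial.eval_sub, Polynomial.eval_mul, Polynomial.eval_C]; ring
    simp_rw [e2]
    rw [intervalIntegral.integral_add, h1, intervalIntegral.integral_const_mul, hTi]
    · simp
    · exact Continuous.intervalIntegrable (Continuous.mul (by fun_prop) hG) _ _
    · exact Continuous.intervalIntegrable (continuous_const.mul
        (Continuous.mul (by fun_prop) hG)) _ _

lemma norm_cauchyInt_le_of_uIcc (m : ℕ) {f : ℝ → ℂ} {M c : ℝ} (hc : |c| ≤ 1)
    (hM : ∀ t ∈ uIcc 0 c, ‖f t‖ ≤ M) : ‖cauchyInt m f c‖ ≤ M := by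
  have hM0 : 0 ≤ M := (norm_nonneg _).trans (hM 0 left_mem_uIcc)
  have h := intervalIntegral.norm_integral_le_of_norm_le_const (a := 0) (b := c) (C := M)
    (f := fun s => (((c - s) ^ m / m.factorial : ℝ) : ℂ) * f s) (fun s hs => by
      have hs' : |c - s| ≤ |c| := by
        have := abs_sub_right_of_mem_uIcc (uIoc_subset_uIcc hs)
        rwa [sub_zero] at this
      have h1 : |(c - s) ^ m / m.factorial| ≤ 1 := by
        rw [abs_div, abs_pow, Nat.abs_cast]
        have : (1 : ℝ) ≤ m.factorial := by exact_mod_cast Nat.one_le_iff_ne_zero.2 m.factorial_ne_zero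
        rw [div_le_one (by linarith)]
        exact (pow_le_one₀ (abs_nonneg _) (hs'.trans hc)).trans this
      rw [norm_mul, Complex.norm_real, Real.norm_eq_abs]
      have := mul_le_mul h1 (hM s (uIoc_subset_uIcc hs)) (norm_nonneg _) zero_le_one
      rwa [one_mul] at this)
  rw [sub_zero] at h
  exact h.trans (mul_le_of_le_one_right hM0 hc)

lemma norm_cauchyInt_le (m : ℕ) {f : ℝ → ℂ} {M c : ℝ} (hc : |c| ≤ 1)
    (hM : ∀ t, |t| ≤ 1 → ‖f t‖ ≤ M) : ‖cauchyInt m f c‖ ≤ M :=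
  norm_cauchyInt_le_of_uIcc m hc fun t ht => hM t <| by
    have := abs_sub_left_of_mem_uIcc ht
    rw [sub_zero, sub_zero] at this
    exact this.trans hc

/-- A function without low Fourier modes sees only the Taylor remainder of the kernel. -/
lemma norm_circleConv_le {k : ℕ → ℝ → ℝ} (hk : IsKernelChain k) {m : ℕ} {M : ℝ}
    (hM : ∀ t, |t| ≤ 1 → |k (m + 1) t| ≤ M) {G : ℝ → ℂ} (hG : Continuous fun θ => G (cos θ))
    (hmode : ∀ n ≤ m, cosMode G n = 0) {B : ℝ} (hB : ∀ θ, ‖G (cos θ)‖ ≤ B) (φ : ℝ) :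
    ‖circleConv (k 0) G φ‖ ≤ 2 * π * (M * B) := by
  have hS : ∀ t ∈ Icc (-1 : ℝ) 1, |t| ≤ 1 := fun t ht => abs_le.2 ht
  obtain ⟨P, hP, h⟩ := exists_polynomial_add_cauchyInt (S := Icc (-1 : ℝ) 1) ordConnected_Icc
    (by norm_num) m (e := fun j t => (k j t : ℂ))
    (fun j _ t ht => (hk j t (hS t ht)).ofReal_comp)
    (fun t ht => (hk (m + 1) t (hS t ht)).ofReal_comp.continuousAt.continuousWithinAt)
  have hkc : Continuous fun θ => ((k 0 (cos (φ - θ)) : ℝ) : ℂ) * G (cos θ) :=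
    (Complex.continuous_ofReal.comp (hk.continuous_comp 0 (by fun_prop)
      fun θ => abs_cos_le_one _)).mul hG
  have hPc : Continuous fun θ => P.eval ((cos (φ - θ) : ℝ) : ℂ) * G (cos θ) :=
    Continuous.mul (by fun_prop) hG
  have h1 : circleConv (k 0) G φ = ∫ θ in (-π)..π,
      (((k 0 (cos (φ - θ)) : ℝ) : ℂ) * G (cos θ) - P.eval ((cos (φ - θ) : ℝ) : ℂ) * G (cos θ)) := by
    rw [intervalIntegral.integral_sub (hkc.intervalIntegrable _ _) (hPc.intervalIntegrable _ _),
      integral_eval_mul_eq_zero hG hmode φ (m + 1) le_rfl P hP, sub_zero, circleConv]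
  have hM0 : 0 ≤ M := (abs_nonneg _).trans (hM 0 (by simp))
  rw [h1]
  have h2 := intervalIntegral.norm_integral_le_of_norm_le_const (a := -π) (b := π) (C := M * B)
    (f := fun θ => ((k 0 (cos (φ - θ)) : ℝ) : ℂ) * G (cos θ) -
      P.eval ((cos (φ - θ) : ℝ) : ℂ) * G (cos θ)) (fun θ _ => by
      have hc := abs_cos_le_one (φ - θ)
      rw [← sub_mul, h _ (abs_le.1 hc), add_sub_cancel_left, norm_mul]
      exact mul_le_mul (norm_cauchyInt_le m hc fun t ht => by
        rw [Complex.norm_real]; exact hM t ht) (hB θ) (norm_nonneg _) hM0)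
  rw [sub_neg_eq_add, abs_of_pos (by linarith [pi_pos])] at h2
  exact h2.trans_eq (by ring)

/-! ### Sizes of the ladder and of the planar kernel -/

section
variable {l : ℕ} {β : ℝ}

lemma one_add_sq_sub_ge {ρ c : ℝ} (hρ : 0 ≤ ρ) (hc : |c| ≤ 1) :
    (1 - ρ) ^ 2 ≤ 1 + ρ ^ 2 - 2 * ρ * c := by
  nlinarith [mul_le_mul_of_nonneg_left (abs_le.1 hc).2 hρ]

lemma one_add_sq_sub_pos {ρ c : ℝ} (hρ : 0 ≤ ρ) (h1 : ρ ≠ 1) (hc : |c| ≤ 1) :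
    0 < 1 + ρ ^ 2 - 2 * ρ * c :=
  (sq_pos_of_ne_zero (sub_ne_zero.2 h1.symm)).trans_le (one_add_sq_sub_ge hρ hc)

/-- The bound of `exists_ladderChain_le` on a circle, where `|z - 1|² = 1 + ρ² - 2 ρ c`. -/
lemma exists_ladderProfile_le (hβ : 0 < β) (hβ' : β < (l : ℝ) + 1) (L : ℕ) :
    ∃ C : ℝ, 0 ≤ C ∧ ∀ ρ : ℝ, 0 < ρ → ρ ≠ 1 → ∀ c : ℝ, |c| ≤ 1 →
      ladderProfile l β L ρ c ≤ C * (ρ ^ (-((l : ℝ) + 1 - β)) +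
        (1 + ρ ^ 2 - 2 * ρ * c) ^ (-((l : ℝ) + 1 - β))) := by
  obtain ⟨C, hC, h⟩ := exists_ladderChain_le hβ hβ' L (l := l)
  refine ⟨C, hC, fun ρ hρ h1 c hc => ?_⟩
  have hb := h (emb l (upperPoint ρ c)) (emb_ne_zero (polar_ne_zero hρ _))
    (emb_ne_one (polar_ne_one hρ h1 _))
  refine (ENNReal.toReal_mono ENNReal.ofReal_ne_top hb).trans_eq ?_
  have hd : ‖upperPoint ρ c - 1‖ ^ 2 = 1 + ρ ^ 2 - 2 * ρ * c := by
    have := norm_polar_sub_sq ρ 1 (arccos c) 0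
    rw [sub_zero, cos_arccos (abs_le.1 hc).1 (abs_le.1 hc).2] at this
    rw [upperPoint]
    simp only [Complex.ofReal_one, Complex.ofReal_zero, zero_mul, Complex.exp_zero, mul_one] at this
    rw [this]; ring
  rw [ENNReal.toReal_ofReal (mul_nonneg hC (ladderBound_nonneg _)), ladderBound, emb_sub, norm_emb,
    norm_emb, norm_upperPoint hρ.le, ← hd, ← rpow_natCast, ← rpow_mul (norm_nonneg _)]
  push_cast
  ring_nf

/-- Away from the unit circle the ladder is of the size of a power of the radius. -/
lemma exists_ladderProfile_le_rpow (hβ : 0 < β) (hβ' : β < (l : ℝ) + 1) (L : ℕ) :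
    ∃ C : ℝ, 0 ≤ C ∧ ∀ ρ : ℝ, 0 < ρ → ρ ∉ Icc (1 / 2 : ℝ) 2 → ∀ c : ℝ, |c| ≤ 1 →
      ladderProfile l β L ρ c ≤ C * ρ ^ (-((l : ℝ) + 1 - β)) := by
  obtain ⟨C, hC, h⟩ := exists_ladderProfile_le hβ hβ' L (l := l)
  set γ : ℝ := (l : ℝ) + 1 - β with hγ
  have hγ0 : 0 < γ := by linarith
  refine ⟨C * (1 + 4 ^ γ), by positivity, fun ρ hρ hn c hc => ?_⟩
  have h1 : ρ ≠ 1 := fun h => hn (by rw [h]; norm_num)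
  refine (h ρ hρ h1 c hc).trans ?_
  have hq : ρ / 4 ≤ 1 + ρ ^ 2 - 2 * ρ * c := by
    refine le_trans ?_ (one_add_sq_sub_ge hρ.le hc)
    rw [mem_Icc, not_and_or, not_le, not_le] at hn
    rcases hn with hn | hn <;> nlinarith
  have h2 : (1 + ρ ^ 2 - 2 * ρ * c) ^ (-γ) ≤ 4 ^ γ * ρ ^ (-γ) := by
    calc (1 + ρ ^ 2 - 2 * ρ * c) ^ (-γ) ≤ (ρ / 4) ^ (-γ) :=
          rpow_le_rpow_of_nonpos (by positivity) hq (by linarith)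
      _ = 4 ^ γ * ρ ^ (-γ) := by
          rw [div_rpow hρ.le (by norm_num), rpow_neg (by norm_num : (0 : ℝ) ≤ 4), div_inv_eq_mul,
            mul_comm]
  calc _ ≤ C * (ρ ^ (-γ) + 4 ^ γ * ρ ^ (-γ)) :=
        mul_le_mul_of_nonneg_left (add_le_add le_rfl h2) hC
    _ = _ := by ring

/-- A bound for the planar kernel by a weaker power, which covers the logarithms. -/
lemma exists_planeKernel_le (β : ℝ) {τ : ℝ} (hτ : 1 - β < τ) {R : ℝ} (hR : 0 < R) :
    ∃ C : ℝ, 0 ≤ C ∧ ∀ t : ℝ, 0 < t → t ≤ R → |planeKernel β t| ≤ C * t ^ (-(2 * τ)) := by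
  set ε : ℝ := 2 * (τ - (1 - β)) with hε
  have hε0 : 0 < ε := by rw [hε]; linarith
  have e : ∀ t : ℝ, 0 < t → t ^ (2 * β - 2) = t ^ (-(2 * τ)) * t ^ ε := fun t ht => by
    rw [← rpow_add ht]; congr 1; rw [hε]; ring
  unfold planeKernel
  split_ifs with h
  · set D : ℝ := (-1) ^ ⌊β⌋₊ * 2 / ((4 : ℝ) ^ β * Real.pi * Real.Gamma β ^ 2)
    refine ⟨|D| * ((R ^ (2 * ε) + 1) / ε), by positivity, fun t ht htR => ?_⟩
    have h1 : t ^ ε * |log t| ≤ (R ^ (2 * ε) + 1) / ε := by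
      have hlog : |log t| ≤ (t ^ ε + t ^ (-ε)) / ε := by
        have p1 := log_le_rpow_div ht.le hε0
        have p2 := log_le_rpow_div (inv_nonneg.2 ht.le) hε0
        rw [log_inv, inv_rpow ht.le, ← rpow_neg ht.le] at p2
        have q1 : 0 ≤ t ^ ε / ε := by positivity
        have q2 : 0 ≤ t ^ (-ε) / ε := by positivity
        rw [abs_le, add_div]
        constructor <;> linarith
      calc t ^ ε * |log t| ≤ t ^ ε * ((t ^ ε + t ^ (-ε)) / ε) := by gcongr
        _ = (t ^ (2 * ε) + 1) / ε := by
          have : t ^ ε * t ^ (-ε) = 1 := by rw [← rpow_add ht]; simp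
          have h2 : t ^ ε * t ^ ε = t ^ (2 * ε) := by rw [← rpow_add ht]; congr 1; ring
          rw [← mul_div_assoc, mul_add, this, h2]
        _ ≤ _ := by gcongr
    rw [e t ht, abs_mul, abs_mul, abs_mul, abs_of_pos (by positivity : 0 < t ^ (-(2 * τ))),
      abs_of_pos (by positivity : 0 < t ^ ε)]
    calc |D| * (t ^ (-(2 * τ)) * t ^ ε * |log t|) = |D| * (t ^ ε * |log t|) * t ^ (-(2 * τ)) := by
          ring
      _ ≤ _ := by gcongr
  · refine ⟨|propConst 1 β| * R ^ ε, by positivity, fun t ht htR => ?_⟩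
    rw [e t ht, abs_mul, abs_mul, abs_of_pos (by positivity : 0 < t ^ (-(2 * τ))),
      abs_of_pos (by positivity : 0 < t ^ ε)]
    calc |propConst 1 β| * (t ^ (-(2 * τ)) * t ^ ε) =
          |propConst 1 β| * t ^ ε * t ^ (-(2 * τ)) := by ring
      _ ≤ _ := by gcongr

/-! ### A preimage of the ladder function -/

/-- The polynomial that is added to the iterated primitive of the ladder function on the circle of
radius `ρ`. It removes the low Chebyshev modes, except close to the unit circle, where no decay is
needed and the plain primitive is easier to bound. -/
noncomputable def canonicalPoly (m : ℕ) (β : ℝ) (L : ℕ) (ρ : ℝ) : Polynomial ℂ :=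
  if ρ ∈ Icc (1 / 2 : ℝ) 2 then 0 else -chebyshevPart m (preimageChain m β L 0 ρ 0)

lemma degree_canonicalPoly (m : ℕ) (β : ℝ) (L : ℕ) (ρ : ℝ) :
    (canonicalPoly m β L ρ).degree < (m + 1 : ℕ) := by
  unfold canonicalPoly
  split_ifs
  · rw [Polynomial.degree_zero]; exact WithBot.bot_lt_coe _
  · rw [Polynomial.degree_neg]; exact degree_chebyshevPart m _

/-- The quotient of `canonicalPreimage` by the norm, on the circle of radius `ρ`. -/
noncomputable def canonicalProfile (m : ℕ) (β : ℝ) (L : ℕ) (ρ t : ℝ) : ℂ :=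
  preimageChain m β L (canonicalPoly m β L ρ) ρ 0 t

/-- A preimage of the ladder function under the `(m + 1)`-st power of `R_d`: on each circle, an
iterated primitive with respect to the cosine of the angle. -/
noncomputable def canonicalPreimage (m : ℕ) (β : ℝ) (L : ℕ) (z : ℂ) : ℂ :=
  ‖z‖ * canonicalProfile m β L ‖z‖ (z.re / ‖z‖)

lemma canonicalPreimage_conj (m : ℕ) (β : ℝ) (L : ℕ) (z : ℂ) :
    canonicalPreimage m β L (starRingEnd ℂ z) = canonicalPreimage m β L z := by
  rw [canonicalPreimage, canonicalPreimage, RCLike.norm_conj, Complex.conj_re]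

lemma canonicalPreimage_polar (m : ℕ) (β : ℝ) (L : ℕ) {ρ : ℝ} (hρ : 0 < ρ) (θ : ℝ) :
    canonicalPreimage m β L (ρ * Complex.exp (θ * Complex.I)) /
      (‖(ρ : ℂ) * Complex.exp (θ * Complex.I)‖ : ℂ) = canonicalProfile m β L ρ (cos θ) := by
  have hρ' : (ρ : ℂ) ≠ 0 := by exact_mod_cast hρ.ne'
  rw [canonicalPreimage, norm_polar hρ.le, Complex.re_ofReal_mul, Complex.exp_ofReal_mul_I_re,
    mul_div_cancel_left₀ _ hρ.ne', mul_div_cancel_left₀ _ hρ']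

lemma hasRdPow_canonicalPreimage {m : ℕ} (hβ : 0 < β) (hβ' : β < ((m + 1 : ℕ) : ℝ) + 1) (L : ℕ) :
    HasRdPow (m + 1) (canonicalPreimage m β L) (ladderFun (m + 1) β L) := by
  refine hasRdPow_of_chain (m + 1)
    (e := fun j r c => r * preimageChain m β L (canonicalPoly m β L r) r j c / (2 * r) ^ j) ?_ ?_ ?_
  · intro r hr j hj c hc
    have hr' : (r : ℂ) ≠ 0 := by exact_mod_cast hr.ne'
    have hF : ContinuousOn (fun t => (((2 * r) ^ (m + 1) * ladderScale (m + 1) β L *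
        ladderProfile (m + 1) β L r t : ℝ) : ℂ)) (Ioo (-1) 1) :=
      Complex.continuous_ofReal.comp_continuousOn
        (continuousOn_const.mul (continuousOn_ladderProfile hβ hβ' L hr))
    refine (((hasDerivAt_taylorChain isOpen_Ioo ordConnected_Ioo (by norm_num)
      (degree_canonicalPoly m β L r) hF hj hc).const_mul (r : ℂ)).div_const _).congr_deriv ?_
    simp only [preimageChain]
    generalize taylorChain m _ _ (j + 1) c = T
    rw [pow_succ]
    field_simp
  · intro z hz
    simp [canonicalPreimage, canonicalProfile]
  · intro z hz
    have hz0 : 0 < ‖z‖ := norm_pos_iff.2 fun h => hz (by simp [h])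
    have hz' : (‖z‖ : ℂ) ≠ 0 := by exact_mod_cast hz0.ne'
    rw [eq_comp_upperPoint (ladderFun_conj L) hz, ladderFun_upperPoint _ hz0.le, preimageChain,
      taylorChain, if_neg (by omega)]
    push_cast
    field_simp

lemma preimageChain_zero_eq (m : ℕ) (β : ℝ) (L : ℕ) (P : Polynomial ℂ) (ρ t : ℝ) :
    preimageChain m β L P ρ 0 t = P.eval (t : ℂ) + preimageChain m β L 0 ρ 0 t := by
  simp [preimageChain, taylorChain]

lemma continuous_preimageChain_zero {m : ℕ} (hβ : 0 < β) (hβ' : β < ((m + 1 : ℕ) : ℝ) + 1) (L : ℕ)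
    {P : Polynomial ℂ} (hP : P.degree < (m + 1 : ℕ)) {ρ : ℝ} (hρ : 0 < ρ) (h1 : ρ ≠ 1) :
    Continuous (preimageChain m β L P ρ 0) :=
  continuous_iff_continuousAt.2 fun t =>
    (hasDerivAt_preimageChain hβ hβ' L hP hρ h1 (Nat.succ_pos m) t).continuousAt

lemma continuous_canonicalProfile {m : ℕ} (hβ : 0 < β) (hβ' : β < ((m + 1 : ℕ) : ℝ) + 1) (L : ℕ)
    {ρ : ℝ} (hρ : 0 < ρ) (h1 : ρ ≠ 1) : Continuous (canonicalProfile m β L ρ) :=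
  continuous_preimageChain_zero hβ hβ' L (degree_canonicalPoly m β L ρ) hρ h1

lemma cosMode_canonicalProfile {m : ℕ} (hβ : 0 < β) (hβ' : β < ((m + 1 : ℕ) : ℝ) + 1) (L : ℕ)
    {ρ : ℝ} (hρ : 0 < ρ) (hn : ρ ∉ Icc (1 / 2 : ℝ) 2) {n : ℕ} (hnm : n ≤ m) :
    cosMode (canonicalProfile m β L ρ) n = 0 := by
  have h1 : ρ ≠ 1 := fun h => hn (by rw [h]; norm_num)
  have h0 : Continuous (preimageChain m β L 0 ρ 0) :=
    continuous_preimageChain_zero hβ hβ' L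
      (by rw [Polynomial.degree_zero]; exact WithBot.bot_lt_coe _) hρ h1
  rw [← cosMode_sub_chebyshevPart hnm (h0.comp continuous_cos)]
  congr 1
  funext t
  rw [canonicalProfile, preimageChain_zero_eq, canonicalPoly, if_neg hn, Polynomial.eval_neg]
  ring

/-- The size of the preimage away from the unit circle. -/
lemma exists_canonicalProfile_le_rpow {m : ℕ} (hβ : 0 < β) (hβ' : β < ((m + 1 : ℕ) : ℝ) + 1)
    (L : ℕ) : ∃ C : ℝ, 0 ≤ C ∧ ∀ ρ : ℝ, 0 < ρ → ρ ∉ Icc (1 / 2 : ℝ) 2 → ∀ θ : ℝ,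
      ‖canonicalProfile m β L ρ (cos θ)‖ ≤
        C * (ρ ^ (m + 1) * ρ ^ (-(((m + 1 : ℕ) : ℝ) + 1 - β))) := by
  obtain ⟨C, hC, h⟩ := exists_ladderProfile_le_rpow hβ hβ' L
  set γ : ℝ := ((m + 1 : ℕ) : ℝ) + 1 - β with hγ
  set A := |ladderScale (m + 1) β L| with hA
  refine ⟨(2 * (m + 1) + 1) * (2 ^ (m + 1) * A * C), by positivity, fun ρ hρ hn θ => ?_⟩
  have h0 : ∀ θ, ‖preimageChain m β L 0 ρ 0 (cos θ)‖ ≤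
      2 ^ (m + 1) * A * C * (ρ ^ (m + 1) * ρ ^ (-γ)) := by
    intro θ
    have e : preimageChain m β L 0 ρ 0 (cos θ) = cauchyInt m (fun t => (((2 * ρ) ^ (m + 1) *
        ladderScale (m + 1) β L * ladderProfile (m + 1) β L ρ t : ℝ) : ℂ)) (cos θ) := by
      simp [preimageChain, taylorChain]
    rw [e]
    refine norm_cauchyInt_le m (abs_cos_le_one θ) fun t ht => ?_
    have hp := ladderProfile_nonneg (l := m + 1) (β := β) L ρ t
    rw [Complex.norm_real, Real.norm_eq_abs, abs_mul, abs_mul, abs_of_nonneg hp,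
      abs_of_pos (by positivity : 0 < (2 * ρ) ^ (m + 1)), mul_pow]
    calc 2 ^ (m + 1) * ρ ^ (m + 1) * |ladderScale (m + 1) β L| * ladderProfile (m + 1) β L ρ t ≤
          2 ^ (m + 1) * ρ ^ (m + 1) * A * (C * ρ ^ (-γ)) := by
            rw [← hA]; gcongr; exact h ρ hρ hn t ht
      _ = _ := by ring
  rw [canonicalProfile, preimageChain_zero_eq, canonicalPoly, if_neg hn, Polynomial.eval_neg]
  refine (norm_add_le _ _).trans ?_
  rw [norm_neg]
  have h1 := norm_eval_chebyshevPart_le m h0 θ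
  calc _ ≤ _ := add_le_add h1 (h0 θ)
    _ = _ := by ring

end

section
variable {m : ℕ} {β : ℝ}

lemma hasDerivAt_quadratic_rpow {ρ τ s : ℝ} (hρ : 0 < ρ) (hτ : 0 < τ)
    (hq : 0 < 1 + ρ ^ 2 - 2 * ρ * s) :
    HasDerivAt (fun s => (1 + ρ ^ 2 - 2 * ρ * s) ^ (-τ) / (2 * ρ * τ))
      ((1 + ρ ^ 2 - 2 * ρ * s) ^ (-(1 + τ))) s := by
  have h1 : HasDerivAt (fun s => 1 + ρ ^ 2 - 2 * ρ * s) (-(2 * ρ)) s := by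
    simpa using ((hasDerivAt_id s).const_mul (2 * ρ)).const_sub (1 + ρ ^ 2)
  refine ((h1.rpow_const (p := -τ) (Or.inl hq.ne')).div_const (2 * ρ * τ)).congr_deriv ?_
  have e : -τ - 1 = -(1 + τ) := by ring
  rw [e]
  field_simp

/-- The size of an iterated primitive of the ladder function close to the unit circle: each
integration gains a power of the distance to the singularity at `1`. -/
lemma exists_preimageChain_le_rpow (hβ : 0 < β) (hβ' : β < ((m + 1 : ℕ) : ℝ) + 1) (L : ℕ) {τ : ℝ}
    (hτ : 0 < τ) (hτβ : 1 - β ≤ τ) : ∃ C : ℝ, 0 ≤ C ∧ ∀ ρ ∈ Icc (1 / 2 : ℝ) 2, ρ ≠ 1 → ∀ c : ℝ,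
      |c| ≤ 1 → ‖preimageChain m β L 0 ρ 0 c‖ ≤ C * (1 + ρ ^ 2 - 2 * ρ * c) ^ (-τ) := by
  obtain ⟨C, hC, h⟩ := exists_ladderProfile_le hβ hβ' L
  set γ : ℝ := ((m + 1 : ℕ) : ℝ) + 1 - β with hγ
  have hγ0 : 0 < γ := by linarith
  set A := |ladderScale (m + 1) β L| with hA
  set D : ℝ := 4 ^ (m + 1) * A * (C * 2 ^ γ) with hD
  have hD0 : 0 ≤ D := by positivity
  set E : ℝ := D * (9 ^ (1 + τ) + 9 ^ (β - 1 + τ)) with hE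
  have hE0 : 0 ≤ E := by positivity
  refine ⟨2 * D * 9 ^ τ + E / τ, by positivity, fun ρ hρ h1 c hc => ?_⟩
  have hρ0 : 0 < ρ := by linarith [hρ.1]
  set F : ℝ → ℂ := fun t => (((2 * ρ) ^ (m + 1) * ladderScale (m + 1) β L *
    ladderProfile (m + 1) β L ρ t : ℝ) : ℂ) with hF
  have e : preimageChain m β L 0 ρ 0 c = cauchyInt m F c := by
    simp [preimageChain, taylorChain, hF]
  set q : ℝ → ℝ := fun s => 1 + ρ ^ 2 - 2 * ρ * s with hq
  have hq0 : ∀ s, |s| ≤ 1 → 0 < q s := fun s hs => one_add_sq_sub_pos hρ0.le h1 hs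
  have hq9 : ∀ s, |s| ≤ 1 → q s ≤ 9 := fun s hs => by
    have := mul_le_mul_of_nonneg_left (abs_le.1 hs).1 hρ0.le
    simp only [hq]
    nlinarith [hρ.2]
  have hone : ∀ s, |s| ≤ 1 → ∀ σ : ℝ, 0 ≤ σ → 1 ≤ 9 ^ σ * q s ^ (-σ) := by
    intro s hs σ hσ
    have h0 := hq0 s hs
    rw [rpow_neg h0.le, ← div_eq_mul_inv, one_le_div (by positivity)]
    exact rpow_le_rpow h0.le (hq9 s hs) hσ
  have hFb : ∀ s, |s| ≤ 1 → ‖F s‖ ≤ D * (1 + q s ^ (-γ)) := by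
    intro s hs
    have h0 := hq0 s hs
    have hp := ladderProfile_nonneg (l := m + 1) (β := β) L ρ s
    simp only [hF]
    rw [Complex.norm_real, Real.norm_eq_abs, abs_mul, abs_mul, abs_of_nonneg hp,
      abs_of_pos (by positivity : 0 < (2 * ρ) ^ (m + 1))]
    have p1 : (2 * ρ) ^ (m + 1) ≤ 4 ^ (m + 1) := by
      gcongr; linarith [hρ.2]
    have p2 : ρ ^ (-γ) ≤ 2 ^ γ := by
      have : ρ ^ (-γ) ≤ (1 / 2 : ℝ) ^ (-γ) := rpow_le_rpow_of_nonpos (by norm_num) hρ.1 (by linarith)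
      rwa [one_div, inv_rpow (by norm_num), ← rpow_neg (by norm_num), neg_neg] at this
    have p3 : (1 : ℝ) ≤ 2 ^ γ := one_le_rpow (by norm_num) hγ0.le
    have p4 : ladderProfile (m + 1) β L ρ s ≤ C * 2 ^ γ * (1 + q s ^ (-γ)) := by
      refine (h ρ hρ0 h1 s hs).trans ?_
      have p5 : q s ^ (-γ) ≤ 2 ^ γ * q s ^ (-γ) := le_mul_of_one_le_left (by positivity) p3
      calc _ ≤ C * (2 ^ γ + 2 ^ γ * q s ^ (-γ)) :=
            mul_le_mul_of_nonneg_left (add_le_add p2 p5) hC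
        _ = _ := by ring
    calc (2 * ρ) ^ (m + 1) * |ladderScale (m + 1) β L| * ladderProfile (m + 1) β L ρ s
        ≤ 4 ^ (m + 1) * A * (C * 2 ^ γ * (1 + q s ^ (-γ))) := by
          rw [← hA]; gcongr
      _ = _ := by rw [hD]; ring
  have hqc := hq0 c hc
  rw [e]
  -- For `c ≤ 0` the path from `0` to `c` stays away from the singularity. For `c ≥ 0` the factor
  -- `(c - s) ^ m` of the Cauchy formula is at most `q s ^ m`, and lowers the exponent `γ` to `1 - β`.
  rcases le_total c 0 with hc0 | hc0
  · have hb : ‖cauchyInt m F c‖ ≤ 2 * D := by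
      refine norm_cauchyInt_le_of_uIcc m hc fun s hs => ?_
      rw [uIcc_of_ge hc0] at hs
      have hs1 : |s| ≤ 1 := abs_le.2 ⟨(abs_le.1 hc).1.trans hs.1, hs.2.trans zero_le_one⟩
      have hq1 : 1 ≤ q s := by
        simp only [hq]; nlinarith [mul_nonpos_of_nonneg_of_nonpos hρ0.le hs.2]
      have := rpow_le_one_of_one_le_of_nonpos hq1 (by linarith : -γ ≤ 0)
      refine (hFb s hs1).trans ?_
      nlinarith
    have h3 := hone c hc τ hτ.le
    calc ‖cauchyInt m F c‖ ≤ 2 * D * 1 := by linarith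
      _ ≤ 2 * D * (9 ^ τ * q c ^ (-τ)) := by gcongr
      _ = 2 * D * 9 ^ τ * q c ^ (-τ) := by ring
      _ ≤ _ := by gcongr; exact le_add_of_nonneg_right (by positivity)
  · have hs1 : ∀ s ∈ Icc 0 c, |s| ≤ 1 := fun s hs =>
      abs_le.2 ⟨by linarith [hs.1], hs.2.trans (abs_le.1 hc).2⟩
    have hint : ∀ s ∈ Icc 0 c, ‖(((c - s) ^ m / m.factorial : ℝ) : ℂ) * F s‖ ≤
        E * q s ^ (-(1 + τ)) := by
      intro s hs
      have h0 := hq0 s (hs1 s hs)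
      have hcs0 : 0 ≤ c - s := by linarith [hs.2]
      have hcs1 : c - s ≤ 1 := by linarith [hs.1, (abs_le.1 hc).2]
      have hcsq : c - s ≤ q s := by
        have : q s = q c + 2 * ρ * (c - s) := by simp only [hq]; ring
        rw [this]
        nlinarith [hρ.1]
      have hfac : (1 : ℝ) ≤ m.factorial := by
        exact_mod_cast Nat.one_le_iff_ne_zero.2 m.factorial_ne_zero
      have k1 : (c - s) ^ m ≤ 9 ^ (1 + τ) * q s ^ (-(1 + τ)) :=
        (pow_le_one₀ hcs0 hcs1).trans (hone s (hs1 s hs) (1 + τ) (by linarith))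
      have k2 : (c - s) ^ m * q s ^ (-γ) ≤ 9 ^ (β - 1 + τ) * q s ^ (-(1 + τ)) := by
        calc (c - s) ^ m * q s ^ (-γ) ≤ q s ^ m * q s ^ (-γ) := by gcongr
          _ = q s ^ (β - 1 + τ) * q s ^ (-(1 + τ)) := by
            rw [← rpow_natCast, ← rpow_add h0, ← rpow_add h0]
            congr 1; rw [hγ]; push_cast; ring
          _ ≤ _ := by
            have : (0 : ℝ) ≤ β - 1 + τ := by linarith
            exact mul_le_mul_of_nonneg_right (rpow_le_rpow h0.le (hq9 s (hs1 s hs)) this)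
              (by positivity)
      rw [norm_mul, Complex.norm_real, norm_of_nonneg (by positivity)]
      calc (c - s) ^ m / m.factorial * ‖F s‖ ≤ (c - s) ^ m * (D * (1 + q s ^ (-γ))) := by
            gcongr
            · exact div_le_self (by positivity) hfac
            · exact hFb s (hs1 s hs)
        _ = D * ((c - s) ^ m + (c - s) ^ m * q s ^ (-γ)) := by ring
        _ ≤ D * (9 ^ (1 + τ) * q s ^ (-(1 + τ)) + 9 ^ (β - 1 + τ) * q s ^ (-(1 + τ))) := by
            gcongr
        _ = _ := by rw [hE]; ring
    have hcontq : ContinuousOn (fun s => E * q s ^ (-(1 + τ))) (uIcc 0 c) := by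
      rw [uIcc_of_le hc0]
      refine continuousOn_const.mul (ContinuousOn.rpow_const (by fun_prop) fun s hs =>
        Or.inl (hq0 s (hs1 s hs)).ne')
    have h5 := intervalIntegral.norm_integral_le_of_norm_le (μ := volume) hc0
      (f := fun s => (((c - s) ^ m / m.factorial : ℝ) : ℂ) * F s)
      (Eventually.of_forall fun s hs => hint s (Ioc_subset_Icc_self hs))
      hcontq.intervalIntegrable
    have h6 : ∫ s in (0 : ℝ)..c, E * q s ^ (-(1 + τ)) =
        E * (q c ^ (-τ) / (2 * ρ * τ)) - E * (q 0 ^ (-τ) / (2 * ρ * τ)) :=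
      intervalIntegral.integral_eq_sub_of_hasDerivAt (fun s hs => by
        rw [uIcc_of_le hc0] at hs
        exact (hasDerivAt_quadratic_rpow hρ0 hτ (hq0 s (hs1 s hs))).const_mul E)
        hcontq.intervalIntegrable
    have h00 := hq0 0 (by simp)
    have h7 : 0 ≤ E * (q 0 ^ (-τ) / (2 * ρ * τ)) := by positivity
    calc ‖cauchyInt m F c‖ ≤ E * (q c ^ (-τ) / (2 * ρ * τ)) := by
          refine h5.trans ?_; rw [h6]; linarith
      _ ≤ E * (q c ^ (-τ) / τ) := by
          gcongr
          nlinarith [hρ.1]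
      _ = E / τ * q c ^ (-τ) := by ring
      _ ≤ _ := by gcongr; exact le_add_of_nonneg_left (by positivity)

/-- The size of the preimage on an annulus, with its singularity at `1`. -/
lemma exists_canonicalProfile_le (hβ : 0 < β) (hβ' : β < ((m + 1 : ℕ) : ℝ) + 1) (L : ℕ) {τ : ℝ}
    (hτ : 0 < τ) (hτβ : 1 - β ≤ τ) {a b : ℝ} (ha : 0 < a) :
    ∃ C : ℝ, 0 ≤ C ∧ ∀ ρ ∈ Icc a b, ρ ≠ 1 → ∀ θ : ℝ,
      ‖canonicalProfile m β L ρ (cos θ)‖ ≤ C * (1 + ρ ^ 2 - 2 * ρ * cos θ) ^ (-τ) := by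
  obtain ⟨C₁, hC₁, h₁⟩ := exists_preimageChain_le_rpow hβ hβ' L hτ hτβ
  obtain ⟨C₂, hC₂, h₂⟩ := exists_canonicalProfile_le_rpow hβ hβ' L
  set γ : ℝ := ((m + 1 : ℕ) : ℝ) + 1 - β with hγ
  have hγ0 : 0 < γ := by linarith
  refine ⟨C₁ + C₂ * (|b| ^ (m + 1) * a ^ (-γ)) * ((1 + |b|) ^ 2) ^ τ, by positivity,
    fun ρ hρ h1 θ => ?_⟩
  have hρ0 : 0 < ρ := ha.trans_le hρ.1
  have hq := one_add_sq_sub_pos hρ0.le h1 (abs_cos_le_one θ)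
  by_cases hn : ρ ∈ Icc (1 / 2 : ℝ) 2
  · rw [canonicalProfile, canonicalPoly, if_pos hn]
    refine (h₁ ρ hn h1 _ (abs_cos_le_one θ)).trans ?_
    gcongr
    exact le_add_of_nonneg_right (by positivity)
  · refine (h₂ ρ hρ0 hn θ).trans ?_
    have hb : ρ ≤ |b| := hρ.2.trans (le_abs_self b)
    have hqb : 1 + ρ ^ 2 - 2 * ρ * cos θ ≤ (1 + |b|) ^ 2 := by
      have := mul_le_mul_of_nonneg_left (neg_one_le_cos θ) hρ0.le
      nlinarith
    have k : 1 ≤ ((1 + |b|) ^ 2) ^ τ * (1 + ρ ^ 2 - 2 * ρ * cos θ) ^ (-τ) := by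
      rw [rpow_neg hq.le, ← div_eq_mul_inv, one_le_div (by positivity)]
      exact rpow_le_rpow hq.le hqb hτ.le
    have k2 : ρ ^ (m + 1) * ρ ^ (-γ) ≤ |b| ^ (m + 1) * a ^ (-γ) := by
      have : -γ ≤ 0 := by linarith
      exact mul_le_mul (pow_le_pow_left₀ hρ0.le hb _) (rpow_le_rpow_of_nonpos ha hρ.1 this)
        (by positivity) (by positivity)
    calc C₂ * (ρ ^ (m + 1) * ρ ^ (-γ)) ≤ C₂ * (|b| ^ (m + 1) * a ^ (-γ)) * 1 := by
          rw [mul_one]; gcongr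
      _ ≤ C₂ * (|b| ^ (m + 1) * a ^ (-γ)) * (((1 + |b|) ^ 2) ^ τ *
          (1 + ρ ^ 2 - 2 * ρ * cos θ) ^ (-τ)) := by gcongr
      _ = C₂ * (|b| ^ (m + 1) * a ^ (-γ)) * ((1 + |b|) ^ 2) ^ τ *
          (1 + ρ ^ 2 - 2 * ρ * cos θ) ^ (-τ) := by ring
      _ ≤ _ := by gcongr; exact le_add_of_nonneg_left hC₁

/-! ### Measurability of the preimage -/

lemma measurable_cauchyInt (k : ℕ) {F : ℝ → ℝ → ℂ} (hF : Measurable (Function.uncurry F)) :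
    Measurable fun p : ℝ × ℝ => cauchyInt k (F p.1) p.2 := by
  have e : (fun p : ℝ × ℝ => cauchyInt k (F p.1) p.2) = fun p : ℝ × ℝ =>
      (p.2 : ℂ) * ∫ u in Ioc (0 : ℝ) 1,
        (((p.2 - p.2 * u) ^ k / k.factorial : ℝ) : ℂ) * F p.1 (p.2 * u) := by
    funext p
    have h := intervalIntegral.smul_integral_comp_mul_left (a := 0) (b := 1)
      (fun s => (((p.2 - s) ^ k / k.factorial : ℝ) : ℂ) * F p.1 s) p.2
    rw [mul_zero, mul_one] at h
    rw [cauchyInt, ← h, ← intervalIntegral.integral_of_le zero_le_one, Complex.real_smul]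
  rw [e]
  refine Measurable.mul (by fun_prop) ?_
  have hm : Measurable fun q : (ℝ × ℝ) × ℝ =>
      (((q.1.2 - q.1.2 * q.2) ^ k / k.factorial : ℝ) : ℂ) * F q.1.1 (q.1.2 * q.2) := by
    refine Measurable.mul (by fun_prop) ?_
    exact hF.comp (by fun_prop : Measurable fun q : (ℝ × ℝ) × ℝ => (q.1.1, q.1.2 * q.2))
  exact (hm.stronglyMeasurable.integral_prod_right').measurable

lemma measurable_cosMode (n : ℕ) {F : ℝ → ℝ → ℂ} (hF : Measurable (Function.uncurry F)) :
    Measurable fun ρ => cosMode (F ρ) n := by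
  unfold cosMode
  simp only [intervalIntegral.integral_of_le (by linarith [pi_pos] : -π ≤ π)]
  have hm : Measurable fun q : ℝ × ℝ => ((cos (n * q.2) : ℝ) : ℂ) * F q.1 (cos q.2) := by
    refine Measurable.mul (by fun_prop) ?_
    exact hF.comp (by fun_prop : Measurable fun q : ℝ × ℝ => (q.1, cos q.2))
  exact (hm.stronglyMeasurable.integral_prod_right').measurable

lemma measurable_canonicalProfile (m : ℕ) (β : ℝ) (L : ℕ) :
    Measurable (Function.uncurry (canonicalProfile m β L)) := by
  have hF : Measurable (Function.uncurry fun ρ t : ℝ => (((2 * ρ) ^ (m + 1) *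
      ladderScale (m + 1) β L * ladderProfile (m + 1) β L ρ t : ℝ) : ℂ)) := by
    have hp : Measurable fun p : ℝ × ℝ => ladderProfile (m + 1) β L p.1 p.2 :=
      (measurable_planarLadder_comp (m + 1) β L measurable_fst
        (continuous_arccos.measurable.comp measurable_snd)).ennreal_toReal
    exact Complex.measurable_ofReal.comp
      ((by fun_prop : Measurable fun p : ℝ × ℝ => (2 * p.1) ^ (m + 1) *
        ladderScale (m + 1) β L).mul hp)
  have hB : Measurable (Function.uncurry fun ρ t : ℝ => preimageChain m β L 0 ρ 0 t) := by
    have e : (Function.uncurry fun ρ t : ℝ => preimageChain m β L 0 ρ 0 t) = fun p : ℝ × ℝ =>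
        cauchyInt m (fun t : ℝ => (((2 * p.1) ^ (m + 1) * ladderScale (m + 1) β L *
          ladderProfile (m + 1) β L p.1 t : ℝ) : ℂ)) p.2 := by
      funext p
      simp [preimageChain, taylorChain, Function.uncurry]
    rw [e]
    exact measurable_cauchyInt m hF
  have hP : Measurable fun p : ℝ × ℝ => (canonicalPoly m β L p.1).eval (p.2 : ℂ) := by
    have e : (fun p : ℝ × ℝ => (canonicalPoly m β L p.1).eval (p.2 : ℂ)) = fun p : ℝ × ℝ =>
        (Icc (1 / 2 : ℝ) 2)ᶜ.indicator (fun _ => (1 : ℂ)) p.1 * -∑ n ∈ Finset.range (m + 1),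
          cosMode (preimageChain m β L 0 p.1 0) n / cosNorm n *
            (Polynomial.Chebyshev.T ℂ n).eval (p.2 : ℂ) := by
      funext p
      rw [canonicalPoly]
      split_ifs with h
      · rw [indicator_of_notMem (notMem_compl_iff.2 h), zero_mul, Polynomial.eval_zero]
      · rw [indicator_of_mem (mem_compl h), one_mul, Polynomial.eval_neg, chebyshevPart]
        simp only [Polynomial.eval_finsetSum, Polynomial.eval_mul, Polynomial.eval_C]
    rw [e]
    refine Measurable.mul ?_ (Measurable.neg (Finset.measurable_fun_sum _ fun n _ => ?_))
    · exact (measurable_const.indicator measurableSet_Icc.compl).comp measurable_fst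
    · refine Measurable.mul ?_ (Continuous.measurable (by fun_prop))
      exact ((measurable_cosMode n hB).comp measurable_fst).div_const _
  have e : Function.uncurry (canonicalProfile m β L) = fun p : ℝ × ℝ =>
      (canonicalPoly m β L p.1).eval (p.2 : ℂ) + preimageChain m β L 0 p.1 0 p.2 := by
    funext p
    exact preimageChain_zero_eq m β L _ _ _
  rw [e]
  exact hP.add hB

end

/-! ### The preimage is in the domain of the planar operator -/

lemma measurable_planeKernel (β : ℝ) : Measurable (planeKernel β) := by
  unfold planeKernel
  split_ifs <;> fun_prop

/-- In the plane, `|p - y|^{-2τ}` is locally integrable for `τ < 1`, in polar coordinates around `0`. -/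
lemma lintegral_polar_rpow_lt_top (p : ℂ) {τ : ℝ} (hτ : τ < 1) {a b : ℝ} (ha : 0 < a) :
    ∫⁻ ρ in Icc a b, ∫⁻ θ in Ioc (-π) π, ENNReal.ofReal ρ *
      ENNReal.ofReal (‖p - ρ * Complex.exp (θ * Complex.I)‖ ^ (-(2 * τ))) < ⊤ := by
  set R : ℝ := b + ‖p‖ + 1 with hR
  set g : ℂ → ENNReal := (Metric.ball (0 : ℂ) R).indicator
    fun y => ENNReal.ofReal (‖y‖ ^ (-(2 * τ))) with hg
  have hgm : Measurable g := Measurable.indicator (by fun_prop) measurableSet_ball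
  have h1 : ∫⁻ y, g (p - y) < ⊤ := by
    rw [lintegral_sub_left_eq_self g p, hg, lintegral_indicator measurableSet_ball]
    refine lintegral_ball_norm_rpow_lt_top volume ?_ R
    rw [Complex.finrank_real_complex]; push_cast; linarith
  refine lt_of_le_of_lt ?_ h1
  rw [← Complex.lintegral_comp_polarCoord_symm]
  have h2 : polarCoord.target = Ioi (0 : ℝ) ×ˢ Ioo (-π) π := rfl
  have hm : Measurable fun q : ℝ × ℝ => ENNReal.ofReal q.1 • g (p - Complex.polarCoord.symm q) := by
    simp only [Complex.polarCoord_symm_apply, smul_eq_mul]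
    exact Measurable.mul (by fun_prop) (hgm.comp (by fun_prop))
  rw [h2, Measure.volume_eq_prod, setLIntegral_prod _ hm.aemeasurable]
  refine le_trans ?_ (lintegral_mono_set (fun ρ hρ => lt_of_lt_of_le ha hρ.1 :
    Icc a b ⊆ Ioi (0 : ℝ)))
  refine setLIntegral_mono' measurableSet_Icc fun ρ hρ => ?_
  rw [← setLIntegral_congr (Ioo_ae_eq_Ioc (a := -π) (b := π))]
  refine lintegral_mono fun θ => ?_
  have hρ0 : 0 < ρ := ha.trans_le hρ.1
  have e : Complex.polarCoord.symm (ρ, θ) = ρ * Complex.exp (θ * Complex.I) := by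
    rw [Complex.polarCoord_symm_apply, Complex.exp_mul_I]; push_cast; rfl
  simp only [e, smul_eq_mul]
  rw [hg, indicator_of_mem]
  rw [mem_ball_zero_iff, hR]
  have := norm_sub_le p (ρ * Complex.exp (θ * Complex.I))
  rw [norm_polar hρ0.le] at this
  linarith [hρ.2]

section
variable {m : ℕ} {β : ℝ}

/-- The contribution of the circle of radius `ρ` to the value at `x` of the planar operator, applied
to the quotient of `canonicalPreimage` by the norm. -/
noncomputable def canonicalShell (m : ℕ) (β : ℝ) (L : ℕ) (x : ℂ) (ρ : ℝ) : ℂ :=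
  ((ρ ^ (-(2 * β)) * ρ : ℝ) : ℂ) * ∫ θ in (-π)..π,
    (planeKernel β ‖x - ρ * Complex.exp (θ * Complex.I)‖ : ℂ) * canonicalProfile m β L ρ (cos θ)

lemma measurable_canonicalShell (m : ℕ) (β : ℝ) (L : ℕ) (x : ℂ) :
    Measurable (canonicalShell m β L x) := by
  unfold canonicalShell
  simp only [intervalIntegral.integral_of_le (by linarith [pi_pos] : -π ≤ π)]
  refine Measurable.mul (by fun_prop) ?_
  have hm : Measurable fun q : ℝ × ℝ =>
      (planeKernel β ‖x - q.1 * Complex.exp (q.2 * Complex.I)‖ : ℂ) *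
        canonicalProfile m β L q.1 (cos q.2) := by
    refine Measurable.mul ?_ ?_
    · exact Complex.measurable_ofReal.comp ((measurable_planeKernel β).comp (by fun_prop))
    · exact (measurable_canonicalProfile m β L).comp
        (by fun_prop : Measurable fun q : ℝ × ℝ => (q.1, cos q.2))
  exact (hm.stronglyMeasurable.integral_prod_right').measurable

/-- Away from the circles of radius `1` and `r`, the absence of low Fourier modes improves the
decay. -/
lemma exists_norm_canonicalShell_le (hβ : 0 < β) (hβ' : β < ((m + 1 : ℕ) : ℝ) + 1) (L : ℕ)
    {r : ℝ} (hr : 0 < r) (φ : ℝ) : ∃ C : ℝ, 0 ≤ C ∧ ∀ ρ : ℝ, 0 < ρ → ρ ∉ Icc (1 / 2 : ℝ) 2 →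
      ∀ d : ℝ, 0 < d → d ≤ |r - ρ| →
      ‖canonicalShell m β L (r * Complex.exp (φ * Complex.I)) ρ‖ ≤
        C * (ρ ^ (((m + 1 : ℕ) : ℝ) + 1 - β - 1) *
          d ^ (-(2 * (((m + 1 : ℕ) : ℝ) + 1 - β)))) := by
  obtain ⟨C, hC, h⟩ := exists_canonicalProfile_le_rpow hβ hβ' L
  set γ : ℝ := ((m + 1 : ℕ) : ℝ) + 1 - β with hγ
  have hγ0 : 0 < γ := by linarith
  set p := |propConst (((m + 1 : ℕ) : ℝ) + 1) β| with hp
  refine ⟨2 * π * ((2 * r) ^ (m + 1) * π ^ (m + 1) * p * C), by positivity,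
    fun ρ hρ hn d hd hdr => ?_⟩
  have h1 : ρ ≠ 1 := fun h => hn (by rw [h]; norm_num)
  have hne : r ≠ ρ := fun h => by rw [h, sub_self, abs_zero] at hdr; linarith
  have hk := isKernelChain_annulusKernel β hr.le hρ.le hne
  have hM : ∀ t, |t| ≤ 1 → |annulusKernel β r ρ (m + 1) t| ≤
      (2 * r * ρ) ^ (m + 1) * (π ^ (m + 1) * p * d ^ (-(2 * γ))) := by
    intro t ht
    have hq : d ^ 2 ≤ r ^ 2 + ρ ^ 2 - 2 * r * ρ * t := by
      refine le_trans ?_ (annulus_dist_sq_ge hr.le hρ.le ht)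
      rw [← sq_abs (r - ρ)]
      gcongr
    have hq' : (r ^ 2 + ρ ^ 2 - 2 * r * ρ * t) ^ (-γ) ≤ d ^ (-(2 * γ)) := by
      refine (rpow_le_rpow_of_nonpos (by positivity) hq (by linarith)).trans_eq ?_
      rw [← rpow_natCast, ← rpow_mul hd.le]
      congr 1; push_cast; ring
    have hq0 : 0 ≤ r ^ 2 + ρ ^ 2 - 2 * r * ρ * t := (sq_nonneg d).trans hq
    rw [annulusKernel, planePow_eq (m + 1) hβ', abs_mul, abs_mul, abs_mul, abs_mul, abs_pow, abs_neg,
      abs_pow, abs_neg, abs_one, one_pow, one_mul, abs_of_pos (by positivity : 0 < 2 * r * ρ),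
      abs_of_pos (by positivity : 0 < π ^ (m + 1)), abs_of_nonneg (rpow_nonneg hq0 _), ← hp, ← hγ]
    gcongr
  have hA := norm_circleConv_le hk hM
    ((continuous_canonicalProfile hβ hβ' L hρ h1).comp continuous_cos)
    (fun n hnm => cosMode_canonicalProfile hβ hβ' L hρ hn hnm) (h ρ hρ hn) φ
  have e : canonicalShell m β L (r * Complex.exp (φ * Complex.I)) ρ =
      ((ρ ^ (-(2 * β)) * ρ : ℝ) : ℂ) *
        circleConv (annulusKernel β r ρ 0) (canonicalProfile m β L ρ) φ := by
    simp only [canonicalShell, circleConv, planeKernel_norm_sub β hr.le hρ.le hne]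
  rw [e, norm_mul, Complex.norm_real, norm_of_nonneg (by positivity)]
  have e2 : ρ ^ (-(2 * β)) * ρ * (ρ ^ (m + 1) * (ρ ^ (m + 1) * ρ ^ (-γ))) = ρ ^ (γ - 1) := by
    rw [← rpow_natCast, ← rpow_add hρ, ← rpow_add hρ]
    nth_rewrite 2 [← rpow_one ρ]
    rw [← rpow_add hρ, ← rpow_add hρ]
    congr 1
    rw [hγ]; push_cast; ring
  calc ρ ^ (-(2 * β)) * ρ * ‖circleConv (annulusKernel β r ρ 0) (canonicalProfile m β L ρ) φ‖ ≤
      ρ ^ (-(2 * β)) * ρ * (2 * π * ((2 * r * ρ) ^ (m + 1) * (π ^ (m + 1) * p * d ^ (-(2 * γ))) *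
        (C * (ρ ^ (m + 1) * ρ ^ (-γ))))) := by gcongr
    _ = 2 * π * ((2 * r) ^ (m + 1) * π ^ (m + 1) * p * C) *
        (ρ ^ (-(2 * β)) * ρ * (ρ ^ (m + 1) * (ρ ^ (m + 1) * ρ ^ (-γ))) * d ^ (-(2 * γ))) := by
          rw [mul_pow (2 * r) ρ]; ring
    _ = _ := by rw [e2]

/-- A product of two powers with different singularities is bounded by their sum. -/
lemma rpow_mul_rpow_le {u v t τ : ℝ} (hu : 0 < u) (hv : 0 < v) (ht : 0 < t) (hτ : 0 ≤ τ)
    (h : t ≤ u + v) : u ^ (-(2 * τ)) * v ^ (-(2 * τ)) ≤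
      (t / 2) ^ (-(2 * τ)) * (u ^ (-(2 * τ)) + v ^ (-(2 * τ))) := by
  have key : ∀ s : ℝ, t / 2 ≤ s → s ^ (-(2 * τ)) ≤ (t / 2) ^ (-(2 * τ)) := fun s hs =>
    rpow_le_rpow_of_nonpos (by positivity) hs (by linarith)
  have p1 : 0 < u ^ (-(2 * τ)) := by positivity
  have p2 : 0 < v ^ (-(2 * τ)) := by positivity
  have p3 : 0 < (t / 2) ^ (-(2 * τ)) := by positivity
  rcases le_total u v with huv | huv
  · have := key v (by linarith)
    nlinarith [mul_le_mul_of_nonneg_left this p1.le, mul_pos p3 p2]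
  · have := key u (by linarith)
    nlinarith [mul_le_mul_of_nonneg_right this p2.le, mul_pos p3 p1]

/-- On an annulus, both singularities are integrable and they do not meet. -/
lemma integrableOn_canonicalShell_Icc (hβ : 0 < β) (hβ' : β < ((m + 1 : ℕ) : ℝ) + 1) (L : ℕ)
    {x : ℂ} (hx : x.im ≠ 0) {a b : ℝ} (ha : 0 < a) :
    IntegrableOn (canonicalShell m β L x) (Icc a b) := by
  refine ⟨(measurable_canonicalShell m β L x).aestronglyMeasurable, ?_⟩
  -- The exponent `2 τ` is larger than that of the kernel, so that it absorbs a logarithm, and less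
  -- than `2`, the dimension of the plane.
  obtain ⟨τ, hτ0, hτ1, hτβ⟩ : ∃ τ : ℝ, 0 < τ ∧ τ < 1 ∧ 1 - β < τ := by
    refine ⟨1 - min β 1 / 2, ?_, ?_, ?_⟩
    · have := min_le_right β 1; linarith
    · have : 0 < min β 1 := lt_min hβ one_pos
      linarith
    · have := min_le_left β 1
      have h0 : 0 < min β 1 := lt_min hβ one_pos
      linarith
  obtain ⟨C₁, hC₁, h₁⟩ := exists_planeKernel_le β hτβ (R := ‖x‖ + |b| + 1) (by positivity)
  obtain ⟨C₂, hC₂, h₂⟩ := exists_canonicalProfile_le hβ hβ' L hτ0 hτβ.le (b := b) ha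
  have hx1 : x ≠ 1 := fun h => hx (by simp [h])
  have ht : 0 < ‖x - 1‖ := norm_pos_iff.2 (sub_ne_zero.2 hx1)
  set D : ℝ := a ^ (-(2 * β)) * (C₁ * C₂ * (‖x - 1‖ / 2) ^ (-(2 * τ))) with hD
  have hD0 : 0 ≤ D := by positivity
  have hbound : ∀ᵐ ρ ∂(volume.restrict (Icc a b)), ‖canonicalShell m β L x ρ‖ₑ ≤
      ∫⁻ θ in Ioc (-π) π, ENNReal.ofReal D *
        (ENNReal.ofReal ρ *
            ENNReal.ofReal (‖x - ρ * Complex.exp (θ * Complex.I)‖ ^ (-(2 * τ))) +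
          ENNReal.ofReal ρ *
            ENNReal.ofReal (‖1 - ρ * Complex.exp (θ * Complex.I)‖ ^ (-(2 * τ)))) := by
    have hne : ∀ᵐ ρ ∂(volume.restrict (Icc a b)), ρ ≠ 1 ∧ ρ ≠ ‖x‖ :=
      ae_restrict_of_ae ((Measure.ae_ne volume 1).and (Measure.ae_ne volume ‖x‖))
    filter_upwards [hne, ae_restrict_mem measurableSet_Icc] with ρ hρne hρ
    have hρ0 : 0 < ρ := ha.trans_le hρ.1
    rw [canonicalShell, intervalIntegral.integral_of_le (by linarith [pi_pos]),
      ← integral_const_mul]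
    refine (enorm_integral_le_lintegral_enorm _).trans (lintegral_mono fun θ => ?_)
    set y : ℂ := ρ * Complex.exp (θ * Complex.I) with hy
    have hyn : ‖y‖ = ρ := norm_polar hρ0.le θ
    have hxy : 0 < ‖x - y‖ := norm_pos_iff.2 (sub_ne_zero.2 fun h => hρne.2 (by rw [h, hyn]))
    have h1y : 0 < ‖1 - y‖ := norm_pos_iff.2 (sub_ne_zero.2 fun h => hρne.1 (by
      rw [← hyn, ← h, norm_one]))
    have hq : (1 + ρ ^ 2 - 2 * ρ * cos θ) ^ (-τ) = ‖1 - y‖ ^ (-(2 * τ)) := by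
      have h := norm_polar_sub_sq 1 ρ 0 θ
      simp only [Complex.ofReal_one, Complex.ofReal_zero, zero_mul, Complex.exp_zero, mul_one,
        zero_sub, cos_neg, one_pow] at h
      rw [← h, ← hy, ← rpow_natCast, ← rpow_mul (norm_nonneg _)]
      congr 1; push_cast; ring
    have k1 : |planeKernel β ‖x - y‖| ≤ C₁ * ‖x - y‖ ^ (-(2 * τ)) := by
      refine h₁ _ hxy ?_
      have := norm_sub_le x y
      rw [hyn] at this
      linarith [hρ.2, le_abs_self b]
    have k2 := h₂ ρ hρ hρne.1 θ
    rw [hq] at k2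
    have k3 := rpow_mul_rpow_le hxy h1y ht hτ0.le (by
      have := norm_sub_le (x - y) (1 - y)
      rwa [sub_sub_sub_cancel_right] at this)
    have k4 : ρ ^ (-(2 * β)) ≤ a ^ (-(2 * β)) := rpow_le_rpow_of_nonpos ha hρ.1 (by linarith)
    rw [← ENNReal.ofReal_mul hρ0.le, ← ENNReal.ofReal_mul hρ0.le,
      ← ENNReal.ofReal_add (by positivity) (by positivity), ← ENNReal.ofReal_mul hD0, ← ofReal_norm]
    apply ENNReal.ofReal_le_ofReal
    rw [norm_mul, norm_mul, Complex.norm_real, Complex.norm_real, norm_of_nonneg (by positivity),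
      Real.norm_eq_abs]
    calc ρ ^ (-(2 * β)) * ρ * (|planeKernel β ‖x - y‖| * ‖canonicalProfile m β L ρ (cos θ)‖) ≤
        a ^ (-(2 * β)) * ρ * ((C₁ * ‖x - y‖ ^ (-(2 * τ))) * (C₂ * ‖1 - y‖ ^ (-(2 * τ)))) := by
          gcongr
      _ = a ^ (-(2 * β)) * ρ * (C₁ * C₂) * (‖x - y‖ ^ (-(2 * τ)) * ‖1 - y‖ ^ (-(2 * τ))) := by ring
      _ ≤ a ^ (-(2 * β)) * ρ * (C₁ * C₂) * ((‖x - 1‖ / 2) ^ (-(2 * τ)) *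
          (‖x - y‖ ^ (-(2 * τ)) + ‖1 - y‖ ^ (-(2 * τ)))) := by gcongr
      _ = _ := by rw [hD]; ring
  refine (lintegral_mono_ae hbound).trans_lt ?_
  have hm : ∀ p : ℂ, Measurable fun q : ℝ × ℝ => ENNReal.ofReal q.1 *
      ENNReal.ofReal (‖p - q.1 * Complex.exp (q.2 * Complex.I)‖ ^ (-(2 * τ))) := fun p => by
    fun_prop
  have hsum : ∀ ρ : ℝ, ∫⁻ θ in Ioc (-π) π, ENNReal.ofReal D *
        (ENNReal.ofReal ρ *
            ENNReal.ofReal (‖x - ρ * Complex.exp (θ * Complex.I)‖ ^ (-(2 * τ))) +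
          ENNReal.ofReal ρ *
            ENNReal.ofReal (‖1 - ρ * Complex.exp (θ * Complex.I)‖ ^ (-(2 * τ)))) =
      ENNReal.ofReal D * ((∫⁻ θ in Ioc (-π) π, ENNReal.ofReal ρ *
            ENNReal.ofReal (‖x - ρ * Complex.exp (θ * Complex.I)‖ ^ (-(2 * τ)))) +
          ∫⁻ θ in Ioc (-π) π, ENNReal.ofReal ρ *
            ENNReal.ofReal (‖1 - ρ * Complex.exp (θ * Complex.I)‖ ^ (-(2 * τ)))) := by
    intro ρ
    rw [lintegral_const_mul' _ _ ENNReal.ofReal_ne_top, lintegral_add_left]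
    exact (hm x).comp (measurable_prodMk_left (x := ρ))
  simp only [hsum]
  rw [lintegral_const_mul' _ _ ENNReal.ofReal_ne_top,
    lintegral_add_left (Measurable.lintegral_prod_right (hm x))]
  exact ENNReal.mul_lt_top ENNReal.ofReal_lt_top (ENNReal.add_lt_top.2
    ⟨lintegral_polar_rpow_lt_top x hτ1 ha, lintegral_polar_rpow_lt_top 1 hτ1 ha⟩)

/-- The contribution of the circle of radius `ρ` is of order `ρ^{γ - 1}` for small `ρ` and of order
`ρ^{-γ - 1}` for large `ρ`; in between it is integrable by `integrableOn_canonicalShell_Icc`. -/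
lemma integrableOn_canonicalShell (hβ : 0 < β) (hβ' : β < ((m + 1 : ℕ) : ℝ) + 1) (L : ℕ)
    {x : ℂ} (hx : x.im ≠ 0) : IntegrableOn (canonicalShell m β L x) (Ioi 0) := by
  have hr : 0 < ‖x‖ := norm_pos_iff.2 fun h => hx (by simp [h])
  obtain ⟨C, hC, h⟩ := exists_norm_canonicalShell_le hβ hβ' L hr x.arg
  rw [Complex.norm_mul_exp_arg_mul_I] at h
  set γ : ℝ := ((m + 1 : ℕ) : ℝ) + 1 - β with hγ
  have hγ0 : 0 < γ := by linarith
  set r := ‖x‖ with hrdef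
  set a : ℝ := min (1 / 2) (r / 2) with ha
  set b : ℝ := max 2 (2 * r) with hb
  have ha0 : 0 < a := lt_min (by norm_num) (by positivity)
  have hb0 : 0 < b := lt_max_of_lt_left (by norm_num)
  have hmeas := (measurable_canonicalShell m β L x).aestronglyMeasurable
    (μ := (volume : Measure ℝ))
  have hsub : Ioi (0 : ℝ) ⊆ Ioo 0 a ∪ Icc a b ∪ Ioi b := by
    intro ρ hρ
    rcases lt_or_ge ρ a with h1 | h1
    · exact Or.inl (Or.inl ⟨hρ, h1⟩)
    · rcases le_or_gt ρ b with h2 | h2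
      · exact Or.inl (Or.inr ⟨h1, h2⟩)
      · exact Or.inr h2
  refine IntegrableOn.mono_set ((IntegrableOn.union (IntegrableOn.union ?_
    (integrableOn_canonicalShell_Icc hβ hβ' L hx ha0)) ?_)) hsub
  · have hi : IntegrableOn (fun ρ : ℝ => C * (ρ ^ (γ - 1) * (r / 2) ^ (-(2 * γ)))) (Ioo 0 a) :=
      (((intervalIntegral.integrableOn_Ioo_rpow_iff ha0).2 (by linarith)).mul_const _).const_mul _
    refine Integrable.mono' hi hmeas.restrict ?_
    filter_upwards [ae_restrict_mem measurableSet_Ioo] with ρ hρ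
    have h1 : ρ < 1 / 2 := hρ.2.trans_le (min_le_left _ _)
    have h2 : ρ < r / 2 := hρ.2.trans_le (min_le_right _ _)
    refine h ρ hρ.1 (fun hc => by linarith [hc.1]) (r / 2) (by positivity) ?_
    rw [abs_of_pos (by linarith)]
    linarith
  · have hi : IntegrableOn (fun ρ : ℝ => C * 2 ^ (2 * γ) * ρ ^ (-γ - 1)) (Ioi b) :=
      (integrableOn_Ioi_rpow_of_lt (by linarith) hb0).const_mul _
    refine Integrable.mono' hi hmeas.restrict ?_
    filter_upwards [ae_restrict_mem measurableSet_Ioi] with ρ hρ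
    have hρ0 : 0 < ρ := hb0.trans hρ
    have h1 : 2 < ρ := (le_max_left _ _).trans_lt hρ
    have h2 : 2 * r < ρ := (le_max_right _ _).trans_lt hρ
    refine (h ρ hρ0 (fun hc => by linarith [hc.2]) (ρ / 2) (by positivity) ?_).trans_eq ?_
    · rw [abs_of_neg (by linarith)]
      linarith
    · have e : (ρ / 2) ^ (-(2 * γ)) = 2 ^ (2 * γ) * ρ ^ (-(2 * γ)) := by
        rw [div_rpow hρ0.le (by norm_num), rpow_neg (by norm_num : (0 : ℝ) ≤ 2), div_inv_eq_mul,
          mul_comm]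
      have e2 : ρ ^ (γ - 1) * ρ ^ (-(2 * γ)) = ρ ^ (-γ - 1) := by
        rw [← rpow_add hρ0]; congr 1; ring
      rw [e, ← e2]; ring

lemma inHhatDomain_canonicalPreimage (hβ : 0 < β) (hβ' : β < ((m + 1 : ℕ) : ℝ) + 1) (L : ℕ) :
    InHhatDomain β (fun w => canonicalPreimage m β L w / (‖w‖ : ℂ)) := by
  intro x hx
  have hr : 0 < ‖x‖ := norm_pos_iff.2 fun h => hx (by simp [h])
  have hcirc : ∀ ρ : ℝ, 0 < ρ → ∀ θ : ℝ,
      circleIntegrand β (fun w => canonicalPreimage m β L w / (‖w‖ : ℂ)) x ρ θ =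
        (planeKernel β ‖x - ρ * Complex.exp (θ * Complex.I)‖ : ℂ) *
          canonicalProfile m β L ρ (cos θ) := fun ρ hρ θ => by
    rw [circleIntegrand, canonicalPreimage_polar m β L hρ]
  constructor
  · have hne : ∀ᵐ ρ ∂(volume.restrict (Ioi (0 : ℝ))), ρ ≠ 1 ∧ ρ ≠ ‖x‖ :=
      ae_restrict_of_ae ((Measure.ae_ne volume 1).and (Measure.ae_ne volume ‖x‖))
    filter_upwards [hne, ae_restrict_mem measurableSet_Ioi] with ρ hρne hρ
    have hρ0 : (0 : ℝ) < ρ := hρ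
    have hk := isKernelChain_annulusKernel β hr.le hρ0.le hρne.2.symm
    refine Continuous.intervalIntegrable ?_ _ _
    have e : circleIntegrand β (fun w => canonicalPreimage m β L w / (‖w‖ : ℂ)) x ρ = fun θ =>
        ((annulusKernel β ‖x‖ ρ 0 (cos (x.arg - θ)) : ℝ) : ℂ) *
          canonicalProfile m β L ρ (cos θ) := by
      funext θ
      rw [hcirc ρ hρ0, ← planeKernel_norm_sub β hr.le hρ0.le hρne.2.symm,
        Complex.norm_mul_exp_arg_mul_I]
    rw [e]
    exact (Complex.continuous_ofReal.comp (hk.continuous_comp 0 (by fun_prop)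
      fun θ => abs_cos_le_one _)).mul
      ((continuous_canonicalProfile hβ hβ' L hρ0 hρne.1).comp continuous_cos)
  · refine (integrableOn_canonicalShell hβ hβ' L hx).congr_fun (fun ρ hρ => ?_) measurableSet_Ioi
    simp only [canonicalShell, hcirc ρ hρ]

lemma isRdPreimage_canonicalPreimage (hβ : 0 < β) (hβ' : β < ((m + 1 : ℕ) : ℝ) + 1) (L : ℕ) :
    IsRdPreimage (m + 1) β (ladderFun (m + 1) β L) (canonicalPreimage m β L) :=
  ⟨canonicalPreimage_conj m β L, hasRdPow_canonicalPreimage hβ hβ' L,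
    inHhatDomain_canonicalPreimage hβ hβ' L⟩

end

end LadderShift

theorem proposition2 (l : ℕ) (hl : 0 < l) (β : ℝ) (hβ : 0 < β) (hβ' : β < (l : ℝ) + 1) :
    ∃ Φ : ℕ → ℂ → ℂ,
      (∀ L : ℕ, LadderShift.IsLadderFunction l β L (Φ L)) ∧
      ∀ L : ℕ, LadderShift.LoopOperatorMaps l β (Φ L) (Φ (L + 1)) := by
  obtain ⟨m, rfl⟩ : ∃ m, l = m + 1 := ⟨l - 1, by omega⟩
  exact ⟨LadderShift.ladderFun (m + 1) β, LadderShift.isLadderFunction_ladderFun (m + 1) β,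
    fun L => ⟨⟨_, LadderShift.isRdPreimage_canonicalPreimage hβ hβ' L⟩,
      fun g hg => LadderShift.hasRdPow_Hhat hβ hβ' L hg⟩⟩
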